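/- Consider the description logic $\mathcal{EL}$ with concepts $C ::= A \mid \top \mid C\sqcap C\mid \exists r.C$ and axioms $C\sqsubseteq D$ (GCIs), $C(a)$ and $r(a,b)$, where concept, role and individual names are finite bit strings. Write $O\models\alpha$ if every model of $O$ satisfies $\alpha$, and $C\sqsubseteq^\emptyset D$ if $\emptyset\models C\sqsubseteq D$. The reduced form of a concept is obtained by exhaustively replacing subconcepts $E\sqcap F$ with $E\sqsubseteq^\emptyset F$ by $E$, modulo associativity and commutativity of $\sqcap$. Write $C\sqsubset^{\mathit{syn}}D$ if $D$ is obtained from the reduced form of $C$ by replacing some (at least one) occurrences of subconcepts $\neq\top$ with $\top$; here the result is taken up to associativity and commutativity of $\sqcap$ and up to deletion of superfluous conjuncts $\top$ (i.e. $E\sqcap\top = E$). Write $(C\sqsubseteq D)\succ^{\mathit{syn}}(C'\sqsubseteq D')$ if $C=C'$, $D\sqsubset^{\mathit{syn}}D'$ and $\{C'\sqsubseteq D'\}\not\models C\sqsubseteq D$. Let $O = O_s\cup O_r$ be a finite ontology with static part $O_s$ and refutable part $O_r$. A justification for an axiom $\alpha$ in $O$ is a minimal subset $J$ of $O_r$ with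 $O_s\cup J\models\alpha$. For $\beta\in J$, an axiom $\gamma$ is a maximally strong weakening of $\beta$ in $J$ w.r.t. $\succ^{\mathit{syn}}$ if $\beta\succ^{\mathit{syn}}\gamma$, $O_s\cup(J\setminus\{\beta\})\cup\{\gamma\}\not\models\alpha$, and $O_s\cup(J\setminus\{\beta\})\cup\{\delta\}\models\alpha$ for all $\delta$ with $\beta\succ^{\mathit{syn}}\delta\succ^{\mathit{syn}}\gamma$. **Proposition.** There is an algorithm running in polynomial time that, given $O_s$, $\alpha$, a justification $J$ for $\alpha$ in $O_s\cup O_r$ and a GCI $\beta = (C\sqsubseteq D)\in J$, computes a maximally strong weakening of $\beta$ in $J$ w.r.t. $\succ^{\mathit{syn}}$. -/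

import Mathlib

/-! ## The description logic EL -/

namespace EL

/-- Names are finite bit strings. Concept, role and individual names are kept apart by the
constructors below, so the three sets of names are disjoint. -/
abbrev Name := List Bool

/-- EL concepts `A | ⊤ | C ⊓ D | ∃ r. C`. -/
inductive Concept where
  | top : Concept
  | atom (A : Name) : Concept
  | conj (C D : Concept) : Concept
  | ex (r : Name) (C : Concept) : Concept

/-- GCIs `C ⊑ D`, concept assertions `C(a)` and role assertions `r(a,b)`. -/
inductive Ax where
  | gci (C D : Concept) : Ax
  | concAssert (C : Concept) (a : Name) : Ax
  | roleAssert (r : Name) (a b : Name) : Ax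

structure Interp where
  dom : Type
  nonempty : Nonempty dom
  indiv : Name → dom
  conc : Name → Set dom
  role : Name → Set (dom × dom)

/-- The extension of a concept. -/
def Interp.ext (I : Interp) : Concept → Set I.dom
  | .top => Set.univ
  | .atom A => I.conc A
  | .conj C D => I.ext C ∩ I.ext D
  | .ex r C => {d | ∃ e ∈ I.ext C, (d, e) ∈ I.role r}

def Interp.Satisfies (I : Interp) : Ax → Prop
  | .gci C D => I.ext C ⊆ I.ext D
  | .concAssert C a => I.indiv a ∈ I.ext C
  | .roleAssert r a b => (I.indiv a, I.indiv b) ∈ I.role r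

/-- `O ⊨ α`: every model of `O` satisfies `α`. -/
def Entails (O : Set Ax) (α : Ax) : Prop :=
  ∀ I : Interp, (∀ γ ∈ O, I.Satisfies γ) → I.Satisfies α

/-- `C ⊑^∅ D`: the GCI `C ⊑ D` is a tautology. -/
def Subsumed (C D : Concept) : Prop := Entails ∅ (.gci C D)

/-! ## Reduced forms and syntactic generalization -/

/-- Equality of concepts up to associativity and commutativity of `⊓`. -/
inductive ACEq : Concept → Concept → Prop
  | refl (C : Concept) : ACEq C C
  | symm {C D : Concept} : ACEq C D → ACEq D C
  | trans {C D E : Concept} : ACEq C D → ACEq D E → ACEq C E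
  | conj {C C₁ D D₁ : Concept} : ACEq C C₁ → ACEq D D₁ → ACEq (.conj C D) (.conj C₁ D₁)
  | ex (r : Name) {C D : Concept} : ACEq C D → ACEq (.ex r C) (.ex r D)
  | assoc (C D E : Concept) : ACEq (.conj (.conj C D) E) (.conj C (.conj D E))
  | comm (C D : Concept) : ACEq (.conj C D) (.conj D C)

/-- Equality of concepts up to associativity and commutativity of `⊓` and up to deletion of
superfluous conjuncts `⊤` (that is, `C ⊓ ⊤ = C`). -/
inductive ACUEq : Concept → Concept → Prop
  | refl (C : Concept) : ACUEq C C
  | symm {C D : Concept} : ACUEq C D → ACUEq D C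
  | trans {C D E : Concept} : ACUEq C D → ACUEq D E → ACUEq C E
  | conj {C C₁ D D₁ : Concept} : ACUEq C C₁ → ACUEq D D₁ → ACUEq (.conj C D) (.conj C₁ D₁)
  | ex (r : Name) {C D : Concept} : ACUEq C D → ACUEq (.ex r C) (.ex r D)
  | assoc (C D E : Concept) : ACUEq (.conj (.conj C D) E) (.conj C (.conj D E))
  | comm (C D : Concept) : ACUEq (.conj C D) (.conj D C)
  | unit (C : Concept) : ACUEq (.conj C .top) C

/-- Replace one occurrence of a subconcept `E ⊓ F` with `E ⊑^∅ F` by `E`. -/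
inductive Contract : Concept → Concept → Prop
  | here {E F : Concept} : Subsumed E F → Contract (.conj E F) E
  | left {C C₁ : Concept} (D : Concept) : Contract C C₁ → Contract (.conj C D) (.conj C₁ D)
  | right (C : Concept) {D D₁ : Concept} : Contract D D₁ → Contract (.conj C D) (.conj C D₁)
  | ex (r : Name) {C C₁ : Concept} : Contract C C₁ → Contract (.ex r C) (.ex r C₁)

/-- One reduction step, modulo associativity and commutativity. -/
def RedStep (C D : Concept) : Prop :=
  ∃ C₁ D₁, ACEq C C₁ ∧ Contract C₁ D₁ ∧ ACEq D₁ D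

def IsReduced (C : Concept) : Prop := ∀ D, ¬ RedStep C D

/-- `C₁` is a reduced form of `C`: it results from exhaustively applying reduction steps. -/
def IsReducedForm (C C₁ : Concept) : Prop :=
  Relation.ReflTransGen RedStep C C₁ ∧ IsReduced C₁

/-- `Repl C D`: `D` is obtained from `C` by replacing some (possibly no) occurrences of
subconcepts by `⊤`. -/
inductive Repl : Concept → Concept → Prop
  | refl (C : Concept) : Repl C C
  | toTop (C : Concept) : Repl C .top
  | conj {C C₁ D D₁ : Concept} : Repl C C₁ → Repl D D₁ → Repl (.conj C D) (.conj C₁ D₁)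
  | ex (r : Name) {C D : Concept} : Repl C D → Repl (.ex r C) (.ex r D)

/-- `C ⊏^syn D`: `D` is obtained from the reduced form of `C` by replacing some occurrences of
subconcepts `≠ ⊤` with `⊤`. As replacing an occurrence of `⊤` by `⊤` changes nothing, `D₁ ≠ C₁`
says that at least one occurrence of a subconcept `≠ ⊤` is replaced. -/
def SynGen (C D : Concept) : Prop :=
  ∃ C₁ D₁, IsReducedForm C C₁ ∧ Repl C₁ D₁ ∧ D₁ ≠ C₁ ∧ ACUEq D D₁

/-- `β ≻^syn γ`. -/
def SynWeaker : Ax → Ax → Prop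
  | .gci C D, .gci C₁ D₁ => C = C₁ ∧ SynGen D D₁ ∧ ¬ Entails {.gci C₁ D₁} (.gci C D)
  | _, _ => False

/-! ## Justifications and maximally strong weakenings -/

/-- `J` is a justification of `α` in the ontology with static part `Os` and refutable part `Or`:
a minimal subset of `Or` that together with `Os` has the consequence `α`. -/
def IsJustification (Os Or : Set Ax) (α : Ax) (J : Set Ax) : Prop :=
  J ⊆ Or ∧ Entails (Os ∪ J) α ∧ ∀ K, K ⊂ J → ¬ Entails (Os ∪ K) α

/-- `γ` is a maximally strong weakening of `β` in `J` with respect to the relation `succ`. -/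
def IsMaxStrongWeakening (succ : Ax → Ax → Prop) (Os J : Set Ax) (α β γ : Ax) : Prop :=
  succ β γ ∧ ¬ Entails (Os ∪ (J \ {β}) ∪ {γ}) α ∧
    ∀ δ, succ β δ → succ δ γ → Entails (Os ∪ (J \ {β}) ∪ {δ}) α

end EL

/-! ## A machine model with a running time: WHILE programs on binary trees -/

namespace While

/-- The data on which programs work. -/
inductive Tree where
  | nil : Tree
  | cons (a b : Tree) : Tree
  deriving DecidableEq

def Tree.size : Tree → ℕ
  | .nil => 1
  | .cons a b => 1 + a.size + b.size

def Tree.hd : Tree → Tree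
  | .nil => .nil
  | .cons a _ => a

def Tree.tl : Tree → Tree
  | .nil => .nil
  | .cons _ b => b

abbrev Store := ℕ → Tree

inductive Expr where
  | var (x : ℕ) : Expr
  | nil : Expr
  | cons (e f : Expr) : Expr
  | hd (e : Expr) : Expr
  | tl (e : Expr) : Expr
  | eq (e f : Expr) : Expr

/-- The value of an expression; the truth values are `nil` (false) and `cons nil nil` (true). -/
def Expr.eval (σ : Store) : Expr → Tree
  | .var x => σ x
  | .nil => .nil
  | .cons e f => .cons (e.eval σ) (f.eval σ)
  | .hd e => (e.eval σ).hd
  | .tl e => (e.eval σ).tl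
  | .eq e f => if e.eval σ = f.eval σ then .cons .nil .nil else .nil

/-- The cost of evaluating an expression: the sum of the sizes of the values of all its
subexpressions, so that no operation is cheaper than writing down its operands and result. -/
def Expr.cost (σ : Store) : Expr → ℕ
  | .var x => (σ x).size
  | .nil => 1
  | .cons e f => e.cost σ + f.cost σ + (Expr.eval σ (.cons e f)).size
  | .hd e => e.cost σ + (Expr.eval σ (.hd e)).size
  | .tl e => e.cost σ + (Expr.eval σ (.tl e)).size
  | .eq e f => e.cost σ + f.cost σ + (Expr.eval σ (.eq e f)).size

inductive Cmd where
  | assign (x : ℕ) (e : Expr) : Cmd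
  | seq (c d : Cmd) : Cmd
  | ite (e : Expr) (c d : Cmd) : Cmd
  | loop (e : Expr) (c : Cmd) : Cmd

/-- `Exec c σ t τ`: started in store `σ`, the program `c` terminates in store `τ` with total
cost `t`. The command `loop e c` is `while e do c`. -/
inductive Exec : Cmd → Store → ℕ → Store → Prop
  | assign (x : ℕ) (e : Expr) (σ : Store) :
      Exec (.assign x e) σ (1 + e.cost σ) (Function.update σ x (e.eval σ))
  | seq {c d : Cmd} {σ τ ρ : Store} {t u : ℕ} :
      Exec c σ t τ → Exec d τ u ρ → Exec (.seq c d) σ (t + u) ρ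
  | iteTrue {e : Expr} {c d : Cmd} {σ τ : Store} {t : ℕ} :
      e.eval σ ≠ .nil → Exec c σ t τ → Exec (.ite e c d) σ (1 + e.cost σ + t) τ
  | iteFalse {e : Expr} {c d : Cmd} {σ τ : Store} {t : ℕ} :
      e.eval σ = .nil → Exec d σ t τ → Exec (.ite e c d) σ (1 + e.cost σ + t) τ
  | loopTrue {e : Expr} {c : Cmd} {σ τ ρ : Store} {t u : ℕ} :
      e.eval σ ≠ .nil → Exec c σ t τ → Exec (.loop e c) τ u ρ →
        Exec (.loop e c) σ (1 + e.cost σ + t + u) ρ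
  | loopFalse {e : Expr} {c : Cmd} {σ : Store} :
      e.eval σ = .nil → Exec (.loop e c) σ (1 + e.cost σ) σ

/-- The initial store: the input in variable `0`, and `nil` in all other variables. -/
def initStore (d : Tree) : Store := fun x => if x = 0 then d else .nil

/-- On input `d` the program `c` terminates with output `o` (the final value of variable `0`)
after `t` steps. -/
def Outputs (c : Cmd) (d o : Tree) (t : ℕ) : Prop :=
  ∃ τ : Store, Exec c (initStore d) t τ ∧ τ 0 = o

end While

/-! ## Encoding of the input and the output -/

namespace EL

open While

/-- Lists are encoded as `cons`-lists. -/
def encList {α : Type} (enc : α → Tree) : List α → Tree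
  | [] => .nil
  | a :: l => .cons (enc a) (encList enc l)

def encBool : Bool → Tree
  | false => .nil
  | true => .cons .nil .nil

def encName : Name → Tree := encList encBool

/-- Constructor tags. -/
def tag : ℕ → Tree
  | 0 => .nil
  | n + 1 => .cons .nil (tag n)

def Concept.enc : Concept → Tree
  | .top => .cons (tag 0) .nil
  | .atom A => .cons (tag 1) (encName A)
  | .conj C D => .cons (tag 2) (.cons C.enc D.enc)
  | .ex r C => .cons (tag 3) (.cons (encName r) C.enc)

def Ax.enc : Ax → Tree
  | .gci C D => .cons (tag 0) (.cons C.enc D.enc)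
  | .concAssert C a => .cons (tag 1) (.cons C.enc (encName a))
  | .roleAssert r a b => .cons (tag 2) (.cons (encName r) (.cons (encName a) (encName b)))

/-- The input of the problem: the static part, the justification, the consequence, and the axiom
of the justification that has to be weakened. -/
def encInput (os j : List Ax) (α β : Ax) : Tree :=
  .cons (encList Ax.enc os) (.cons (encList Ax.enc j) (.cons α.enc β.enc))

/-- The finite set of axioms given by a list. -/
def ontology (l : List Ax) : Set Ax := {γ | γ ∈ l}

end EL

/-! A concept is read as a finite tree whose items are its occurrences of atoms and existential
restrictions, each with a label and a parent. Subsumption is the existence of a map between items,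
in the opposite direction, that respects labels and parents (`IsHom.subsumed`,
`exists_isHom_of_subsumed`). Replacing subconcepts by `⊤` corresponds, up to `ACUEq`, to an
injective such map (`Repl.embeds`, `exists_repl_of_embeds`).

The reduced form need not be computed literally. Reduced concepts are cores (`IsReduced.isCore`) and
equivalent cores embed into each other (`IsCore.embeds`), so any core `R` equivalent to `D` serves
in its place. `reduce` finds one by deleting occurrences as long as equivalence persists, tested
with the completion procedure `entailsb`.

A candidate weakening is given by a parent-closed set `S` of items of `R`, and `climb` enlarges `S`
while `α` does not follow. The difficulty is that a concept `E` strictly between may embed into `R`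
along a copy of `S` other than `S` itself, so that maximality of `S` as a set says nothing about
`E`. Therefore `S` is kept rigid: every embedding of `S` into `R` maps `S` to `S`. Instead of a
single item `z`, the whole `Orbit` of `z` is added: all items with the label of `z` whose parent is
simulated by the parent of `z`. This preserves rigidity (`orbit_rigid`) and is logically no stronger
than adding `z` alone (`subsumed_orbit`). When no orbit can be added, adding any single item makes
`α` follow; and an `E` strictly above the result contains `S` and one more item (`Rigid.range_eq`,
`exists_insert`).

For the running time, `PolyTime` functions are shown to be closed under composition, case
distinction and loops with states of polynomial size. The function `weaken` is assembled from such
operations, and all its loops run for a number of rounds given by the length of a list. -/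

namespace While

/-! ### Sizes of trees and stores. -/

theorem Tree.size_pos (d : Tree) : 1 ≤ d.size := by
  cases d with
  | nil => exact le_rfl
  | cons a b => simp only [Tree.size]; omega

theorem Tree.size_hd_le (d : Tree) : d.hd.size ≤ d.size := by
  cases d with
  | nil => exact le_rfl
  | cons a b => simp only [Tree.size, Tree.hd]; omega

theorem Tree.size_tl_le (d : Tree) : d.tl.size ≤ d.size := by
  cases d with
  | nil => exact le_rfl
  | cons a b => simp only [Tree.size, Tree.tl]; omega

theorem Expr.size_eval_le_cost (σ : Store) (e : Expr) : (e.eval σ).size ≤ e.cost σ := by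
  cases e <;> simp only [Expr.cost] <;> first | exact le_rfl | omega

/-- Evaluating an expression costs at least the size of its value, so running time bounds growth.
Polynomial time bounds therefore yield polynomial bounds on outputs, which composition needs. -/
theorem Exec.size_le {c : Cmd} {σ τ : Store} {t : ℕ} (h : Exec c σ t τ) (x : ℕ) :
    (τ x).size ≤ (σ x).size + t := by
  induction h with
  | assign y e σ =>
    by_cases hx : x = y
    · subst hx
      simp only [Function.update_self]
      have := Expr.size_eval_le_cost σ e
      omega
    · simp [Function.update_of_ne hx]
  | seq _ _ ih₁ ih₂ => omega
  | iteTrue _ _ ih => omega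
  | iteFalse _ _ ih => omega
  | loopTrue _ _ _ ih₁ ih₂ => omega
  | loopFalse _ => omega

end While

theorem Polynomial.eval_mono_nat (p : Polynomial ℕ) {a b : ℕ} (h : a ≤ b) :
    p.eval a ≤ p.eval b := by
  rw [Polynomial.eval_eq_sum, Polynomial.eval_eq_sum]
  exact Finset.sum_le_sum fun i _ => Nat.mul_le_mul_left _ (Nat.pow_le_pow_left h i)

/-! ### Polynomial-time functions on encoded data. -/

namespace EL

open While

/-- Types whose elements are encoded as trees. -/
class TEnc (α : Type) where
  enc : α → Tree
  inj : Function.Injective enc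

instance : TEnc Tree := ⟨id, Function.injective_id⟩

instance : TEnc Bool := ⟨encBool, by intro a b; cases a <;> cases b <;> simp [encBool]⟩

instance {α : Type} [TEnc α] : TEnc (List α) :=
  ⟨encList TEnc.enc, by
    intro a
    induction a with
    | nil => intro b; cases b <;> simp [encList]
    | cons x l ih =>
      intro b
      cases b with
      | nil => simp [encList]
      | cons y m =>
        simp only [encList, Tree.cons.injEq, List.cons.injEq]
        exact fun h => ⟨TEnc.inj h.1, ih h.2⟩⟩

instance {α β : Type} [TEnc α] [TEnc β] : TEnc (α × β) :=
  ⟨fun x => .cons (TEnc.enc x.1) (TEnc.enc x.2), by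
    rintro ⟨a, b⟩ ⟨c, d⟩ h
    simp only [Tree.cons.injEq] at h
    exact Prod.ext (TEnc.inj h.1) (TEnc.inj h.2)⟩

instance {α : Type} [TEnc α] : TEnc (Option α) :=
  ⟨fun x => x.elim .nil fun a => .cons (TEnc.enc a) .nil, by
    rintro (_ | a) (_ | b) h <;> simp at h ⊢
    exact TEnc.inj h⟩

theorem tag_injective : Function.Injective tag := by
  intro a
  induction a with
  | zero => intro b; cases b <;> simp [tag]
  | succ n ih =>
    intro b
    cases b with
    | zero => simp [tag]
    | succ m => simp only [tag, Tree.cons.injEq, true_and, Nat.add_right_cancel_iff]; exact @ih m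

theorem encName_injective : Function.Injective encName :=
  TEnc.inj (α := List Bool)

instance : TEnc Concept :=
  ⟨Concept.enc, by
    intro a
    induction a with
    | top => intro b; cases b <;> simp [Concept.enc, tag]
    | atom A =>
      intro b
      cases b <;> simp [Concept.enc, tag]
      exact fun h => encName_injective h
    | conj C D ihC ihD =>
      intro b
      cases b <;> simp [Concept.enc, tag]
      exact fun h₁ h₂ => ⟨ihC h₁, ihD h₂⟩
    | ex r C ihC =>
      intro b
      cases b <;> simp [Concept.enc, tag]
      exact fun h₁ h₂ => ⟨encName_injective h₁, ihC h₂⟩⟩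

instance : TEnc Ax :=
  ⟨Ax.enc, by
    intro a b
    cases a <;> cases b <;> simp [Ax.enc, tag]
    · exact fun h₁ h₂ => ⟨TEnc.inj h₁, TEnc.inj h₂⟩
    · exact fun h₁ h₂ => ⟨TEnc.inj h₁, encName_injective h₂⟩
    · exact fun h₁ h₂ h₃ =>
        ⟨encName_injective h₁, encName_injective h₂, encName_injective h₃⟩⟩

/-- The size of the encoding. -/
def esize {α : Type} [TEnc α] (a : α) : ℕ := (TEnc.enc a).size

/-- Functions that are computed by programs in polynomial time. The program may be placed at any
variable `n`, which holds the input and the output; it keeps all variables below `n`. -/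
@[fun_prop]
def PolyTime {α β : Type} [TEnc α] [TEnc β] (f : α → β) : Prop :=
  ∃ (c : ℕ → Cmd) (p : Polynomial ℕ), ∀ (n : ℕ) (σ : Store) (a : α), σ n = TEnc.enc a →
    ∃ (t : ℕ) (τ : Store), Exec (c n) σ t τ ∧ τ n = TEnc.enc (f a) ∧ (∀ m < n, τ m = σ m) ∧
      t ≤ p.eval (esize a)

section Basic

variable {α β γ δ ι : Type} [TEnc α] [TEnc β] [TEnc γ] [TEnc δ] [TEnc ι]

theorem esize_pos (a : α) : 1 ≤ esize a := Tree.size_pos _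

@[simp] theorem esize_pair (a : α) (b : β) : esize (a, b) = 1 + esize a + esize b := rfl

@[simp] theorem esize_nil : esize ([] : List α) = 1 := rfl

@[simp] theorem esize_cons (a : α) (l : List α) : esize (a :: l) = 1 + esize a + esize l := rfl

theorem PolyTime.exists_size_le {f : α → β} (hf : PolyTime f) :
    ∃ q : Polynomial ℕ, ∀ a, esize (f a) ≤ q.eval (esize a) := by
  obtain ⟨c, p, h⟩ := hf
  refine ⟨Polynomial.X + p, fun a => ?_⟩
  obtain ⟨t, τ, hx, ho, -, ht⟩ := h 0 (fun _ => TEnc.enc a) a rfl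
  have := hx.size_le 0
  rw [ho] at this
  simp only [Polynomial.eval_add, Polynomial.eval_X]
  simp only [esize] at *
  omega

theorem PolyTime.of_expr {f : α → β} (e : ℕ → Expr) (p : Polynomial ℕ)
    (h : ∀ n (σ : Store) a, σ n = TEnc.enc a →
      (e n).eval σ = TEnc.enc (f a) ∧ (e n).cost σ ≤ p.eval (esize a)) : PolyTime f := by
  refine ⟨fun n => .assign n (e n), 1 + p, fun n σ a ha => ?_⟩
  refine ⟨_, _, Exec.assign n (e n) σ, ?_, ?_, ?_⟩
  · simpa using (h n σ a ha).1
  · intro m hm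
    simp [Function.update_of_ne hm.ne]
  · simpa using (h n σ a ha).2

/-- Trees encode themselves, so a function and its composite with the encoding are computed by the
same program. This allows destructors to be implemented on raw trees. -/
theorem PolyTime.of_enc {f : α → β} (h : PolyTime fun a => TEnc.enc (f a)) : PolyTime f := h

theorem PolyTime.to_enc {f : α → β} (h : PolyTime f) : PolyTime fun a => TEnc.enc (f a) := h

@[fun_prop]
theorem PolyTime.id : PolyTime (fun a : α => a) :=
  PolyTime.of_expr (fun n => .var n) Polynomial.X fun n σ a ha => by
    simp [Expr.eval, Expr.cost, ha, esize]

@[fun_prop]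
theorem PolyTime.const (b : β) : PolyTime (fun _ : α => b) := by
  have key : ∀ d : Tree, ∃ (e : Expr) (k : ℕ), ∀ σ, e.eval σ = d ∧ e.cost σ ≤ k := by
    intro d
    induction d with
    | nil => exact ⟨.nil, 1, fun σ => ⟨rfl, le_rfl⟩⟩
    | cons a b iha ihb =>
      obtain ⟨e, k, he⟩ := iha
      obtain ⟨f, l, hf⟩ := ihb
      refine ⟨.cons e f, k + l + (Tree.cons a b).size, fun σ => ⟨?_, ?_⟩⟩
      · simp [Expr.eval, he, hf]
      · simp only [Expr.cost, Expr.eval, (he σ).1, (hf σ).1]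
        have := (he σ).2
        have := (hf σ).2
        omega
  obtain ⟨e, k, he⟩ := key (TEnc.enc b)
  refine PolyTime.of_expr (fun _ => e) (Polynomial.C k) fun n σ a _ => ?_
  simpa using he σ

@[fun_prop]
theorem PolyTime.comp {g : β → γ} {f : α → β} (hg : PolyTime g) (hf : PolyTime f) :
    PolyTime (fun a => g (f a)) := by
  obtain ⟨q, hq⟩ := hf.exists_size_le
  obtain ⟨c, p, hc⟩ := hf
  obtain ⟨d, r, hd⟩ := hg
  refine ⟨fun n => .seq (c n) (d n), p + r.comp q, fun n σ a ha => ?_⟩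
  obtain ⟨t, τ, h₁, h₂, h₃, h₄⟩ := hc n σ a ha
  obtain ⟨u, ρ, k₁, k₂, k₃, k₄⟩ := hd n τ (f a) h₂
  refine ⟨_, _, h₁.seq k₁, k₂, fun m hm => (k₃ m hm).trans (h₃ m hm), ?_⟩
  simp only [Polynomial.eval_add, Polynomial.eval_comp]
  have := r.eval_mono_nat (hq a)
  omega

@[fun_prop]
theorem PolyTime.fst : PolyTime (fun x : α × β => x.1) :=
  PolyTime.of_expr (fun n => .hd (.var n)) (Polynomial.X + Polynomial.X) fun n σ a ha => by
    have h : σ n = .cons (TEnc.enc a.1) (TEnc.enc a.2) := ha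
    have h2 : (σ n).size = esize a := by rw [ha]; rfl
    have := Tree.size_hd_le (σ n)
    refine ⟨by simp [Expr.eval, h, Tree.hd], ?_⟩
    simp [Expr.cost, Expr.eval]
    omega

@[fun_prop]
theorem PolyTime.snd : PolyTime (fun x : α × β => x.2) :=
  PolyTime.of_expr (fun n => .tl (.var n)) (Polynomial.X + Polynomial.X) fun n σ a ha => by
    have h : σ n = .cons (TEnc.enc a.1) (TEnc.enc a.2) := ha
    have h2 : (σ n).size = esize a := by rw [ha]; rfl
    have := Tree.size_tl_le (σ n)
    refine ⟨by simp [Expr.eval, h, Tree.tl], ?_⟩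
    simp [Expr.cost, Expr.eval]
    omega

theorem PolyTime.hd : PolyTime Tree.hd :=
  PolyTime.of_expr (fun n => .hd (.var n)) (Polynomial.X + Polynomial.X) fun n σ a ha => by
    have h : σ n = a := ha
    have := Tree.size_hd_le a
    refine ⟨by simp [Expr.eval, h, TEnc.enc], ?_⟩
    simp [Expr.cost, Expr.eval, h, esize, TEnc.enc]
    omega

theorem PolyTime.tl : PolyTime Tree.tl :=
  PolyTime.of_expr (fun n => .tl (.var n)) (Polynomial.X + Polynomial.X) fun n σ a ha => by
    have h : σ n = a := ha
    have := Tree.size_tl_le a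
    refine ⟨by simp [Expr.eval, h, TEnc.enc], ?_⟩
    simp [Expr.cost, Expr.eval, h, esize, TEnc.enc]
    omega

@[fun_prop]
theorem PolyTime.pair {f : α → β} {g : α → γ} (hf : PolyTime f) (hg : PolyTime g) :
    PolyTime (fun a => (f a, g a)) := by
  obtain ⟨qf, hqf⟩ := hf.exists_size_le
  obtain ⟨qg, hqg⟩ := hg.exists_size_le
  obtain ⟨c, p, hc⟩ := hf
  obtain ⟨d, r, hd⟩ := hg
  -- `f` runs on a copy of the input at `n + 1` and `g` on a copy at `n + 2`, so that neither
  -- destroys the input at `n` and `g` keeps the value of `f`.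
  refine ⟨fun n => .seq (.assign (n + 1) (.var n)) (.seq (c (n + 1)) (.seq
    (.assign (n + 2) (.var n)) (.seq (d (n + 2))
      (.assign n (.cons (.var (n + 1)) (.var (n + 2))))))),
    3 + 2 * Polynomial.X + p + r + 2 * (qf + qg) + 1, fun n σ a ha => ?_⟩
  set σ₁ := Function.update σ (n + 1) (σ n) with hσ₁
  have e₁ : Exec (.assign (n + 1) (.var n)) σ _ σ₁ := Exec.assign _ _ _
  obtain ⟨t, τ, h₁, h₂, h₃, h₄⟩ := hc (n + 1) σ₁ a (by simp [hσ₁, ha])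
  have hτn : τ n = TEnc.enc a := by
    rw [h₃ n (by omega), hσ₁, Function.update_of_ne (by omega), ha]
  set τ₁ := Function.update τ (n + 2) (τ n) with hτ₁
  have e₂ : Exec (.assign (n + 2) (.var n)) τ _ τ₁ := Exec.assign _ _ _
  obtain ⟨u, ρ, k₁, k₂, k₃, k₄⟩ := hd (n + 2) τ₁ a (by simp [hτ₁, hτn])
  have hρ : ρ (n + 1) = TEnc.enc (f a) := by
    rw [k₃ (n + 1) (by omega), hτ₁, Function.update_of_ne (by omega), h₂]
  have e₃ := Exec.assign n (.cons (.var (n + 1)) (.var (n + 2))) ρ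
  refine ⟨_, _, e₁.seq (h₁.seq (e₂.seq (k₁.seq e₃))), ?_, ?_, ?_⟩
  · simp [Expr.eval, hρ, k₂, TEnc.enc]
  · intro m hm
    rw [Function.update_of_ne (by omega), k₃ m (by omega), hτ₁,
      Function.update_of_ne (by omega), h₃ m (by omega), hσ₁, Function.update_of_ne (by omega)]
  · have a1 := hqf a
    have a2 := hqg a
    simp only [Expr.cost, Expr.eval, hρ, k₂, ha, hτn, Tree.size]
    simp only [esize] at *
    simp only [Polynomial.eval_add, Polynomial.eval_mul, Polynomial.eval_X, Polynomial.eval_ofNat,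
      Polynomial.eval_one]
    omega

theorem PolyTime.treeCons {f g : α → Tree} (hf : PolyTime f) (hg : PolyTime g) :
    PolyTime (fun a => Tree.cons (f a) (g a)) :=
  hf.pair hg

/-- Equality, tested on the encodings. -/
def eqb (a b : β) : Bool := decide (TEnc.enc a = TEnc.enc b)

@[simp] theorem eqb_iff {a b : β} : eqb a b = true ↔ a = b := by
  simp only [eqb, decide_eq_true_eq]
  exact TEnc.inj.eq_iff

@[simp] theorem eqb_false_iff {a b : β} : eqb a b = false ↔ a ≠ b := by
  rw [← Bool.not_eq_true, eqb_iff]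

theorem PolyTime.eqb_pair : PolyTime (fun x : β × β => eqb x.1 x.2) :=
  PolyTime.of_expr (fun n => .eq (.hd (.var n)) (.tl (.var n))) (4 * Polynomial.X + 3)
    fun n σ a ha => by
      have h : σ n = .cons (TEnc.enc a.1) (TEnc.enc a.2) := ha
      have h2 : (σ n).size = esize a := by rw [ha]; rfl
      have := Tree.size_tl_le (σ n)
      have := Tree.size_hd_le (σ n)
      have e : (Expr.eq (.hd (.var n)) (.tl (.var n))).eval σ = TEnc.enc (eqb a.1 a.2) := by
        by_cases hb : TEnc.enc a.1 = TEnc.enc a.2 <;>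
          simp [Expr.eval, h, Tree.hd, Tree.tl, eqb, hb] <;> simp [TEnc.enc, encBool]
      refine ⟨e, ?_⟩
      have h3 : (TEnc.enc (eqb a.1 a.2)).size ≤ 3 := by
        cases eqb a.1 a.2 <;> simp [TEnc.enc, encBool, Tree.size]
      simp only [Expr.cost, e]
      simp [Expr.eval]
      omega

@[fun_prop]
theorem PolyTime.eqb {f g : α → β} (hf : PolyTime f) (hg : PolyTime g) :
    PolyTime (fun a => eqb (f a) (g a)) :=
  PolyTime.comp PolyTime.eqb_pair (hf.pair hg)

/-- Case distinction on a tree that is `nil` or the code of some `d : δ`. -/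
theorem PolyTime.caseTree {s : α → Tree} {g : α → β} {h : α × δ → β} {f : α → β}
    (hs : PolyTime s) (hg : PolyTime g) (hh : PolyTime h) (hnil : ∀ a, s a = .nil → f a = g a)
    (hcons : ∀ a, s a ≠ .nil → ∃ d, s a = TEnc.enc d ∧ f a = h (a, d)) : PolyTime f := by
  obtain ⟨qs, hqs⟩ := hs.exists_size_le
  obtain ⟨b, w, hb⟩ := hs
  obtain ⟨c, p, hc⟩ := hh
  obtain ⟨d, r, hd⟩ := hg
  -- The scrutinee is computed on a copy at `n + 1`. In the non-`nil` branch, consing it to the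
  -- input yields the code of the pair on which `h` works.
  refine ⟨fun n => .seq (.assign (n + 1) (.var n)) (.seq (b (n + 1)) (.ite (.var (n + 1))
    (.seq (.assign n (.cons (.var n) (.var (n + 1)))) (c n)) (d n))),
    4 + 4 * Polynomial.X + w + 4 * qs + p.comp (1 + Polynomial.X + qs) + r, fun n σ a ha => ?_⟩
  set σ₁ := Function.update σ (n + 1) (σ n) with hσ₁
  have e₁ : Exec (.assign (n + 1) (.var n)) σ _ σ₁ := Exec.assign _ _ _
  obtain ⟨t, τ, h₁, h₂, h₃, h₄⟩ := hb (n + 1) σ₁ a (by simp [hσ₁, ha])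
  have hτn : τ n = TEnc.enc a := by
    rw [h₃ n (by omega), hσ₁, Function.update_of_ne (by omega), ha]
  have a1 := hqs a
  by_cases hn : s a = .nil
  · obtain ⟨u, ρ, k₁, k₂, k₃, k₄⟩ := hd n τ a hτn
    refine ⟨_, _, e₁.seq (h₁.seq (Exec.iteFalse (by simp [Expr.eval, h₂, hn, TEnc.enc]) k₁)),
      ?_, ?_, ?_⟩
    · rw [k₂, hnil a hn]
    · intro m hm
      rw [k₃ m hm, h₃ m (by omega), hσ₁, Function.update_of_ne (by omega)]
    · simp only [Expr.cost, h₂, ha]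
      simp only [esize] at *
      simp only [Polynomial.eval_add, Polynomial.eval_mul, Polynomial.eval_X,
        Polynomial.eval_ofNat]
      omega
  · obtain ⟨e, he, hfe⟩ := hcons a hn
    set τ₁ := Function.update τ n (Tree.cons (τ n) (τ (n + 1))) with hτ₁
    have e₂ : Exec (.assign n (.cons (.var n) (.var (n + 1)))) τ _ τ₁ := Exec.assign _ _ _
    obtain ⟨u, ρ, k₁, k₂, k₃, k₄⟩ := hc n τ₁ (a, e) (by
      rw [hτ₁, Function.update_self, hτn, h₂, he]; rfl)
    refine ⟨_, _, e₁.seq (h₁.seq (Exec.iteTrue ?_ (e₂.seq k₁))), ?_, ?_, ?_⟩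
    · simpa [Expr.eval, h₂, TEnc.enc] using hn
    · rw [k₂, hfe]
    · intro m hm
      rw [k₃ m hm, hτ₁, Function.update_of_ne (by omega), h₃ m (by omega), hσ₁,
        Function.update_of_ne (by omega)]
    · have hse : esize e = esize (s a) := by rw [esize, ← he]; rfl
      have hm : p.eval (esize (a, e)) ≤ p.eval (1 + esize a + qs.eval (esize a)) :=
        p.eval_mono_nat (by simp only [esize_pair]; omega)
      simp only [Expr.cost, Expr.eval, h₂, ha, hτn, Tree.size]
      simp only [esize] at *
      simp only [Polynomial.eval_add, Polynomial.eval_mul, Polynomial.eval_X,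
        Polynomial.eval_ofNat, Polynomial.eval_comp, Polynomial.eval_one]
      omega

end Basic

end EL

/-! ### Control structures and list operations in polynomial time. -/

namespace EL

open While

/-- All pairs of elements of two lists. -/
def pairs {β γ : Type} (l : List β) (m : List γ) : List (β × γ) := l.flatMap fun x => m.map fun y => (x, y)

@[simp] theorem mem_pairs {β γ : Type} {l : List β} {m : List γ} {x : β × γ} :
    x ∈ pairs l m ↔ x.1 ∈ l ∧ x.2 ∈ m := by
  rcases x with ⟨x, y⟩
  simp [pairs]

section Control

variable {α β γ δ ι : Type} [TEnc α] [TEnc β] [TEnc γ] [TEnc δ] [TEnc ι]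

@[fun_prop]
theorem PolyTime.cond {b : α → Bool} {f g : α → β} (hb : PolyTime b) (hf : PolyTime f)
    (hg : PolyTime g) : PolyTime (fun a => bif b a then f a else g a) :=
  PolyTime.caseTree (δ := While.Tree) (h := fun x => f x.1) hb.to_enc hg (by fun_prop)
    (fun a h => by cases hb : b a <;> simp_all [TEnc.enc, encBool])
    (fun a h => ⟨_, rfl, by cases hb : b a <;> simp_all [TEnc.enc, encBool]⟩)

@[fun_prop]
theorem PolyTime.and {f g : α → Bool} (hf : PolyTime f) (hg : PolyTime g) :
    PolyTime (fun a => f a && g a) := by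
  have : (fun a => f a && g a) = fun a => bif f a then g a else false := by
    funext a; cases f a <;> rfl
  rw [this]; fun_prop

@[fun_prop]
theorem PolyTime.or {f g : α → Bool} (hf : PolyTime f) (hg : PolyTime g) :
    PolyTime (fun a => f a || g a) := by
  have : (fun a => f a || g a) = fun a => bif f a then true else g a := by
    funext a; cases f a <;> rfl
  rw [this]; fun_prop

@[fun_prop]
theorem PolyTime.not {f : α → Bool} (hf : PolyTime f) : PolyTime (fun a => !f a) := by
  have : (fun a => !f a) = fun a => bif f a then false else true := by
    funext a; cases f a <;> rfl
  rw [this]; fun_prop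

@[fun_prop]
theorem PolyTime.cons {f : α → β} {g : α → List β} (hf : PolyTime f) (hg : PolyTime g) :
    PolyTime (fun a => f a :: g a) :=
  (PolyTime.treeCons hf.to_enc hg.to_enc : _)

theorem PolyTime.of_listCases {l : α → List β} {g : α → γ} {h : α → β → List β → γ} {f : α → γ}
    (hl : PolyTime l) (hg : PolyTime g)
    (hh : PolyTime fun x : α × β × List β => h x.1 x.2.1 x.2.2)
    (hnil : ∀ a, l a = [] → f a = g a) (hcons : ∀ a y m, l a = y :: m → f a = h a y m) :
    PolyTime f :=
  PolyTime.caseTree (δ := β × List β) hl.to_enc hg hh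
    (fun a e => by
      cases hb : l a with
      | nil => exact hnil a hb
      | cons y m => simp [hb, TEnc.enc, encList] at e)
    (fun a e => by
      cases hb : l a with
      | nil => simp [hb, TEnc.enc, encList] at e
      | cons y m => exact ⟨(y, m), rfl, hcons a y m hb⟩)

theorem PolyTime.listCases {l : α → List β} {g : α → γ} {h : α → β → List β → γ}
    (hl : PolyTime l) (hg : PolyTime g)
    (hh : PolyTime fun x : α × β × List β => h x.1 x.2.1 x.2.2) :
    PolyTime (fun a => match l a with
      | [] => g a
      | y :: m => h a y m) :=
  PolyTime.of_listCases hl hg hh (fun a e => by rw [e]) (fun a y m e => by rw [e])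

@[fun_prop]
theorem PolyTime.some {f : α → β} (hf : PolyTime f) : PolyTime (fun a => some (f a)) :=
  (PolyTime.treeCons hf.to_enc (PolyTime.const While.Tree.nil) : _)

@[fun_prop]
theorem PolyTime.optionElim {o : α → Option β} {g : α → γ} {h : α → β → γ}
    (ho : PolyTime o) (hg : PolyTime g) (hh : PolyTime fun x : α × β => h x.1 x.2) :
    PolyTime (fun a => (o a).elim (g a) (h a)) :=
  PolyTime.caseTree (δ := β × While.Tree) (h := fun x => h x.1 x.2.1) ho.to_enc hg
    (PolyTime.comp hh (f := fun x : α × β × While.Tree => (x.1, x.2.1)) (by fun_prop))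
    (fun a e => by cases hb : o a <;> simp_all [TEnc.enc])
    (fun a e => by
      cases hb : o a with
      | none => simp_all [TEnc.enc]
      | some y => exact ⟨(y, While.Tree.nil), rfl, rfl⟩)

/-- Loops with polynomially many rounds and states of polynomial size. -/
theorem PolyTime.whileLoop {s : α → β} {b : β → Bool} {g : β → β} (hs : PolyTime s)
    (hb : PolyTime b) (hg : PolyTime g) (N : α → ℕ) (q r : Polynomial ℕ)
    (hN : ∀ a, N a ≤ r.eval (esize a)) (hlt : ∀ a, ∀ k < N a, b (g^[k] (s a)) = true)
    (hend : ∀ a, b (g^[N a] (s a)) = false)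
    (hq : ∀ a, ∀ k ≤ N a, esize (g^[k] (s a)) ≤ q.eval (esize a)) :
    PolyTime (fun a => g^[N a] (s a)) := by
  obtain ⟨cs, ps, hs⟩ := hs
  obtain ⟨cb, pb, hb⟩ := hb
  obtain ⟨cg, pg, hg⟩ := hg
  -- The test works on a copy, since the state at `n` has to survive. The loop body may overwrite `n
  -- + 1`, so the test is run again at the end of each round.
  let test : ℕ → Cmd := fun n => .seq (.assign (n + 1) (.var n)) (cb (n + 1))
  have htest : ∀ n (σ : Store) (x : β), σ n = TEnc.enc x → ∃ (t : ℕ) (τ : Store),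
      Exec (test n) σ t τ ∧ τ (n + 1) = TEnc.enc (b x) ∧ (∀ m ≤ n, τ m = σ m) ∧
        t ≤ 1 + esize x + pb.eval (esize x) := by
    intro n σ x hx
    set σ₁ := Function.update σ (n + 1) (σ n) with hσ₁
    have e₁ : Exec (.assign (n + 1) (.var n)) σ _ σ₁ := Exec.assign _ _ _
    obtain ⟨t, τ, h₁, h₂, h₃, h₄⟩ := hb (n + 1) σ₁ x (by simp [hσ₁, hx])
    refine ⟨_, _, e₁.seq h₁, h₂, fun m hm => ?_, ?_⟩
    · rw [h₃ m (by omega), hσ₁, Function.update_of_ne (by omega)]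
    · simp only [Expr.cost, hx]
      simp only [esize] at *
      omega
  have hbool : ∀ v : Bool, (TEnc.enc v).size ≤ 3 := by
    intro v; cases v <;> simp [TEnc.enc, encBool, Tree.size]
  -- A bound for one round: the guard, the body, and the test together with its copy of the state.
  let R : Polynomial ℕ := 5 + q + pg.comp q + pb.comp q
  have hloop : ∀ (n : ℕ) (a : α) (j k : ℕ), k + j = N a → ∀ σ : Store,
      σ n = TEnc.enc (g^[k] (s a)) → σ (n + 1) = TEnc.enc (b (g^[k] (s a))) →
      ∃ (t : ℕ) (τ : Store), Exec (.loop (.var (n + 1)) (.seq (cg n) (test n))) σ t τ ∧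
        τ n = TEnc.enc (g^[N a] (s a)) ∧ (∀ m < n, τ m = σ m) ∧
          t ≤ (j + 1) * R.eval (esize a) := by
    intro n a j
    induction j with
    | zero =>
      intro k hk σ h₁ h₂
      have hk' : k = N a := by omega
      subst hk'
      rw [hend] at h₂
      refine ⟨_, _, Exec.loopFalse (by simp [Expr.eval, h₂, TEnc.enc, encBool]), h₁,
        fun _ _ => rfl, ?_⟩
      simp only [Expr.cost, h₂, R, Polynomial.eval_add, Polynomial.eval_ofNat]
      have := hbool false
      omega
    | succ j ih =>
      intro k hk σ h₁ h₂
      rw [hlt a k (by omega)] at h₂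
      obtain ⟨t, τ, k₁, k₂, k₃, k₄⟩ := hg n σ _ h₁
      obtain ⟨u, ρ, l₁, l₂, l₃, l₄⟩ := htest n τ _ k₂
      rw [← Function.iterate_succ_apply' g k, Nat.succ_eq_add_one] at k₂ l₂ l₄
      obtain ⟨v, π, m₁, m₂, m₃, m₄⟩ := ih (k + 1) (by omega) ρ (by rw [l₃ n le_rfl, k₂]) l₂
      refine ⟨_, _, Exec.loopTrue (by simp [Expr.eval, h₂, TEnc.enc, encBool]) (k₁.seq l₁) m₁, m₂,
        fun m hm => by rw [m₃ m hm, l₃ m hm.le, k₃ m hm], ?_⟩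
      have b1 := hbool true
      have b2 := hq a k (by omega)
      have b3 := hq a (k + 1) (by omega)
      have b4 := pg.eval_mono_nat b2
      have b5 := pb.eval_mono_nat b3
      have : R.eval (esize a) = 5 + q.eval (esize a) + pg.eval (q.eval (esize a)) +
          pb.eval (q.eval (esize a)) := by simp [R]
      rw [Nat.succ_mul (j + 1)]
      simp only [Expr.cost, h₂]
      omega
  refine ⟨fun n => .seq (cs n) (.seq (test n) (.loop (.var (n + 1)) (.seq (cg n) (test n)))),
    ps + (1 + q + pb.comp q) + (r + 1) * R, fun n σ a ha => ?_⟩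
  obtain ⟨t, τ, k₁, k₂, k₃, k₄⟩ := hs n σ a ha
  obtain ⟨u, ρ, l₁, l₂, l₃, l₄⟩ := htest n τ _ k₂
  obtain ⟨v, π, m₁, m₂, m₃, m₄⟩ := hloop n a (N a) 0 (by omega) ρ (by rw [l₃ n le_rfl, k₂]; rfl) l₂
  refine ⟨_, _, k₁.seq (l₁.seq m₁), m₂, fun m hm => by rw [m₃ m hm, l₃ m hm.le, k₃ m hm], ?_⟩
  have b2 := hq a 0 (by omega)
  have b5 := pb.eval_mono_nat b2
  have b6 := Nat.mul_le_mul_right (R.eval (esize a)) (Nat.add_le_add_right (hN a) 1)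
  simp only [Function.iterate_zero, id_eq] at b2 b5
  simp only [Polynomial.eval_add, Polynomial.eval_mul, Polynomial.eval_one, Polynomial.eval_comp]
  omega

theorem esize_prod (x : α × β) : esize x = 1 + esize x.1 + esize x.2 := rfl

theorem length_le_esize (l : List α) : l.length ≤ esize l := by
  induction l with
  | nil => simp
  | cons x l ih => simp only [List.length_cons, esize_cons]; omega

theorem esize_le_of_mem {l : List α} {x : α} (h : x ∈ l) : esize x ≤ esize l := by
  induction l with
  | nil => simp at h
  | cons y l ih =>
    simp only [esize_cons]
    rcases List.mem_cons.1 h with rfl | h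
    · omega
    · have := ih h; omega

theorem esize_drop_le (l : List α) (k : ℕ) : esize (l.drop k) ≤ esize l := by
  induction l generalizing k with
  | nil => simp
  | cons y l ih =>
    cases k with
    | zero => simp
    | succ k => simp only [List.drop_succ_cons, esize_cons]; have := ih k; omega

theorem esize_sublist {l m : List α} (h : l.Sublist m) : esize l ≤ esize m := by
  induction h with
  | slnil => simp
  | cons a _ ih => simp only [esize_cons]; omega
  | cons_cons a _ ih => simp only [esize_cons]; omega

theorem esize_list_le {l : List α} {B : ℕ} (h : ∀ x ∈ l, esize x ≤ B) :
    esize l ≤ 1 + l.length * (B + 1) := by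
  induction l with
  | nil => simp
  | cons y l ih =>
    have := ih fun x hx => h x (by simp [hx])
    have := h y (by simp)
    simp only [esize_cons, List.length_cons, Nat.succ_mul]
    omega

@[fun_prop]
theorem PolyTime.isEmpty {l : α → List β} (hl : PolyTime l) :
    PolyTime (fun a => (l a).isEmpty) := by
  have : (fun a => (l a).isEmpty) = fun a => match l a with
      | [] => true
      | _ :: _ => false := by
    funext a
    cases l a <;> rfl
  rw [this]
  exact PolyTime.listCases hl (by fun_prop) (by fun_prop)

/-- Folding with states of polynomial size. -/
theorem PolyTime.foldl {l : α → List β} {s : α → γ} {g : α → γ → β → γ} (hl : PolyTime l)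
    (hs : PolyTime s) (hg : PolyTime fun x : α × γ × β => g x.1 x.2.1 x.2.2) (q : Polynomial ℕ)
    (hq : ∀ a k, esize (((l a).take k).foldl (g a) (s a)) ≤ q.eval (esize a)) :
    PolyTime (fun a => (l a).foldl (g a) (s a)) := by
  -- The loop state holds the parameter, the part of the list not yet consumed, and the accumulator.
  let st : α × List β × γ → α × List β × γ := fun x => match x.2.1 with
    | [] => x
    | y :: m => (x.1, m, g x.1 x.2.2 y)
  let b : α × List β × γ → Bool := fun x => match x.2.1 with
    | [] => false
    | _ :: _ => true
  have hst : PolyTime st := by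
    refine PolyTime.listCases (l := fun x : α × List β × γ => x.2.1) (by fun_prop) (by fun_prop)
      (h := fun x y m => (x.1, m, g x.1 x.2.2 y)) ?_
    refine PolyTime.pair (by fun_prop) (PolyTime.pair (by fun_prop) ?_)
    exact PolyTime.comp hg (f := fun x : (α × List β × γ) × β × List β =>
      (x.1.1, x.1.2.2, x.2.1)) (by fun_prop)
  have hb : PolyTime b := PolyTime.listCases
    (l := fun x : α × List β × γ => x.2.1) (h := fun _ _ _ => true) (by fun_prop) (by fun_prop) (by fun_prop)
  have hit : ∀ a k, k ≤ (l a).length → st^[k] (a, l a, s a) =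
      (a, (l a).drop k, ((l a).take k).foldl (g a) (s a)) := by
    intro a k
    induction k with
    | zero => simp
    | succ k ih =>
      intro hk
      rw [Function.iterate_succ_apply', ih (by omega)]
      have hd : (l a).drop k = (l a)[k] :: (l a).drop (k + 1) := List.drop_eq_getElem_cons (by omega)
      rw [List.take_succ_eq_append_getElem (i := k) (l := l a) (by omega), List.foldl_append]
      simp only [st]
      rw [hd]
      rfl
  obtain ⟨ql, hql⟩ := hl.exists_size_le
  have key := PolyTime.whileLoop (s := fun a => (a, l a, s a)) (b := b) (g := st)
    (by fun_prop) hb hst (fun a => (l a).length) (2 + Polynomial.X + ql + q) ql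
    (fun a => (length_le_esize _).trans (hql a))
    (fun a k hk => by
      rw [hit a k hk.le]
      have hd : (l a).drop k = (l a)[k] :: (l a).drop (k + 1) := List.drop_eq_getElem_cons hk
      simp only [b]
      rw [hd])
    (fun a => by rw [hit a _ le_rfl]; simp [b])
    (fun a k hk => by
      rw [hit a k hk]
      have h1 := esize_drop_le (l a) k
      have h2 := hql a
      have h3 := hq a k
      simp only [esize_pair, Polynomial.eval_add, Polynomial.eval_ofNat, Polynomial.eval_X]
      omega)
  have e : (fun a => (l a).foldl (g a) (s a)) =
      fun a => (st^[(l a).length] (a, l a, s a)).2.2 := by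
    funext a
    rw [hit a _ le_rfl, List.take_length]
  rw [e]
  exact PolyTime.snd.comp (PolyTime.snd.comp key)

/-- Folding with states that grow by a polynomial amount in each round. -/
theorem PolyTime.foldl_of_growth {l : α → List β} {s : α → γ} {g : α → γ → β → γ}
    (hl : PolyTime l) (hs : PolyTime s) (hg : PolyTime fun x : α × γ × β => g x.1 x.2.1 x.2.2)
    (q : Polynomial ℕ)
    (hq : ∀ a, ∀ y ∈ l a, ∀ z, esize (g a z y) ≤ esize z + q.eval (esize a)) :
    PolyTime (fun a => (l a).foldl (g a) (s a)) := by
  obtain ⟨ql, hql⟩ := hl.exists_size_le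
  obtain ⟨qs, hqs⟩ := hs.exists_size_le
  refine PolyTime.foldl hl hs hg (qs + ql * q) fun a k => ?_
  have key : ∀ (m : List β) (z : γ), (∀ y ∈ m, y ∈ l a) →
      esize (m.foldl (g a) z) ≤ esize z + m.length * q.eval (esize a) := by
    intro m
    induction m with
    | nil => intro z _; simp
    | cons y m ih =>
      intro z hm
      have h1 := ih (g a z y) fun w hw => hm w (by simp [hw])
      have h2 := hq a y (hm y (by simp)) z
      simp only [List.foldl_cons, List.length_cons, Nat.succ_mul]
      omega
  have h1 := key ((l a).take k) (s a) fun y hy => List.mem_of_mem_take hy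
  have h2 : ((l a).take k).length ≤ ql.eval (esize a) :=
    ((List.length_take_le' k _).trans (length_le_esize _)).trans (hql a)
  have h3 := Nat.mul_le_mul_right (q.eval (esize a)) h2
  have h4 := hqs a
  simp only [Polynomial.eval_add, Polynomial.eval_mul]
  omega

@[fun_prop]
theorem PolyTime.reverse {l : α → List β} (hl : PolyTime l) :
    PolyTime (fun a => (l a).reverse) := by
  obtain ⟨ql, hql⟩ := hl.exists_size_le
  have : (fun a => (l a).reverse) = fun a => (l a).foldl (fun s x => x :: s) [] := by
    funext a; simp
  rw [this]
  refine PolyTime.foldl_of_growth hl (by fun_prop) (by fun_prop) (1 + ql) fun a y hy z => ?_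
  have := esize_le_of_mem hy
  have := hql a
  simp only [esize_cons, Polynomial.eval_add, Polynomial.eval_one]
  omega

/-- Folding from the right with states that grow by a polynomial amount in each round. -/
theorem PolyTime.foldr_of_growth {l : α → List β} {s : α → γ} {g : α → β → γ → γ}
    (hl : PolyTime l) (hs : PolyTime s) (hg : PolyTime fun x : α × β × γ => g x.1 x.2.1 x.2.2)
    (q : Polynomial ℕ)
    (hq : ∀ a, ∀ y ∈ l a, ∀ z, esize (g a y z) ≤ esize z + q.eval (esize a)) :
    PolyTime (fun a => (l a).foldr (g a) (s a)) := by
  have : (fun a => (l a).foldr (g a) (s a)) =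
      fun a => (l a).reverse.foldl (fun z y => g a y z) (s a) := by
    funext a; simp
  rw [this]
  refine PolyTime.foldl_of_growth hl.reverse hs ?_ q fun a y hy z => hq a y (by simpa using hy) z
  exact PolyTime.comp hg (f := fun x : α × γ × β => (x.1, x.2.2, x.2.1)) (by fun_prop)

@[fun_prop]
theorem PolyTime.append {l m : α → List β} (hl : PolyTime l) (hm : PolyTime m) :
    PolyTime (fun a => l a ++ m a) := by
  obtain ⟨ql, hql⟩ := hl.exists_size_le
  have : (fun a => l a ++ m a) = fun a => (l a).foldr (fun x s => x :: s) (m a) := by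
    funext a; simp
  rw [this]
  refine PolyTime.foldr_of_growth hl hm (by fun_prop) (1 + ql) fun a y hy z => ?_
  have := esize_le_of_mem hy
  have := hql a
  simp only [esize_cons, Polynomial.eval_add, Polynomial.eval_one]
  omega

@[fun_prop]
theorem PolyTime.map {l : α → List β} {f : α → β → γ} (hl : PolyTime l)
    (hf : PolyTime fun x : α × β => f x.1 x.2) : PolyTime (fun a => (l a).map (f a)) := by
  obtain ⟨ql, hql⟩ := hl.exists_size_le
  obtain ⟨qf, hqf⟩ := hf.exists_size_le
  have : (fun a => (l a).map (f a)) = fun a => (l a).foldr (fun x s => f a x :: s) [] := by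
    funext a
    induction l a with
    | nil => rfl
    | cons x m ih => simp
  rw [this]
  refine PolyTime.foldr_of_growth hl (by fun_prop) ?_
    (1 + qf.comp (1 + Polynomial.X + ql)) fun a y hy z => ?_
  · exact PolyTime.cons (PolyTime.comp hf (f := fun x : α × β × List γ => (x.1, x.2.1))
      (by fun_prop)) (by fun_prop)
  · have h1 := esize_le_of_mem hy
    have h2 := hql a
    have h3 := hqf (a, y)
    have h4 : qf.eval (esize (a, y)) ≤ qf.eval (1 + esize a + ql.eval (esize a)) :=
      qf.eval_mono_nat (by simp only [esize_pair]; omega)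
    simp only [esize_cons, Polynomial.eval_add, Polynomial.eval_one, Polynomial.eval_comp,
      Polynomial.eval_X]
    simp only at h3
    omega

@[fun_prop]
theorem PolyTime.flatMap {l : α → List β} {f : α → β → List γ} (hl : PolyTime l)
    (hf : PolyTime fun x : α × β => f x.1 x.2) : PolyTime (fun a => (l a).flatMap (f a)) := by
  obtain ⟨ql, hql⟩ := hl.exists_size_le
  obtain ⟨qf, hqf⟩ := hf.exists_size_le
  have happ : ∀ m n : List γ, esize (m ++ n) ≤ esize n + esize m := by
    intro m n
    induction m with
    | nil => simp
    | cons x m ih => simp only [List.cons_append, esize_cons]; omega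
  have : (fun a => (l a).flatMap (f a)) = fun a => (l a).foldr (fun x s => f a x ++ s) [] := by
    funext a
    induction l a with
    | nil => rfl
    | cons x m ih => simp [ih]
  rw [this]
  refine PolyTime.foldr_of_growth hl (by fun_prop) ?_
    (qf.comp (1 + Polynomial.X + ql)) fun a y hy z => ?_
  · exact PolyTime.append (PolyTime.comp hf (f := fun x : α × β × List γ => (x.1, x.2.1))
      (by fun_prop)) (by fun_prop)
  · have h1 := esize_le_of_mem hy
    have h2 := hql a
    have h3 := hqf (a, y)
    have h4 : qf.eval (esize (a, y)) ≤ qf.eval (1 + esize a + ql.eval (esize a)) :=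
      qf.eval_mono_nat (by simp only [esize_pair]; omega)
    have h5 := happ (f a y) z
    simp only [Polynomial.eval_add, Polynomial.eval_one, Polynomial.eval_comp, Polynomial.eval_X]
    simp only at h3
    omega

@[fun_prop]
theorem PolyTime.filter {l : α → List β} {f : α → β → Bool} (hl : PolyTime l)
    (hf : PolyTime fun x : α × β => f x.1 x.2) : PolyTime (fun a => (l a).filter (f a)) := by
  have : (fun a => (l a).filter (f a)) =
      fun a => (l a).flatMap fun x => bif f a x then [x] else [] := by
    funext a
    induction l a with
    | nil => rfl
    | cons x m ih => cases h : f a x <;> simp [h, ih]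
  rw [this]
  exact PolyTime.flatMap hl (PolyTime.cond hf (by fun_prop) (by fun_prop))

theorem esize_bool_le (v : Bool) : esize v ≤ 3 := by
  cases v <;> simp [esize, TEnc.enc, encBool, Tree.size]

@[fun_prop]
theorem PolyTime.any {l : α → List β} {f : α → β → Bool} (hl : PolyTime l)
    (hf : PolyTime fun x : α × β => f x.1 x.2) : PolyTime (fun a => (l a).any (f a)) := by
  have : (fun a => (l a).any (f a)) = fun a => (l a).foldr (fun x s => f a x || s) false := by
    funext a
    induction l a with
    | nil => rfl
    | cons x m ih => simp [ih]
  rw [this]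
  refine PolyTime.foldr_of_growth hl (by fun_prop) ?_ 3 fun a y hy z => ?_
  · exact PolyTime.or (PolyTime.comp hf (f := fun x : α × β × Bool => (x.1, x.2.1))
      (by fun_prop)) (by fun_prop)
  · have := esize_bool_le (f a y || z)
    simp only [Polynomial.eval_ofNat]
    omega

@[fun_prop]
theorem PolyTime.all {l : α → List β} {f : α → β → Bool} (hl : PolyTime l)
    (hf : PolyTime fun x : α × β => f x.1 x.2) : PolyTime (fun a => (l a).all (f a)) := by
  have : (fun a => (l a).all (f a)) = fun a => !(l a).any fun x => !f a x := by
    funext a; exact List.all_eq_not_any_not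
  rw [this]
  exact PolyTime.not (PolyTime.any hl (PolyTime.not hf))

@[fun_prop]
theorem PolyTime.find? {l : α → List β} {f : α → β → Bool} (hl : PolyTime l)
    (hf : PolyTime fun x : α × β => f x.1 x.2) : PolyTime (fun a => (l a).find? (f a)) := by
  have : (fun a => (l a).find? (f a)) = fun a => match (l a).filter (f a) with
      | [] => none
      | x :: _ => Option.some x := by
    funext a
    rw [← List.head?_filter]
    cases (l a).filter (f a) <;> rfl
  rw [this]
  exact PolyTime.listCases (hl.filter hf) (by fun_prop) (by fun_prop)

@[fun_prop]
theorem PolyTime.pairs {l : α → List β} {m : α → List γ} (hl : PolyTime l) (hm : PolyTime m) :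
    PolyTime (fun a => pairs (l a) (m a)) := by
  unfold EL.pairs
  fun_prop

/-- Membership in a list. -/
def memb (x : β) (l : List β) : Bool := l.any fun y => eqb x y

@[simp] theorem memb_iff {x : β} {l : List β} : memb x l = true ↔ x ∈ l := by
  simp [memb]

@[fun_prop]
theorem PolyTime.memb {f : α → β} {l : α → List β} (hf : PolyTime f) (hl : PolyTime l) :
    PolyTime (fun a => memb (f a) (l a)) := by
  unfold EL.memb
  fun_prop

end Control

end EL

namespace EL

open While

/-! ### Constructors and destructors of concepts and axioms -/

def Concept.kind : Concept → ℕ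
  | .top => 0
  | .atom _ => 1
  | .conj _ _ => 2
  | .ex _ _ => 3

/-- The name at the root of an atom or an existential restriction. -/
def Concept.name : Concept → Name
  | .atom A => A
  | .ex r _ => r
  | _ => []

def Concept.left : Concept → Concept
  | .conj C _ => C
  | _ => .top

/-- The second conjunct, or the filler of an existential restriction. -/
def Concept.right : Concept → Concept
  | .conj _ D => D
  | .ex _ D => D
  | _ => .top

def Concept.isKind (k : ℕ) (C : Concept) : Bool := decide (C.kind = k)

def Ax.lhs : Ax → Concept
  | .gci C _ => C
  | .concAssert C _ => C
  | .roleAssert _ _ _ => .top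

def Ax.rhs : Ax → Concept
  | .gci _ D => D
  | _ => .top

def Ax.kind : Ax → ℕ
  | .gci _ _ => 0
  | .concAssert _ _ => 1
  | .roleAssert _ _ _ => 2

def Ax.isKind (k : ℕ) (x : Ax) : Bool := decide (x.kind = k)

/-- The first individual name of an assertion. -/
def Ax.fstInd : Ax → Name
  | .gci _ _ => []
  | .concAssert _ a => a
  | .roleAssert _ a _ => a

/-- The second individual name of a role assertion. -/
def Ax.sndInd : Ax → Name
  | .roleAssert _ _ b => b
  | _ => []

instance {α β : Type} [TEnc α] [TEnc β] : TEnc (α ⊕ β) :=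
  ⟨Sum.elim (fun a => .cons .nil (TEnc.enc a)) (fun b => .cons (.cons .nil .nil) (TEnc.enc b)), by
    rintro (a | a) (b | b) h <;> simp at h ⊢ <;> exact TEnc.inj h⟩

section

variable {α β γ : Type} [TEnc α] [TEnc β] [TEnc γ]

@[fun_prop]
theorem PolyTime.inl {f : α → β} (hf : PolyTime f) : PolyTime (fun a => (.inl (f a) : β ⊕ γ)) :=
  (PolyTime.treeCons (PolyTime.const While.Tree.nil) hf.to_enc : _)

@[fun_prop]
theorem PolyTime.inr {f : α → β} (hf : PolyTime f) : PolyTime (fun a => (.inr (f a) : γ ⊕ β)) :=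
  (PolyTime.treeCons (PolyTime.const (While.Tree.cons .nil .nil)) hf.to_enc : _)

theorem PolyTime.hdComp {f : α → While.Tree} (hf : PolyTime f) : PolyTime (fun a => (f a).hd) :=
  PolyTime.comp PolyTime.hd hf

theorem PolyTime.tlComp {f : α → While.Tree} (hf : PolyTime f) : PolyTime (fun a => (f a).tl) :=
  PolyTime.comp PolyTime.tl hf

end

section

variable {α : Type} [TEnc α]

@[fun_prop]
theorem PolyTime.conceptIsKind (k : ℕ) {f : α → Concept} (hf : PolyTime f) :
    PolyTime (fun a => (f a).isKind k) := by
  have : (fun a => (f a).isKind k) = fun a => EL.eqb (TEnc.enc (f a)).hd (tag k) := by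
    funext a
    have h : (TEnc.enc (f a)).hd = tag (f a).kind := by cases f a <;> rfl
    rw [h, Bool.eq_iff_iff]
    simp [Concept.isKind, tag_injective.eq_iff]
  rw [this]
  exact PolyTime.eqb (PolyTime.hdComp hf.to_enc) (PolyTime.const _)

@[fun_prop]
theorem PolyTime.axIsKind (k : ℕ) {f : α → Ax} (hf : PolyTime f) :
    PolyTime (fun a => (f a).isKind k) := by
  have : (fun a => (f a).isKind k) = fun a => EL.eqb (TEnc.enc (f a)).hd (tag k) := by
    funext a
    have h : (TEnc.enc (f a)).hd = tag (f a).kind := by cases f a <;> rfl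
    rw [h, Bool.eq_iff_iff]
    simp [Ax.isKind, tag_injective.eq_iff]
  rw [this]
  exact PolyTime.eqb (PolyTime.hdComp hf.to_enc) (PolyTime.const _)

@[fun_prop]
theorem PolyTime.conj {f g : α → Concept} (hf : PolyTime f) (hg : PolyTime g) :
    PolyTime (fun a => Concept.conj (f a) (g a)) :=
  (PolyTime.treeCons (PolyTime.const (tag 2)) (PolyTime.treeCons hf.to_enc hg.to_enc) : _)

@[fun_prop]
theorem PolyTime.ex {f : α → Name} {g : α → Concept} (hf : PolyTime f) (hg : PolyTime g) :
    PolyTime (fun a => Concept.ex (f a) (g a)) :=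
  (PolyTime.treeCons (PolyTime.const (tag 3)) (PolyTime.treeCons hf.to_enc hg.to_enc) : _)

@[fun_prop]
theorem PolyTime.gci {f g : α → Concept} (hf : PolyTime f) (hg : PolyTime g) :
    PolyTime (fun a => Ax.gci (f a) (g a)) :=
  (PolyTime.treeCons (PolyTime.const (tag 0)) (PolyTime.treeCons hf.to_enc hg.to_enc) : _)

@[fun_prop]
theorem PolyTime.concAssert {f : α → Concept} {g : α → Name} (hf : PolyTime f)
    (hg : PolyTime g) : PolyTime (fun a => Ax.concAssert (f a) (g a)) :=
  (PolyTime.treeCons (PolyTime.const (tag 1)) (PolyTime.treeCons hf.to_enc hg.to_enc) : _)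

@[fun_prop]
theorem PolyTime.roleAssert {f g h : α → Name} (hf : PolyTime f) (hg : PolyTime g)
    (hh : PolyTime h) : PolyTime (fun a => Ax.roleAssert (f a) (g a) (h a)) :=
  (PolyTime.treeCons (PolyTime.const (tag 2)) (PolyTime.treeCons hf.to_enc
    (PolyTime.treeCons hg.to_enc hh.to_enc)) : _)

@[fun_prop]
theorem PolyTime.conceptName {f : α → Concept} (hf : PolyTime f) :
    PolyTime (fun a => (f a).name) := by
  have : (fun a => TEnc.enc (f a).name) = fun a => bif (f a).isKind 1 then (TEnc.enc (f a)).tl else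
      bif (f a).isKind 3 then (TEnc.enc (f a)).tl.hd else .nil := by
    funext a
    cases f a <;> rfl
  refine PolyTime.of_enc ?_
  rw [this]
  have := PolyTime.tlComp hf.to_enc
  have := PolyTime.hdComp this
  fun_prop

@[fun_prop]
theorem PolyTime.conceptLeft {f : α → Concept} (hf : PolyTime f) :
    PolyTime (fun a => (f a).left) := by
  have : (fun a => TEnc.enc (f a).left) = fun a => bif (f a).isKind 2 then
      (TEnc.enc (f a)).tl.hd else TEnc.enc Concept.top := by
    funext a
    cases f a <;> rfl
  refine PolyTime.of_enc ?_
  rw [this]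
  have := PolyTime.hdComp (PolyTime.tlComp hf.to_enc)
  fun_prop

@[fun_prop]
theorem PolyTime.conceptRight {f : α → Concept} (hf : PolyTime f) :
    PolyTime (fun a => (f a).right) := by
  have : (fun a => TEnc.enc (f a).right) = fun a => bif (f a).isKind 2 || (f a).isKind 3 then
      (TEnc.enc (f a)).tl.tl else TEnc.enc Concept.top := by
    funext a
    cases f a <;> rfl
  refine PolyTime.of_enc ?_
  rw [this]
  have := PolyTime.tlComp (PolyTime.tlComp hf.to_enc)
  fun_prop

@[fun_prop]
theorem PolyTime.axLhs {f : α → Ax} (hf : PolyTime f) : PolyTime (fun a => (f a).lhs) := by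
  have : (fun a => TEnc.enc (f a).lhs) = fun a => bif (f a).isKind 2 then
      TEnc.enc Concept.top else (TEnc.enc (f a)).tl.hd := by
    funext a
    cases f a <;> rfl
  refine PolyTime.of_enc ?_
  rw [this]
  have := PolyTime.hdComp (PolyTime.tlComp hf.to_enc)
  fun_prop

@[fun_prop]
theorem PolyTime.axRhs {f : α → Ax} (hf : PolyTime f) : PolyTime (fun a => (f a).rhs) := by
  have : (fun a => TEnc.enc (f a).rhs) = fun a => bif (f a).isKind 0 then
      (TEnc.enc (f a)).tl.tl else TEnc.enc Concept.top := by
    funext a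
    cases f a <;> rfl
  refine PolyTime.of_enc ?_
  rw [this]
  have := PolyTime.tlComp (PolyTime.tlComp hf.to_enc)
  fun_prop

@[fun_prop]
theorem PolyTime.axFstInd {f : α → Ax} (hf : PolyTime f) : PolyTime (fun a => (f a).fstInd) := by
  have : (fun a => TEnc.enc (f a).fstInd) = fun a => bif (f a).isKind 0 then .nil else
      bif (f a).isKind 1 then (TEnc.enc (f a)).tl.tl else (TEnc.enc (f a)).tl.tl.hd := by
    funext a
    cases f a <;> rfl
  refine PolyTime.of_enc ?_
  rw [this]
  have h1 := PolyTime.tlComp (PolyTime.tlComp hf.to_enc)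
  have := PolyTime.hdComp h1
  fun_prop

@[fun_prop]
theorem PolyTime.axSndInd {f : α → Ax} (hf : PolyTime f) : PolyTime (fun a => (f a).sndInd) := by
  have : (fun a => TEnc.enc (f a).sndInd) = fun a => bif (f a).isKind 2 then
      (TEnc.enc (f a)).tl.tl.tl else .nil := by
    funext a
    cases f a <;> rfl
  refine PolyTime.of_enc ?_
  rw [this]
  have := PolyTime.tlComp (PolyTime.tlComp (PolyTime.tlComp hf.to_enc))
  fun_prop

end

theorem esize_top : esize Concept.top = 3 := rfl

theorem esize_conj (C D : Concept) : esize (Concept.conj C D) = 7 + esize C + esize D := by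
  change 1 + 5 + (1 + esize C + esize D) = _
  omega

theorem esize_ex (r : Name) (C : Concept) : esize (Concept.ex r C) = 9 + esize r + esize C := by
  change 1 + 7 + (1 + esize r + esize C) = _
  omega

theorem esize_bool_cons_le (b : Bool) (p : List Bool) : esize (b :: p) ≤ 4 + esize p := by
  have := esize_bool_le b
  simp only [esize_cons]
  omega

/-! ### Occurrences of subconcepts -/

/-- An occurrence of a subconcept: its position, the position of the filler of the innermost
existential restriction around it (or of the whole concept), and the subconcept. -/
abbrev Occ := List Bool × List Bool × Concept

/-- The occurrences of subconcepts of `C`, when `C` is found at position `p` below `q`. -/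
def occ (p q : List Bool) : Concept → List Occ
  | .top => [(p, q, .top)]
  | .atom A => [(p, q, .atom A)]
  | .conj C D => (p, q, .conj C D) :: (occ (false :: p) q C ++ occ (true :: p) q D)
  | .ex r C => (p, q, .ex r C) :: occ (false :: p) (false :: p) C

/-- The immediate subconcepts of an occurrence. -/
def occKids (e : Occ) : List Occ :=
  bif e.2.2.isKind 2 then
    [(false :: e.1, e.2.1, e.2.2.left), (true :: e.1, e.2.1, e.2.2.right)]
  else bif e.2.2.isKind 3 then [(false :: e.1, false :: e.1, e.2.2.right)] else []

def occOf (e : Occ) : List Occ := occ e.1 e.2.1 e.2.2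

/-- One unfolding of the preorder listing, in the form in which a worklist traversal performs it. -/
theorem occOf_eq (e : Occ) : occOf e = e :: (occKids e).flatMap occOf := by
  obtain ⟨p, q, C⟩ := e
  cases C <;> simp [occOf, occ, occKids, Concept.isKind, Concept.kind, Concept.left, Concept.right]

theorem occ_length_le (C : Concept) (p q : List Bool) : (occ p q C).length ≤ esize C := by
  induction C generalizing p q with
  | top => exact esize_pos _
  | atom A => exact esize_pos _
  | conj C D ihC ihD =>
    have := ihC (false :: p) q
    have := ihD (true :: p) q
    simp only [occ, List.length_cons, List.length_append, esize_conj]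
    omega
  | ex r C ih =>
    have := ih (false :: p) (false :: p)
    simp only [occ, List.length_cons, esize_ex]
    omega

theorem esize_of_mem_occ (C : Concept) (p q : List Bool) (e : Occ) (he : e ∈ occ p q C) :
    esize e.1 ≤ esize p + 4 * esize C ∧
      (esize e.2.1 ≤ esize q ∨ esize e.2.1 ≤ esize p + 4 * esize C) ∧
        esize e.2.2 ≤ esize C := by
  induction C generalizing p q with
  | top => simp [occ] at he; simp [he]
  | atom A => simp [occ] at he; simp [he]
  | conj C D ihC ihD =>
    simp only [occ, List.mem_cons, List.mem_append] at he
    have h1 := esize_bool_cons_le false p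
    have h2 := esize_bool_cons_le true p
    rw [esize_conj]
    rcases he with rfl | he | he
    · simp [esize_conj]
    · have := ihC _ _ he; omega
    · have := ihD _ _ he; omega
  | ex r C ih =>
    simp only [occ, List.mem_cons] at he
    have h1 := esize_bool_cons_le false p
    rw [esize_ex]
    rcases he with rfl | he
    · simp [esize_ex]
    · have := ih _ _ he; omega

theorem esize_occ_le (C : Concept) (p q : List Bool) :
    esize (occ p q C) ≤ 1 + esize C * (2 * esize p + esize q + 9 * esize C + 3) := by
  refine (esize_list_le (B := 2 * esize p + esize q + 9 * esize C + 2) fun e he => ?_).trans ?_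
  · have := esize_of_mem_occ C p q e he
    rw [esize_prod e, esize_prod e.2]
    omega
  · exact Nat.add_le_add_left (Nat.mul_le_mul_right _ (occ_length_le C p q)) 1

/-- One step of the traversal of a worklist of occurrences. -/
def occStep (x : List Occ × List Occ) : List Occ × List Occ :=
  match x.1 with
  | [] => x
  | e :: m => (occKids e ++ m, e :: x.2)

/-- Each pending occurrence heads its own listing, so the worklist is never larger than the output
still to come. This bounds the state of the traversal. -/
theorem sublist_flatMap_occOf (l : List Occ) : l.Sublist (l.flatMap occOf) := by
  induction l with
  | nil => simp
  | cons e m ih =>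
    rw [List.flatMap_cons, occOf_eq, List.cons_append]
    exact (ih.trans (List.sublist_append_right _ _)).cons_cons e

/-- Each step moves one entry of the preorder listing from the worklist to the reversed output. -/
theorem occStep_iterate (k : ℕ) (todo out : List Occ) (hk : k ≤ (todo.flatMap occOf).length) :
    ((occStep^[k] (todo, out)).1.flatMap occOf = (todo.flatMap occOf).drop k) ∧
      (occStep^[k] (todo, out)).2 = ((todo.flatMap occOf).take k).reverse ++ out := by
  induction k generalizing todo out with
  | zero => simp
  | succ k ih =>
    rw [Function.iterate_succ_apply]
    cases todo with
    | nil => simp at hk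
    | cons e m =>
      have h : (e :: m).flatMap occOf = e :: (occKids e ++ m).flatMap occOf := by
        rw [List.flatMap_cons, occOf_eq, List.flatMap_append, List.cons_append]
      rw [h] at hk ⊢
      have := ih (occKids e ++ m) (e :: out) (by simpa using hk)
      simpa [occStep] using this

@[fun_prop]
theorem PolyTime.occKids : PolyTime occKids := by
  unfold EL.occKids
  fun_prop

theorem PolyTime.occStep : PolyTime occStep := by
  refine PolyTime.of_listCases (l := fun x : List Occ × List Occ => x.1) (g := fun x => x)
    (h := fun x e m => (EL.occKids e ++ m, e :: x.2)) (by fun_prop) (by fun_prop) (by fun_prop)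
    ?_ ?_
  · rintro ⟨l, o⟩ h
    simp only at h
    subst h
    rfl
  · rintro ⟨l, o⟩ y m h
    simp only at h
    subst h
    rfl

theorem PolyTime.occ_root : PolyTime (fun C => occ [] [] C) := by
  have hf : ∀ C, [(([], [], C) : Occ)].flatMap occOf = occ [] [] C := by intro C; simp [occOf]
  let P : Polynomial ℕ := 1 + Polynomial.X * (6 + 9 * Polynomial.X)
  have hP : ∀ C, esize (occ [] [] C) ≤ P.eval (esize C) := by
    intro C
    have := esize_occ_le C [] []
    have h1 : 2 * esize ([] : List Bool) + esize ([] : List Bool) + 9 * esize C + 3 =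
      6 + 9 * esize C := by rw [esize_nil]; omega
    rw [h1] at this
    simpa [P] using this
  have hr : ∀ l m : List Occ, esize (l.reverse ++ m) = esize l + esize m - 1 := by
    intro l
    induction l with
    | nil => intro m; simp
    | cons x l ih =>
      intro m
      rw [List.reverse_cons, List.append_assoc, ih]
      have := esize_pos m
      simp only [esize_cons, List.singleton_append]
      omega
  have key := PolyTime.whileLoop (s := fun C : Concept => ([(([], [], C) : Occ)], ([] : List Occ)))
    (b := fun x : List Occ × List Occ => !x.1.isEmpty) (g := EL.occStep) (by fun_prop)
    (by fun_prop)
    PolyTime.occStep (fun C => (occ [] [] C).length) (1 + 2 * P) Polynomial.X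
    (fun C => by simpa using occ_length_le C [] [])
    (fun C k hk => by
      have h := (occStep_iterate k [([], [], C)] [] (by rw [hf]; exact hk.le)).1
      cases h2 : (EL.occStep^[k] ([([], [], C)], [])).1 with
      | nil =>
        rw [h2, hf] at h
        have := congrArg List.length h
        simp at this
        omega
      | cons e m => simp)
    (fun C => by
      have h := (occStep_iterate (occ [] [] C).length [([], [], C)] [] (by rw [hf])).1
      cases h2 : (EL.occStep^[(occ [] [] C).length] ([([], [], C)], [])).1 with
      | nil => simp
      | cons e m =>
        rw [h2, hf, List.drop_length, List.flatMap_cons, occOf_eq] at h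
        simp at h)
    (fun C k hk => by
      have h := occStep_iterate k [([], [], C)] [] (by rw [hf]; exact hk)
      rw [hf] at h
      rw [esize_prod, h.2, hr]
      have h1 := esize_sublist (sublist_flatMap_occOf (EL.occStep^[k] ([([], [], C)], [])).1)
      rw [h.1] at h1
      have h2 := esize_drop_le (occ [] [] C) k
      have h3 := esize_sublist (List.take_sublist k (occ [] [] C))
      have h4 := hP C
      simp only [Polynomial.eval_add, Polynomial.eval_mul, Polynomial.eval_one,
        Polynomial.eval_ofNat, esize_nil]
      omega)
  have e : (fun C => occ [] [] C) = fun C =>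
      (EL.occStep^[(occ [] [] C).length] ([(([], [], C) : Occ)], ([] : List Occ))).2.reverse := by
    funext C
    have h := (occStep_iterate (occ [] [] C).length [([], [], C)] [] (by rw [hf])).2
    rw [h, hf]
    simp
  rw [e]
  exact PolyTime.reverse (PolyTime.snd.comp key)

@[fun_prop]
theorem PolyTime.occ {α : Type} [TEnc α] {f : α → Concept} (hf : PolyTime f) :
    PolyTime (fun a => occ [] [] (f a)) :=
  PolyTime.comp PolyTime.occ_root hf

/-! ### Restriction to a set of positions -/

/-- Replace by `⊤` all atoms and existential restrictions at positions that are not in `S`. -/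
def restr (S : List (List Bool)) (p : List Bool) : Concept → Concept
  | .top => .top
  | .atom A => bif memb p S then .atom A else .top
  | .conj C D => .conj (restr S (false :: p) C) (restr S (true :: p) D)
  | .ex r C => bif memb p S then .ex r (restr S (false :: p) C) else .top

/-- One step of the computation of `restr` with a stack of results. -/
def restrStep (S : List (List Bool)) (e : Occ) (st : List Concept) : List Concept :=
  bif e.2.2.isKind 2 then .conj (st.headD .top) (st.tail.headD .top) :: st.tail.tail
  else bif e.2.2.isKind 3 then
    (bif memb e.1 S then .ex e.2.2.name (st.headD .top) else .top) :: st.tail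
  else bif memb e.1 S then e.2.2 :: st else .top :: st

/-- The preorder listing is prefix notation. Read from the right, it finds the results for the
arguments of each constructor on top of the stack. -/
theorem foldr_restrStep (S : List (List Bool)) (C : Concept) (p q : List Bool)
    (st : List Concept) : (occ p q C).foldr (restrStep S) st = restr S p C :: st := by
  induction C generalizing p q st with
  | top => cases h : memb p S <;> simp [occ, restr, restrStep, Concept.isKind, Concept.kind, h]
  | atom A => cases h : memb p S <;> simp [occ, restr, restrStep, Concept.isKind, Concept.kind, h]
  | conj C D ihC ihD =>
    simp [occ, restr, restrStep, Concept.isKind, Concept.kind, ihC, ihD]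
  | ex r C ih =>
    simp [occ, restr, restrStep, Concept.isKind, Concept.kind, Concept.name, ih]

section

variable {α β : Type} [TEnc α] [TEnc β]

@[fun_prop]
theorem PolyTime.tail {l : α → List β} (hl : PolyTime l) : PolyTime (fun a => (l a).tail) := by
  have : (fun a => (l a).tail) = fun a => match l a with
      | [] => []
      | _ :: m => m := by
    funext a
    cases l a <;> rfl
  rw [this]
  exact PolyTime.listCases hl (by fun_prop) (by fun_prop)

@[fun_prop]
theorem PolyTime.headD {l : α → List β} {f : α → β} (hl : PolyTime l) (hf : PolyTime f) :
    PolyTime (fun a => (l a).headD (f a)) := by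
  have : (fun a => (l a).headD (f a)) = fun a => match l a with
      | [] => f a
      | x :: _ => x := by
    funext a
    cases l a <;> rfl
  rw [this]
  exact PolyTime.listCases hl (by fun_prop) (by fun_prop)

end

theorem PolyTime.restr_pair :
    PolyTime (fun x : List (List Bool) × Concept => restr x.1 [] x.2) := by
  have e : (fun x : List (List Bool) × Concept => restr x.1 [] x.2) =
      fun x => ((EL.occ [] [] x.2).foldr (restrStep x.1) []).headD .top := by
    funext x
    rw [foldr_restrStep]
    rfl
  obtain ⟨q, hq⟩ := PolyTime.occ_root.exists_size_le
  rw [e]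
  -- A step adds to the stack at most one constructor, its name, and default values `⊤` for missing
  -- arguments; `20` covers the tags and the defaults.
  refine PolyTime.headD (PolyTime.foldr_of_growth (by fun_prop) (by fun_prop) ?_
    (20 + q.comp Polynomial.X + q) ?_) (by fun_prop)
  · unfold restrStep
    fun_prop
  · intro x e he st
    have h1 := esize_le_of_mem he
    have h2 := hq x.2
    have h3 : esize e.2.2 ≤ esize e := by
      rw [esize_prod e, esize_prod e.2]; omega
    have h4 : q.eval (esize x.2) ≤ q.eval (esize x) :=
      q.eval_mono_nat (by rw [esize_prod x]; omega)
    have h5 := esize_top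
    simp only [Polynomial.eval_add, Polynomial.eval_ofNat, Polynomial.eval_comp, Polynomial.eval_X]
    have h6 : esize (restrStep x.1 e st) ≤ esize st + 20 + esize e.2.2 := by
      obtain ⟨p, r, C⟩ := e
      cases C with
      | top =>
        cases h : EL.memb p x.1 <;>
          simp [restrStep, Concept.isKind, Concept.kind, h, esize_top] <;> omega
      | atom A =>
        cases h : EL.memb p x.1 <;>
          simp [restrStep, Concept.isKind, Concept.kind, h, esize_top] <;> omega
      | conj C D =>
        rcases st with _ | ⟨a, _ | ⟨b, m⟩⟩ <;>
          simp [restrStep, Concept.isKind, Concept.kind, esize_conj, esize_top] <;> omega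
      | ex s C =>
        rcases st with _ | ⟨a, m⟩ <;> cases h : EL.memb p x.1 <;>
          simp [restrStep, Concept.isKind, Concept.kind, Concept.name, esize_ex, esize_top, h] <;>
          omega
    omega

@[fun_prop]
theorem PolyTime.restr {α : Type} [TEnc α] {S : α → List (List Bool)} {f : α → Concept}
    (hS : PolyTime S) (hf : PolyTime f) : PolyTime (fun a => restr (S a) [] (f a)) :=
  PolyTime.comp PolyTime.restr_pair (hS.pair hf)

end EL

namespace EL

open While

/-- The list `l a` serves as a unary counter: only its length matters. -/
theorem PolyTime.iterate_of_growth {α β γ : Type} [TEnc α] [TEnc β] [TEnc γ]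
    {l : α → List β} {s : α → γ} {g : α → γ → γ} (hl : PolyTime l) (hs : PolyTime s)
    (hg : PolyTime fun x : α × γ => g x.1 x.2) (q : Polynomial ℕ)
    (hq : ∀ a z, esize (g a z) ≤ esize z + q.eval (esize a)) :
    PolyTime (fun a => (g a)^[(l a).length] (s a)) := by
  have key : ∀ a (m : List β) z, m.foldl (fun z _ => g a z) z = (g a)^[m.length] z := by
    intro a m
    induction m with
    | nil => simp
    | cons y m ih => intro z; simp [ih]
  simp_rw [← key]
  refine PolyTime.foldl_of_growth hl hs ?_ q fun a y _ z => hq a z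
  exact PolyTime.comp hg (f := fun x : α × γ × β => (x.1, x.2.1)) (by fun_prop)

/-! ### The algorithms -/

def subterms (C : Concept) : List Concept := (occ [] [] C).map fun e => e.2.2

/-- The subconcepts that occur in a list of axioms. -/
def subs (O : List Ax) : List Concept :=
  .top :: O.flatMap fun x => subterms x.lhs ++ subterms x.rhs

/-- The individual names that occur in a list of axioms. -/
def inds (O : List Ax) : List Name := O.flatMap fun x => [x.fstInd, x.sndInd]

/-- Elements of the canonical model: one for each concept and one for each individual. -/
abbrev Node := Concept ⊕ Name

/-- The fact that an element of the canonical model belongs to a concept. -/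
abbrev Fact := Node × Concept

def nodes (O : List Ax) : List Node := (subs O).map .inl ++ (inds O).map .inr

def facts (O : List Ax) : List Fact := pairs (nodes O) (subs O)

/-- Facts that follow from `S` and `O` in one step. -/
def derivable (O : List Ax) (S : List Fact) (f : Fact) : Bool :=
  eqb f.1 (.inl f.2) || f.2.isKind 0 ||
  O.any (fun x => eqb x (.concAssert f.2 x.fstInd) && eqb f.1 (.inr x.fstInd)) ||
  S.any (fun g => eqb g.1 f.1 && ((g.2.isKind 2 && (eqb g.2.left f.2 || eqb g.2.right f.2)) ||
    memb (.gci g.2 f.2) O)) ||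
  (f.2.isKind 2 && memb (f.1, f.2.left) S && memb (f.1, f.2.right) S) ||
  (f.2.isKind 3 && (
    S.any (fun g => eqb g.1 f.1 && eqb g.2 (.ex f.2.name g.2.right) &&
      memb (.inl g.2.right, f.2.right) S) ||
    O.any (fun x => eqb x (.roleAssert f.2.name x.fstInd x.sndInd) && eqb f.1 (.inr x.fstInd) &&
      memb (.inr x.sndInd, f.2.right) S)))

/-- Filtering the fixed universe `U`, instead of appending to `S`, keeps every stage a sublist of
`U`. Sizes stay bounded, and the length measures progress. -/
def closeStep (O : List Ax) (U S : List Fact) : List Fact :=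
  U.filter fun f => memb f S || derivable O S f

/-- The facts in `U` that follow from `O`. -/
def closure (O : List Ax) (U : List Fact) : List Fact := (closeStep O U)^[U.length] []

/-- The decision procedure for entailment. -/
def entailsb (O : List Ax) (α : Ax) : Bool :=
  bif α.isKind 0 then memb (.inl α.lhs, α.rhs) (closure O (facts (α :: O)))
  else bif α.isKind 1 then memb (.inr α.fstInd, α.lhs) (closure O (facts (α :: O)))
  else memb α O

/-- The occurrences of atoms and existential restrictions. -/
def items (C : Concept) : List Occ :=
  (occ [] [] C).filter fun e => e.2.2.isKind 1 || e.2.2.isKind 3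

/-- If the item at `p` is an existential restriction, its whole filler disappears too, although the
positions below `p` stay in the list. -/
def without (C : Concept) (p : List Bool) : Concept :=
  restr (((items C).filter fun e => !eqb e.1 p).map fun e => e.1) [] C

/-- Deleting an occurrence always generalizes, so equivalence with `D` requires a test in one
direction only. -/
def reduceStep (D R : Concept) : Concept :=
  ((items R).find? fun z => entailsb [] (.gci (without R z.1) D)).elim R fun z => without R z.1

/-- Delete occurrences from `D` as long as the result is still equivalent to `D`. -/
def reduce (D : Concept) : Concept := (reduceStep D)^[(items D).length] D

def Concept.label (C : Concept) : Bool × Name := (C.isKind 3, C.name)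

/-- The root and the fillers of the existential restrictions at positions in `P`. -/
def nodeIds (P : List (List Bool)) : List (List Bool) := [] :: P.map fun p => false :: p

/-- The condition on a pair of nodes in the definition of `simRel`. -/
def simOk (V : List Occ) (P : List (List Bool)) (B : List (List Bool × List Bool))
    (x : List Bool × List Bool) : Bool :=
  ((eqb x.1 [] && eqb x.2 []) || V.any fun i => eqb (false :: i.1) x.1 && V.any fun j =>
    eqb (false :: j.1) x.2 && eqb i.2.2.label j.2.2.label && memb (i.2.1, j.2.1) B) &&
  V.all fun j => !(memb j.1 P && eqb j.2.1 x.2) || V.any fun i =>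
    memb i.1 P && eqb i.2.1 x.1 && memb (false :: i.1, false :: j.1) B

/-- The greatest relation between nodes that matches the paths to the root, and each child of the
second node with a child of the first. -/
def simRel (V : List Occ) (P : List (List Bool)) : List (List Bool × List Bool) :=
  (fun B => B.filter (simOk V P B))^[(pairs (nodeIds P) (nodeIds P)).length]
    (pairs (nodeIds P) (nodeIds P))

/-- Add to `P` the positions of all occurrences similar to `z`. -/
def extend (V : List Occ) (P : List (List Bool)) (z : Occ) : List (List Bool) :=
  P ++ (V.filter fun w => !memb w.1 P && eqb w.2.2.label z.2.2.label &&
    memb (z.2.1, w.2.1) (simRel V P)).map fun w => w.1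

/-- A candidate `z` has to hang directly below the root or an item of `P`, so that the set of
positions remains closed under parents. -/
def climbStep (O : List Ax) (α : Ax) (C R : Concept) (P : List (List Bool)) :
    List (List Bool) :=
  ((items R).find? fun z => !memb z.1 P && memb z.2.1 (nodeIds P) &&
    !entailsb (.gci C (restr (extend (items R) P z) [] R) :: O) α).elim P fun z =>
      extend (items R) P z

/-- Extend the empty set of positions as long as `α` does not follow. -/
def climb (O : List Ax) (α : Ax) (C R : Concept) : List (List Bool) :=
  (climbStep O α C R)^[(items R).length] []

def weakenRhs (O : List Ax) (α : Ax) (C R : Concept) : Ax :=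
  .gci C (restr (climb O α C R) [] R)

/-- The algorithm for maximally strong weakenings. -/
def weaken (x : List Ax × List Ax × Ax × Ax) : Ax :=
  weakenRhs (x.1 ++ x.2.1.filter fun y => !eqb y x.2.2.2) x.2.2.1 x.2.2.2.lhs
    (reduce x.2.2.2.rhs)

/-! ### Running times -/

theorem esize_filter_le {β : Type} [TEnc β] (l : List β) (f : β → Bool) :
    esize (l.filter f) ≤ esize l := esize_sublist List.filter_sublist

section

variable {α : Type} [TEnc α]

@[fun_prop]
theorem PolyTime.derivable {O : α → List Ax} {S : α → List Fact} {f : α → Fact}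
    (hO : PolyTime O) (hS : PolyTime S) (hf : PolyTime f) :
    PolyTime (fun a => derivable (O a) (S a) (f a)) := by
  unfold EL.derivable
  fun_prop

@[fun_prop]
theorem PolyTime.facts {O : α → List Ax} (hO : PolyTime O) :
    PolyTime (fun a => facts (O a)) := by
  unfold EL.facts EL.nodes EL.subs EL.inds EL.subterms
  fun_prop

@[fun_prop]
theorem PolyTime.closure {O : α → List Ax} {U : α → List Fact}
    (hO : PolyTime O) (hU : PolyTime U) : PolyTime (fun a => closure (O a) (U a)) := by
  unfold EL.closure
  obtain ⟨q, hq⟩ := hU.exists_size_le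
  refine PolyTime.iterate_of_growth hU (by fun_prop) ?_ q fun a z => ?_
  · unfold closeStep
    fun_prop
  · have h1 := esize_filter_le (U a) fun f => EL.memb f z || EL.derivable (O a) z f
    have h2 := hq a
    unfold closeStep
    omega

@[fun_prop]
theorem PolyTime.entailsb {O : α → List Ax} {f : α → Ax}
    (hO : PolyTime O) (hf : PolyTime f) : PolyTime (fun a => entailsb (O a) (f a)) := by
  unfold EL.entailsb
  fun_prop

@[fun_prop]
theorem PolyTime.items {f : α → Concept} (hf : PolyTime f) :
    PolyTime (fun a => items (f a)) := by
  unfold EL.items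
  fun_prop

@[fun_prop]
theorem PolyTime.without {f : α → Concept} {p : α → List Bool} (hf : PolyTime f)
    (hp : PolyTime p) : PolyTime (fun a => without (f a) (p a)) := by
  unfold EL.without
  fun_prop

/-- Restriction never enlarges a concept, which permits the growth bound `0` for the loop of
`reduce`. -/
theorem esize_restr_le (S : List (List Bool)) (p : List Bool) (C : Concept) :
    esize (restr S p C) ≤ esize C := by
  have h3 : ∀ C : Concept, 3 ≤ esize C := by
    intro C
    cases C <;> simp [esize, TEnc.enc, Concept.enc, While.Tree.size] <;>
      (have := While.Tree.size_pos; grind)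
  induction C generalizing p with
  | top => exact le_rfl
  | atom A =>
    cases h : memb p S
    · simpa [restr, h, esize_top] using h3 _
    · simp [restr, h]
  | conj C D ihC ihD =>
    have := ihC (false :: p)
    have := ihD (true :: p)
    simp only [restr, esize_conj]
    omega
  | ex r C ih =>
    cases h : memb p S
    · simpa [restr, h, esize_top] using h3 _
    · have := ih (false :: p)
      simp only [restr, h, esize_ex, cond_true]
      omega

@[fun_prop]
theorem PolyTime.reduce {f : α → Concept} (hf : PolyTime f) :
    PolyTime (fun a => reduce (f a)) := by
  unfold EL.reduce
  refine PolyTime.iterate_of_growth (g := fun a => reduceStep (f a)) (by fun_prop) (by fun_prop)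
    ?_ 0 fun a z => ?_
  · unfold reduceStep
    fun_prop
  · unfold reduceStep
    cases (EL.items z).find? fun w => EL.entailsb [] (.gci (EL.without z w.1) (f a)) with
    | none => simp
    | some w =>
      simp only [Option.elim_some, Polynomial.eval_zero, Nat.add_zero]
      exact esize_restr_le _ _ _

@[fun_prop]
theorem PolyTime.label {f : α → Concept} (hf : PolyTime f) :
    PolyTime (fun a => (f a).label) := by
  unfold Concept.label
  fun_prop

@[fun_prop]
theorem PolyTime.nodeIds {f : α → List (List Bool)} (hf : PolyTime f) :
    PolyTime (fun a => nodeIds (f a)) := by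
  unfold EL.nodeIds
  fun_prop

@[fun_prop]
theorem PolyTime.simOk {V : α → List Occ} {P : α → List (List Bool)}
    {B : α → List (List Bool × List Bool)} {x : α → List Bool × List Bool}
    (hV : PolyTime V) (hP : PolyTime P) (hB : PolyTime B) (hx : PolyTime x) :
    PolyTime (fun a => simOk (V a) (P a) (B a) (x a)) := by
  unfold EL.simOk
  fun_prop

@[fun_prop]
theorem PolyTime.simRel {V : α → List Occ} {P : α → List (List Bool)}
    (hV : PolyTime V) (hP : PolyTime P) : PolyTime (fun a => simRel (V a) (P a)) := by
  unfold EL.simRel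
  refine PolyTime.iterate_of_growth (by fun_prop) (by fun_prop) (by fun_prop) 0 fun a z => ?_
  simpa using esize_filter_le _ _

@[fun_prop]
theorem PolyTime.extend {V : α → List Occ} {P : α → List (List Bool)} {z : α → Occ}
    (hV : PolyTime V) (hP : PolyTime P) (hz : PolyTime z) :
    PolyTime (fun a => extend (V a) (P a) (z a)) := by
  unfold EL.extend
  fun_prop

theorem esize_append {β : Type} [TEnc β] (l m : List β) :
    esize (l ++ m) ≤ esize l + esize m := by
  induction l with
  | nil => simp
  | cons x l ih => simp only [List.cons_append, esize_cons]; omega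

theorem esize_map_fst_le {β γ : Type} [TEnc β] [TEnc γ] (l : List (β × γ)) :
    esize (l.map fun w => w.1) ≤ esize l := by
  induction l with
  | nil => simp
  | cons x l ih =>
    simp only [List.map_cons, esize_cons]
    have := esize_prod x
    omega

@[fun_prop]
theorem PolyTime.climb {O : α → List Ax} {x : α → Ax} {C R : α → Concept} (hO : PolyTime O)
    (hx : PolyTime x) (hC : PolyTime C) (hR : PolyTime R) :
    PolyTime (fun a => climb (O a) (x a) (C a) (R a)) := by
  have hV := PolyTime.items hR
  obtain ⟨q, hq⟩ := hV.exists_size_le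
  unfold EL.climb
  refine PolyTime.iterate_of_growth (g := fun a => climbStep (O a) (x a) (C a) (R a)) hV
    (by fun_prop) ?_ q fun a z => ?_
  · unfold climbStep
    fun_prop
  · unfold climbStep
    have h1 : ∀ w, esize (EL.extend (EL.items (R a)) z w) ≤ esize z + q.eval (esize a) := by
      intro w
      unfold EL.extend
      exact (esize_append _ _).trans (Nat.add_le_add_left
        (((esize_map_fst_le _).trans (esize_filter_le _ _)).trans (hq a)) _)
    cases (EL.items (R a)).find? fun w => !EL.memb w.1 z && EL.memb w.2.1 (EL.nodeIds z) &&
        !EL.entailsb (.gci (C a) (EL.restr (EL.extend (EL.items (R a)) z w) [] (R a)) :: O a)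
          (x a) with
    | none => simp
    | some w => exact h1 w

theorem PolyTime.weaken : PolyTime weaken := by
  unfold EL.weaken EL.weakenRhs
  fun_prop

end

end EL

namespace EL

/-! ### Correctness of the decision procedure for entailment -/

/-- The algorithms iterate a fixed number of times instead of testing for stability. A measure
bounded by `B` that grows at every non-stationary step forces a fixed point after `B` rounds. -/
theorem iterate_fixed {X : Type*} {f : X → X} (P : X → Prop) (μ : X → ℕ) (B : ℕ)
    (hP : ∀ x, P x → P (f x)) (hμ : ∀ x, P x → f x = x ∨ μ x < μ (f x))
    (hB : ∀ x, P x → μ x ≤ B) {s : X} (hs : P s) :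
    f (f^[B] s) = f^[B] s ∧ P (f^[B] s) := by
  have hPk : ∀ k, P (f^[k] s) := by
    intro k
    induction k with
    | zero => exact hs
    | succ k ih => rw [Function.iterate_succ_apply']; exact hP _ ih
  refine ⟨?_, hPk B⟩
  have key : ∀ k, f (f^[k] s) = f^[k] s ∨ k < μ (f^[k + 1] s) := by
    intro k
    induction k with
    | zero =>
      rcases hμ _ (hPk 0) with h | h
      · exact .inl h
      · exact .inr ((Nat.zero_le _).trans_lt h)
    | succ k ih =>
      rw [Function.iterate_succ_apply']
      rcases ih with h | h
      · rw [h]; exact .inl h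
      · rcases hμ _ (hPk (k + 1)) with h' | h'
        · rw [Function.iterate_succ_apply'] at h'
          exact .inl h'
        · right
          rw [Function.iterate_succ_apply' f (k + 1)]
          omega
  rcases key B with h | h
  · exact h
  · exact absurd (hB _ (hPk (B + 1))) (by omega)

theorem filter_eq_or_length_lt {X : Type*} (l : List X) (p q : X → Bool)
    (h : ∀ x ∈ l, p x = true → q x = true) :
    l.filter q = l.filter p ∨ (l.filter p).length < (l.filter q).length := by
  have hs : (l.filter p).Sublist (l.filter q) := by
    have : l.filter p = (l.filter q).filter p := by
      rw [List.filter_filter]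
      refine List.filter_congr fun x hx => ?_
      cases hp : p x
      · simp
      · simp [h x hx hp]
    rw [this]
    exact List.filter_sublist
  rcases hs.length_le.lt_or_eq with hl | hl
  · exact .inr hl
  · exact .inl (hs.eq_of_length hl).symm

theorem closeStep_closure (O : List Ax) (U : List Fact) :
    closeStep O U (closure O U) = closure O U := by
  refine (iterate_fixed (fun S => ∃ p, S = U.filter p) List.length U.length ?_ ?_ ?_
    (s := []) ⟨fun _ => false, by simp⟩).1
  · rintro S -
    exact ⟨_, rfl⟩
  · rintro S ⟨p, rfl⟩
    refine filter_eq_or_length_lt U p _ fun x hx hp => ?_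
    simp only [Bool.or_eq_true, memb_iff, List.mem_filter]
    exact .inl ⟨hx, hp⟩
  · rintro S ⟨p, rfl⟩
    exact List.length_filter_le _ _

@[simp] theorem Concept.isKind_iff {k : ℕ} {C : Concept} : C.isKind k = true ↔ C.kind = k := by
  simp [Concept.isKind]

theorem Concept.kind_eq_zero {C : Concept} : C.kind = 0 ↔ C = .top := by
  cases C <;> simp [Concept.kind]

theorem Concept.kind_eq_two {C : Concept} : C.kind = 2 ↔ C = .conj C.left C.right := by
  cases C <;> simp [Concept.kind, Concept.left, Concept.right]

theorem Concept.kind_eq_three {C : Concept} : C.kind = 3 ↔ C = .ex C.name C.right := by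
  cases C <;> simp [Concept.kind, Concept.name, Concept.right]

/-- The meaning of a fact in an interpretation. -/
def Interp.Holds (I : Interp) (f : Fact) : Prop :=
  match f.1 with
  | .inl E => I.ext E ⊆ I.ext f.2
  | .inr a => I.indiv a ∈ I.ext f.2

theorem Interp.Holds.mono {I : Interp} {n : Node} {F G : Concept} (h : I.Holds (n, F))
    (hFG : I.ext F ⊆ I.ext G) : I.Holds (n, G) := by
  cases n with
  | inl E => exact Set.Subset.trans h hFG
  | inr a => exact hFG h

/-- Soundness of the completion rules, checked rule by rule. -/
theorem holds_of_derivable {I : Interp} {O : List Ax} (hO : ∀ γ ∈ O, I.Satisfies γ)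
    {S : List Fact} (hS : ∀ f ∈ S, I.Holds f) {f : Fact} (hf : derivable O S f = true) :
    I.Holds f := by
  obtain ⟨n, F⟩ := f
  simp only [derivable, Bool.or_eq_true, Bool.and_eq_true, eqb_iff, List.any_eq_true, memb_iff,
    Concept.isKind_iff] at hf
  rcases hf with ((((rfl | h) | ⟨x, hx, h1, h2⟩) | ⟨g, hg, h1, h2⟩) | ⟨⟨h1, h2⟩, h3⟩) | ⟨h1, h2⟩
  · exact Set.Subset.rfl
  · rw [Concept.kind_eq_zero] at h
    subst h
    cases n with
    | inl E => exact Set.subset_univ _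
    | inr a => exact Set.mem_univ _
  · subst h2
    rw [h1] at hx
    exact hO _ hx
  · obtain ⟨m, G⟩ := g
    simp only at h1 h2
    subst h1
    rcases h2 with ⟨h2, h3⟩ | h2
    · rw [Concept.kind_eq_two] at h2
      refine (hS _ hg).mono ?_
      rw [h2]
      rcases h3 with h3 | h3
      · rw [h3]; exact Set.inter_subset_left
      · rw [h3]; exact Set.inter_subset_right
    · exact (hS _ hg).mono (hO _ h2)
  · rw [Concept.kind_eq_two] at h1
    rw [h1]
    have a1 := hS _ h2
    have a2 := hS _ h3
    cases n with
    | inl E => exact Set.subset_inter a1 a2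
    | inr a => exact ⟨a1, a2⟩
  · rw [Concept.kind_eq_three] at h1
    rcases h2 with ⟨g, hg, ⟨h3, h4⟩, h5⟩ | ⟨x, hx, ⟨h3, h4⟩, h5⟩
    · obtain ⟨m, G⟩ := g
      simp only at h3 h4 h5
      subst h3
      refine (hS _ hg).mono ?_
      rw [h4, h1]
      rintro d ⟨e, he, hde⟩
      exact ⟨e, hS _ h5 he, hde⟩
    · subst h4
      rw [h1]
      rw [h3] at hx
      exact ⟨_, hS _ h5, hO _ hx⟩

theorem holds_of_mem_closure {I : Interp} {O : List Ax} (hO : ∀ γ ∈ O, I.Satisfies γ)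
    (U : List Fact) {f : Fact} (hf : f ∈ closure O U) : I.Holds f := by
  have : ∀ k, ∀ f ∈ (closeStep O U)^[k] [], I.Holds f := by
    intro k
    induction k with
    | zero => simp
    | succ k ih =>
      intro f hf
      rw [Function.iterate_succ_apply'] at hf
      simp only [closeStep, List.mem_filter, Bool.or_eq_true, memb_iff] at hf
      rcases hf.2 with h | h
      · exact ih f h
      · exact holds_of_derivable hO ih h
  exact this _ f hf

theorem mem_subterms_self (C : Concept) : C ∈ subterms C := by
  cases C <;> simp [subterms, occ]

theorem mem_occ_kids {C : Concept} (p q : List Bool) {e : Occ} (he : e ∈ occ p q C) :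
    ∀ e' ∈ occKids e, e' ∈ occ p q C := by
  induction C generalizing p q with
  | top => simp only [occ, List.mem_singleton] at he; subst he; simp [occKids, Concept.isKind, Concept.kind]
  | atom A => simp only [occ, List.mem_singleton] at he; subst he; simp [occKids, Concept.isKind, Concept.kind]
  | conj C D ihC ihD =>
    simp only [occ, List.mem_cons, List.mem_append] at he ⊢
    rcases he with rfl | he | he
    · have h1 : ∀ (D : Concept) p q, (p, q, D) ∈ occ p q D := by intro D p q; cases D <;> simp [occ]
      intro e' he'
      simp [occKids, Concept.isKind, Concept.kind, Concept.left, Concept.right] at he'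
      rcases he' with rfl | rfl
      · exact .inr (.inl (h1 _ _ _))
      · exact .inr (.inr (h1 _ _ _))
    · exact fun e' he' => .inr (.inl (ihC _ _ he e' he'))
    · exact fun e' he' => .inr (.inr (ihD _ _ he e' he'))
  | ex r C ih =>
    simp only [occ, List.mem_cons] at he ⊢
    rcases he with rfl | he
    · have h1 : ∀ (D : Concept) p q, (p, q, D) ∈ occ p q D := by intro D p q; cases D <;> simp [occ]
      intro e' he'
      simp [occKids, Concept.isKind, Concept.kind, Concept.right] at he'
      subst he'
      exact .inr (h1 _ _ _)
    · exact fun e' he' => .inr (ih _ _ he e' he')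

theorem subterms_conj {C D E : Concept} (h : Concept.conj C D ∈ subterms E) :
    C ∈ subterms E ∧ D ∈ subterms E := by
  simp only [subterms, List.mem_map] at h ⊢
  obtain ⟨e, he, h⟩ := h
  have hk := mem_occ_kids [] [] he
  simp only [occKids, h, Concept.isKind, Concept.kind, Concept.left, Concept.right] at hk
  exact ⟨⟨_, hk _ (by simp; exact .inl rfl), rfl⟩, ⟨_, hk _ (by simp; exact .inr rfl), rfl⟩⟩

theorem subterms_ex {r : Name} {C E : Concept} (h : Concept.ex r C ∈ subterms E) :
    C ∈ subterms E := by
  simp only [subterms, List.mem_map] at h ⊢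
  obtain ⟨e, he, h⟩ := h
  have hk := mem_occ_kids [] [] he
  simp only [occKids, h, Concept.isKind, Concept.kind, Concept.right] at hk
  exact ⟨_, hk _ (by simp; rfl), rfl⟩

theorem mem_subs {O : List Ax} {C : Concept} :
    C ∈ subs O ↔ C = .top ∨ ∃ x ∈ O, C ∈ subterms x.lhs ∨ C ∈ subterms x.rhs := by
  simp [subs]

theorem subs_conj {O : List Ax} {C D : Concept} (h : Concept.conj C D ∈ subs O) :
    C ∈ subs O ∧ D ∈ subs O := by
  rw [mem_subs] at h
  rcases h with h | ⟨x, hx, h | h⟩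
  · simp at h
  · exact ⟨mem_subs.2 (.inr ⟨x, hx, .inl (subterms_conj h).1⟩),
      mem_subs.2 (.inr ⟨x, hx, .inl (subterms_conj h).2⟩)⟩
  · exact ⟨mem_subs.2 (.inr ⟨x, hx, .inr (subterms_conj h).1⟩),
      mem_subs.2 (.inr ⟨x, hx, .inr (subterms_conj h).2⟩)⟩

theorem subs_ex {O : List Ax} {r : Name} {C : Concept} (h : Concept.ex r C ∈ subs O) :
    C ∈ subs O := by
  rw [mem_subs] at h ⊢
  rcases h with h | ⟨x, hx, h | h⟩
  · simp at h
  · exact .inr ⟨x, hx, .inl (subterms_ex h)⟩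
  · exact .inr ⟨x, hx, .inr (subterms_ex h)⟩

/-- The canonical model given by a set of facts. -/
noncomputable def canonical (O : List Ax) (S : List Fact) (N : List Node) (d : {n : Node // n ∈ N}) :
    Interp where
  dom := {n : Node // n ∈ N}
  nonempty := ⟨d⟩
  -- Names outside `N` do not occur in the axioms considered, so any element will do for them.
  indiv a := open Classical in if h : .inr a ∈ N then ⟨.inr a, h⟩ else d
  conc A := {n | (n.1, .atom A) ∈ S}
  -- The successor demanded by a fact about `∃ r. E` is the node of `E` itself. Two individuals are
  -- linked only by an asserted role, so the model refutes all other role assertions.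
  role r := {x | (∃ E, x.2.1 = .inl E ∧ (x.1.1, .ex r E) ∈ S) ∨
    ∃ a b, x.1.1 = .inr a ∧ x.2.1 = .inr b ∧ .roleAssert r a b ∈ O}

/-- The truth lemma for the canonical model. Restricting attention to `T`, which is closed under
subconcepts, suffices for the induction; the node of `C` satisfies `C` by the reflexivity rule. -/
theorem mem_canonical_ext {O : List Ax} {S : List Fact} {N : List Node} {T : List Concept}
    (d : {n : Node // n ∈ N}) (hTN : ∀ C ∈ T, .inl C ∈ N)
    (hconj : ∀ C D, .conj C D ∈ T → C ∈ T ∧ D ∈ T) (hex : ∀ r C, .ex r C ∈ T → C ∈ T)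
    (hclosed : ∀ f : Fact, f.1 ∈ N → f.2 ∈ T → derivable O S f = true → f ∈ S)
    {C : Concept} (hC : C ∈ T) (n : (canonical O S N d).dom) :
    n ∈ (canonical O S N d).ext C ↔ (n.1, C) ∈ S := by
  have hcl : ∀ f : Fact, f.1 ∈ N → f.2 ∈ T → derivable O S f = true → f ∈ S := hclosed
  simp only [derivable, Bool.or_eq_true, Bool.and_eq_true, eqb_iff, List.any_eq_true, memb_iff,
    Concept.isKind_iff] at hclosed
  induction C generalizing n with
  | top =>
    exact ⟨fun _ => hclosed _ n.2 hC (.inl (.inl (.inl (.inl (.inr rfl))))), fun _ => trivial⟩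
  | atom A => exact Iff.rfl
  | conj C D ihC ihD =>
    have hCD := hconj _ _ hC
    change n ∈ (canonical O S N d).ext C ∧ n ∈ (canonical O S N d).ext D ↔ _
    constructor
    · rintro ⟨h1, h2⟩
      replace h1 := (ihC hCD.1 n).1 h1
      replace h2 := (ihD hCD.2 n).1 h2
      exact hclosed _ n.2 hC (.inl (.inr ⟨⟨rfl, h1⟩, h2⟩))
    · intro h
      refine ⟨(ihC hCD.1 n).2 ?_, (ihD hCD.2 n).2 ?_⟩
      · exact hclosed _ n.2 hCD.1 (.inl (.inl (.inr ⟨_, h, rfl, .inl ⟨rfl, .inl rfl⟩⟩)))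
      · exact hclosed _ n.2 hCD.2 (.inl (.inl (.inr ⟨_, h, rfl, .inl ⟨rfl, .inr rfl⟩⟩)))
  | ex r C ih =>
    have hCT := hex _ _ hC
    constructor
    · rintro ⟨e, he, hne⟩
      replace he := (ih hCT e).1 he
      refine hclosed _ n.2 hC (.inr ⟨rfl, ?_⟩)
      rcases hne with ⟨E, h1, h2⟩ | ⟨a, b, h1, h2, h3⟩
      · simp only at h1 h2
        rw [h1] at he
        exact .inl ⟨_, h2, ⟨rfl, rfl⟩, he⟩
      · simp only at h1 h2
        rw [h2] at he
        exact .inr ⟨_, h3, ⟨rfl, h1⟩, he⟩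
    · intro h
      refine ⟨⟨.inl C, hTN C hCT⟩, (ih hCT _).2 ?_, .inl ⟨C, rfl, h⟩⟩
      exact hclosed _ (hTN C hCT) hCT (.inl (.inl (.inl (.inl (.inl rfl)))))

/-- Soundness is `holds_of_mem_closure`. For completeness, the canonical model over the subconcepts
and individuals of `α :: O` satisfies `O` and refutes every fact that is not derived. -/
theorem entailsb_iff (O : List Ax) (α : Ax) :
    entailsb O α = true ↔ Entails (ontology O) α := by
  set S := closure O (facts (α :: O)) with hS
  set N := nodes (α :: O) with hN
  set T := subs (α :: O) with hT
  have hmem : ∀ f ∈ S, f.1 ∈ N ∧ f.2 ∈ T := by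
    intro f hf
    rw [hS, ← closeStep_closure] at hf
    have := (List.mem_filter.1 hf).1
    simpa [facts] using this
  have hclosed : ∀ f : Fact, f.1 ∈ N → f.2 ∈ T → derivable O S f = true → f ∈ S := by
    intro f h1 h2 h3
    rw [hS, ← closeStep_closure, ← hS]
    refine List.mem_filter.2 ⟨by simpa [facts] using ⟨h1, h2⟩, by simp [h3]⟩
  have hTN : ∀ C ∈ T, .inl C ∈ N := fun C hC => by simp [hN, nodes, ← hT, hC]
  have hlhs : ∀ x ∈ α :: O, x.lhs ∈ T := fun x hx =>
    mem_subs.2 (.inr ⟨x, hx, .inl (mem_subterms_self _)⟩)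
  have hrhs : ∀ x ∈ α :: O, x.rhs ∈ T := fun x hx =>
    mem_subs.2 (.inr ⟨x, hx, .inr (mem_subterms_self _)⟩)
  have hi1 : ∀ x ∈ α :: O, .inr x.fstInd ∈ N := fun x hx => by
    simp only [hN, nodes, List.mem_append, List.mem_map, inds, List.mem_flatMap]
    exact .inr ⟨_, ⟨x, hx, by simp⟩, rfl⟩
  have hi2 : ∀ x ∈ α :: O, .inr x.sndInd ∈ N := fun x hx => by
    simp only [hN, nodes, List.mem_append, List.mem_map, inds, List.mem_flatMap]
    exact .inr ⟨_, ⟨x, hx, by simp⟩, rfl⟩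
  let d : {n : Node // n ∈ N} := ⟨.inl .top, hTN _ (mem_subs.2 (.inl rfl))⟩
  have hext : ∀ {C : Concept}, C ∈ T → ∀ n : (canonical O S N d).dom, n ∈ (canonical O S N d).ext C ↔ (n.1, C) ∈ S :=
    fun hC n => mem_canonical_ext d hTN (fun _ _ => subs_conj) (fun _ _ => subs_ex)
      hclosed hC n
  have hind : ∀ a, (h : .inr a ∈ N) → (canonical O S N d).indiv a = ⟨.inr a, h⟩ := by
    intro a h
    simp [canonical, h]
  have hcl := hclosed
  simp only [derivable, Bool.or_eq_true, Bool.and_eq_true, eqb_iff, List.any_eq_true, memb_iff,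
    Concept.isKind_iff] at hcl
  have hmodel : ∀ γ ∈ ontology O, (canonical O S N d).Satisfies γ := by
    intro γ hγ
    have hγ' : γ ∈ α :: O := List.mem_cons_of_mem _ hγ
    cases γ with
    | gci C D =>
      have hD := hrhs _ hγ'
      intro n hn
      refine (hext hD n).2 (hcl _ n.2 hD ?_)
      exact .inl (.inl (.inr ⟨_, (hext (hlhs _ hγ') n).1 hn, rfl, .inr hγ⟩))
    | concAssert C a =>
      have ha := hi1 _ hγ'
      change (canonical O S N d).indiv a ∈ _
      rw [hind a ha]
      refine (hext (hlhs _ hγ') _).2 (hcl _ ha (hlhs _ hγ') ?_)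
      exact .inl (.inl (.inl (.inr ⟨_, hγ, rfl, rfl⟩)))
    | roleAssert r a b =>
      have ha := hi1 _ hγ'
      have hb := hi2 _ hγ'
      change ((canonical O S N d).indiv a, (canonical O S N d).indiv b) ∈ _
      rw [hind a ha, hind b hb]
      exact .inr ⟨a, b, rfl, rfl, hγ⟩
  cases α with
  | gci C D =>
    simp only [entailsb, Ax.isKind, Ax.kind, Ax.lhs, Ax.rhs, decide_true, cond_true, memb_iff]
    have hC := hlhs _ List.mem_cons_self
    have hD := hrhs _ List.mem_cons_self
    constructor
    · intro h I hI
      exact holds_of_mem_closure (I := I) hI _ h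
    · intro h
      have h1 : (.inl C, C) ∈ S :=
        hcl _ (hTN _ hC) hC (.inl (.inl (.inl (.inl (.inl rfl)))))
      exact (hext hD ⟨.inl C, hTN _ hC⟩).1 (h _ hmodel ((hext hC _).2 h1))
  | concAssert C a =>
    simp only [entailsb, Ax.isKind, Ax.kind, Ax.lhs, Ax.fstInd]
    simp only [one_ne_zero, decide_false, cond_false, decide_true, cond_true, memb_iff]
    have hC := hlhs _ List.mem_cons_self
    have ha := hi1 _ List.mem_cons_self
    constructor
    · intro h I hI
      exact holds_of_mem_closure (I := I) hI _ h
    · intro h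
      have := h _ hmodel
      change (canonical O S N d).indiv a ∈ _ at this
      rw [hind a ha] at this
      exact (hext hC _).1 this
  | roleAssert r a b =>
    simp only [entailsb, Ax.isKind, Ax.kind]
    simp only [OfNat.ofNat_ne_zero, decide_false, cond_false, OfNat.ofNat_ne_one, memb_iff]
    have ha := hi1 _ List.mem_cons_self
    have hb := hi2 _ List.mem_cons_self
    constructor
    · intro h I hI
      exact hI _ h
    · intro h
      have := h _ hmodel
      change ((canonical O S N d).indiv a, (canonical O S N d).indiv b) ∈ _ at this
      have e1 := hind a ha
      have e2 := hind b hb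
      rw [e1, e2] at this
      -- Links of the first kind end in a concept node, hence not in the individual `b`.
      rcases this with ⟨E, h1, -⟩ | ⟨a', b', h1, h2, h3⟩
      · simp at h1
      · simp only [Sum.inr.injEq] at h1 h2
        rw [h1, h2]
        exact h3

end EL

namespace EL

/-! ### The tree of occurrences of atoms and existential restrictions -/

/-- The occurrences of atoms and existential restrictions in a concept. -/
def Item : Concept → Type
  | .top => Empty
  | .atom _ => Unit
  | .conj C D => Item C ⊕ Item D
  | .ex _ C => Option (Item C)

namespace Item

/-- The innermost existential restriction around an item. -/
def par : (C : Concept) → Item C → Option (Item C)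
  | .top, i => Empty.elim i
  | .atom _, _ => none
  | .conj C D, i => Sum.elim (fun i : Item C => (par C i).map Sum.inl)
      (fun i : Item D => (par D i).map Sum.inr) i
  | .ex _ C, i => Option.elim i none fun i : Item C => some (par C i)

/-- The concept at an item. -/
def term : (C : Concept) → Item C → Concept
  | .top, i => Empty.elim i
  | .atom A, _ => .atom A
  | .conj C D, i => Sum.elim (fun i : Item C => term C i) (fun i : Item D => term D i) i
  | .ex r C, i => Option.elim i (.ex r C) fun i : Item C => term C i

/-- The number of existential restrictions around an item. -/
def depth : (C : Concept) → Item C → ℕ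
  | .top, i => Empty.elim i
  | .atom _, _ => 0
  | .conj C D, i => Sum.elim (fun i : Item C => depth C i) (fun i : Item D => depth D i) i
  | .ex _ C, i => Option.elim i 0 fun i : Item C => depth C i + 1

/-- The label of an item: whether it is an existential restriction, and its name. -/
def lab (C : Concept) (i : Item C) : Bool × Name := (term C i).label

instance finite : (C : Concept) → Finite (Item C)
  | .top => inferInstanceAs (Finite Empty)
  | .atom _ => inferInstanceAs (Finite Unit)
  | .conj C D => by
    have := finite C
    have := finite D
    exact inferInstanceAs (Finite (Item C ⊕ Item D))
  | .ex _ C => by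
    have := finite C
    exact inferInstanceAs (Finite (Option (Item C)))

theorem depth_par (C : Concept) (i : Item C) :
    depth C i = (par C i).elim 0 fun j => depth C j + 1 := by
  induction C with
  | top => exact i.elim
  | atom A => rfl
  | conj C D ihC ihD =>
    rcases i with i | i
    · change depth C i = ((par C i).map Sum.inl).elim 0 _
      rw [ihC]
      cases par C i <;> rfl
    · change depth D i = ((par D i).map Sum.inr).elim 0 _
      rw [ihD]
      cases par D i <;> rfl
  | ex r C ih =>
    rcases i with _ | i
    · rfl
    · change depth C i + 1 = _
      rw [ih]
      change _ = depth (.ex r C) (par C i : Option (Item C)) + 1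
      cases par C i <;> rfl

end Item

/-- Maps between the items of two concepts that respect labels and parents. -/
structure IsHom (C D : Concept) (n : Option (Item D)) (f : Item C → Item D) : Prop where
  lab : ∀ i, Item.lab D (f i) = Item.lab C i
  par : ∀ i, Item.par D (f i) = (Item.par C i).elim n fun j => some (f j)

/-- Homomorphisms that map the root to the root. -/
abbrev IsRootHom (C D : Concept) (f : Item C → Item D) : Prop := IsHom C D none f

theorem IsHom.comp {C D E : Concept} {f : Item C → Item D} {g : Item D → Item E}
    {n : Option (Item E)} {m : Option (Item D)} (hg : IsHom D E n g) (hf : IsHom C D m f) :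
    IsHom C E (m.elim n fun j => some (g j)) (g ∘ f) where
  lab i := by rw [Function.comp, hg.lab, hf.lab]
  par i := by
    rw [Function.comp, hg.par, hf.par]
    cases Item.par C i <;> rfl

/-- `C` embeds into `D`. -/
def Embeds (C D : Concept) : Prop := ∃ f : Item C → Item D, IsRootHom C D f ∧ f.Injective

theorem Embeds.refl (C : Concept) : Embeds C C :=
  ⟨id, ⟨fun _ => rfl, fun i => by cases h : Item.par C i <;> simp [h]⟩, Function.injective_id⟩

theorem Embeds.trans {C D E : Concept} (h₁ : Embeds C D) (h₂ : Embeds D E) : Embeds C E := by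
  obtain ⟨f, hf, hf'⟩ := h₁
  obtain ⟨g, hg, hg'⟩ := h₂
  exact ⟨g ∘ f, hg.comp hf, hg'.comp hf'⟩

/-! ### Embeddings from syntactic operations -/

theorem Embeds.top (C : Concept) : Embeds .top C :=
  ⟨fun i => Empty.elim i, ⟨fun i => Empty.elim i, fun i => Empty.elim i⟩, fun i => Empty.elim i⟩

theorem Embeds.conj {C C₁ D D₁ : Concept} (h₁ : Embeds C C₁) (h₂ : Embeds D D₁) :
    Embeds (.conj C D) (.conj C₁ D₁) := by
  obtain ⟨f, hf, hf'⟩ := h₁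
  obtain ⟨g, hg, hg'⟩ := h₂
  refine ⟨Sum.map f g, ⟨?_, ?_⟩, hf'.sumMap hg'⟩
  · rintro (i | i)
    · exact hf.lab i
    · exact hg.lab i
  · rintro (i | i)
    · change (Item.par C₁ (f i)).map Sum.inl = ((Item.par C i).map Sum.inl).elim _ _
      rw [hf.par]
      cases Item.par C i <;> rfl
    · change (Item.par D₁ (g i)).map Sum.inr = ((Item.par D i).map Sum.inr).elim _ _
      rw [hg.par]
      cases Item.par D i <;> rfl

theorem Embeds.ex (r : Name) {C D : Concept} (h : Embeds C D) :
    Embeds (.ex r C) (.ex r D) := by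
  obtain ⟨f, hf, hf'⟩ := h
  refine ⟨Option.map f, ⟨?_, ?_⟩, Option.map_injective hf'⟩
  · rintro (_ | i)
    · rfl
    · exact hf.lab i
  · rintro (_ | i)
    · rfl
    · change some (Item.par D (f i)) = some (Option.map f (Item.par C i))
      rw [hf.par]
      cases Item.par C i <;> rfl

theorem Embeds.inl (C D : Concept) : Embeds C (.conj C D) :=
  ⟨Sum.inl, ⟨fun _ => rfl, fun i => by
    change (Item.par C i).map Sum.inl = _
    cases Item.par C i <;> rfl⟩, Sum.inl_injective⟩

/-- `⊤` has no items, and conjunction is the disjoint union of items, so the generating equations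
only rearrange disjoint unions. -/
theorem embeds_of_acuEq {C D : Concept} (h : ACUEq C D) : Embeds C D ∧ Embeds D C := by
  induction h with
  | refl C => exact ⟨.refl C, .refl C⟩
  | symm _ ih => exact ih.symm
  | trans _ _ ih₁ ih₂ => exact ⟨ih₁.1.trans ih₂.1, ih₂.2.trans ih₁.2⟩
  | conj _ _ ih₁ ih₂ => exact ⟨ih₁.1.conj ih₂.1, ih₁.2.conj ih₂.2⟩
  | ex r _ ih => exact ⟨ih.1.ex r, ih.2.ex r⟩
  | assoc C D E =>
    refine ⟨⟨Equiv.sumAssoc (Item C) (Item D) (Item E), ⟨?_, ?_⟩, Equiv.injective _⟩,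
      ⟨(Equiv.sumAssoc (Item C) (Item D) (Item E)).symm, ⟨?_, ?_⟩, Equiv.injective _⟩⟩
    · rintro ((i | i) | i) <;> rfl
    · rintro ((i | i) | i)
      · change (Item.par C i).map Sum.inl = (((Item.par C i).map Sum.inl).map Sum.inl).elim _ _
        cases Item.par C i <;> rfl
      · change ((Item.par D i).map Sum.inl).map Sum.inr =
          (((Item.par D i).map Sum.inr).map Sum.inl).elim _ _
        cases Item.par D i <;> rfl
      · change ((Item.par E i).map Sum.inr).map Sum.inr = ((Item.par E i).map Sum.inr).elim _ _
        cases Item.par E i <;> rfl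
    · rintro (i | i | i) <;> rfl
    · rintro (i | i | i)
      · change ((Item.par C i).map Sum.inl).map Sum.inl = ((Item.par C i).map Sum.inl).elim _ _
        cases Item.par C i <;> rfl
      · change ((Item.par D i).map Sum.inr).map Sum.inl =
          (((Item.par D i).map Sum.inl).map Sum.inr).elim _ _
        cases Item.par D i <;> rfl
      · change (Item.par E i).map Sum.inr = (((Item.par E i).map Sum.inr).map Sum.inr).elim _ _
        cases Item.par E i <;> rfl
  | comm C D =>
    have key : ∀ C D : Concept, Embeds (.conj C D) (.conj D C) := by
      intro C D
      refine ⟨(Sum.swap : Item C ⊕ Item D → Item D ⊕ Item C), ⟨?_, ?_⟩, ?_⟩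
      · rintro (i | i) <;> rfl
      · rintro (i | i)
        · change (Item.par C i).map Sum.inr = ((Item.par C i).map Sum.inl).elim _ _
          cases Item.par C i <;> rfl
        · change (Item.par D i).map Sum.inl = ((Item.par D i).map Sum.inr).elim _ _
          cases Item.par D i <;> rfl
      · exact (Equiv.sumComm (Item C) (Item D)).injective
    exact ⟨key C D, key D C⟩
  | unit C =>
    refine ⟨⟨(Sum.elim id fun i => Empty.elim i : Item C ⊕ Empty → Item C), ⟨?_, ?_⟩, ?_⟩,
      .inl C .top⟩
    · rintro (i | i)
      · rfl
      · exact i.elim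
    · rintro (i | i)
      · change Item.par C i = ((Item.par C i).map Sum.inl).elim _ _
        cases Item.par C i <;> rfl
      · exact i.elim
    · rintro (i | i) (j | j) h
      · exact congrArg _ h
      · exact j.elim
      · exact i.elim
      · exact i.elim

theorem ACEq.acuEq {C D : Concept} (h : ACEq C D) : ACUEq C D := by
  induction h with
  | refl C => exact .refl C
  | symm _ ih => exact ih.symm
  | trans _ _ ih₁ ih₂ => exact ih₁.trans ih₂
  | conj _ _ ih₁ ih₂ => exact ih₁.conj ih₂
  | ex r _ ih => exact ih.ex r
  | assoc C D E => exact .assoc C D E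
  | comm C D => exact .comm C D

theorem Repl.embeds {C D : Concept} (h : Repl C D) : Embeds D C := by
  induction h with
  | refl C => exact .refl C
  | toTop C => exact .top C
  | conj _ _ ih₁ ih₂ => exact ih₁.conj ih₂
  | ex r _ ih => exact ih.ex r

theorem Contract.embeds {C D : Concept} (h : Contract C D) : Embeds D C := by
  induction h with
  | here _ => exact .inl _ _
  | left D _ ih => exact ih.conj (.refl D)
  | right C _ ih => exact (Embeds.refl C).conj ih
  | ex r _ ih => exact ih.ex r

theorem embeds_of_reds {C D : Concept} (h : Relation.ReflTransGen RedStep C D) :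
    Embeds D C := by
  induction h with
  | refl => exact .refl _
  | tail _ h ih =>
    obtain ⟨C₁, D₁, h₁, h₂, h₃⟩ := h
    exact (((embeds_of_acuEq h₃.acuEq).2.trans h₂.embeds).trans
      (embeds_of_acuEq h₁.acuEq).2).trans ih

/-! ### Homomorphisms and subsumption -/

/-- The condition that an item with label `l` imposes on its source and target. -/
def Interp.Good (I : Interp) (l : Bool × Name) (d e : I.dom) : Prop :=
  bif l.1 then (d, e) ∈ I.role l.2 else d ∈ I.conc l.2

/-- Membership means that the tree of `C` can be laid out in `I` with its root at `d`. The value of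
`ρ` at an atom is irrelevant, since an atom constrains its parent node only. -/
theorem mem_ext_iff (I : Interp) (C : Concept) (d : I.dom) :
    d ∈ I.ext C ↔ ∃ ρ : Item C → I.dom,
      ∀ i, I.Good (Item.lab C i) ((Item.par C i).elim d ρ) (ρ i) := by
  induction C generalizing d with
  | top => exact ⟨fun _ => ⟨fun i => Empty.elim i, fun i => Empty.elim i⟩, fun _ => trivial⟩
  | atom A =>
    constructor
    · exact fun h => ⟨fun _ => d, fun _ => h⟩
    · exact fun ⟨ρ, h⟩ => h ()
  | conj C D ihC ihD =>
    change d ∈ I.ext C ∧ d ∈ I.ext D ↔ _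
    rw [ihC, ihD]
    constructor
    · rintro ⟨⟨ρ, hρ⟩, ⟨π, hπ⟩⟩
      refine ⟨Sum.elim ρ π, ?_⟩
      rintro (i | i)
      · have := hρ i
        change I.Good (Item.lab C i) (((Item.par C i).map Sum.inl).elim d _) (ρ i)
        cases h : Item.par C i <;> rw [h] at this <;> exact this
      · have := hπ i
        change I.Good (Item.lab D i) (((Item.par D i).map Sum.inr).elim d _) (π i)
        cases h : Item.par D i <;> rw [h] at this <;> exact this
    · rintro ⟨ρ, hρ⟩
      refine ⟨⟨fun i => ρ (Sum.inl i), fun i => ?_⟩, ⟨fun i => ρ (Sum.inr i), fun i => ?_⟩⟩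
      · have := hρ (Sum.inl i)
        change I.Good (Item.lab C i) (((Item.par C i).map Sum.inl).elim d _) _ at this
        cases h : Item.par C i <;> rw [h] at this <;> exact this
      · have := hρ (Sum.inr i)
        change I.Good (Item.lab D i) (((Item.par D i).map Sum.inr).elim d _) _ at this
        cases h : Item.par D i <;> rw [h] at this <;> exact this
  | ex r C ih =>
    constructor
    · rintro ⟨e, he, hde⟩
      obtain ⟨ρ, hρ⟩ := (ih e).1 he
      refine ⟨fun i => Option.elim i e ρ, ?_⟩
      rintro (_ | i)
      · exact hde
      · have := hρ i
        change I.Good (Item.lab C i) (Option.elim (Item.par C i) e ρ) (ρ i)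
        exact this
    · rintro ⟨ρ, hρ⟩
      refine ⟨ρ (none : Option (Item C)), (ih _).2 ⟨fun i => ρ (some i), fun i => ?_⟩, hρ none⟩
      have := hρ (some i : Option (Item C))
      change I.Good (Item.lab C i) (ρ (Item.par C i : Option (Item C))) (ρ (some i)) at this
      cases h : Item.par C i <;> rw [h] at this <;> exact this

theorem subsumed_iff {C D : Concept} : Subsumed C D ↔ ∀ I : Interp, I.ext C ⊆ I.ext D :=
  ⟨fun h I => h I (by simp), fun h I _ => h I⟩

theorem Subsumed.refl (C : Concept) : Subsumed C C :=
  subsumed_iff.2 fun _ => Set.Subset.rfl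

theorem Subsumed.trans {C D E : Concept} (h₁ : Subsumed C D) (h₂ : Subsumed D E) :
    Subsumed C E :=
  subsumed_iff.2 fun I => (subsumed_iff.1 h₁ I).trans (subsumed_iff.1 h₂ I)

theorem IsHom.subsumed {C D : Concept} {f : Item C → Item D} (h : IsRootHom C D f) :
    Subsumed D C := by
  rw [subsumed_iff]
  intro I d hd
  rw [mem_ext_iff] at hd ⊢
  obtain ⟨ρ, hρ⟩ := hd
  refine ⟨ρ ∘ f, fun i => ?_⟩
  have := hρ (f i)
  rw [h.lab, h.par] at this
  cases e : Item.par C i <;> rw [e] at this <;> exact this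

theorem Embeds.subsumed {C D : Concept} (h : Embeds C D) : Subsumed D C := by
  obtain ⟨f, hf, -⟩ := h
  exact hf.subsumed

/-- The tree of a concept as an interpretation. -/
def treeInterp (D : Concept) : Interp where
  dom := Option (Item D)
  nonempty := ⟨none⟩
  indiv _ := none
  conc A := {n | ∃ j, Item.par D j = n ∧ Item.lab D j = (false, A)}
  role r := {x | ∃ j, x.2 = some j ∧ Item.par D j = x.1 ∧ Item.lab D j = (true, r)}

theorem Item.lab_ne_of_par {C : Concept} {i j : Item C} (h : Item.par C i = some j) :
    (Item.lab C j).1 = true := by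
  induction C with
  | top => exact i.elim
  | atom A => cases h
  | conj C D ihC ihD =>
    rcases i with i | i
    · change (Item.par C i).map Sum.inl = _ at h
      obtain ⟨k, hk, rfl⟩ := Option.map_eq_some_iff.1 h
      exact ihC hk
    · change (Item.par D i).map Sum.inr = _ at h
      obtain ⟨k, hk, rfl⟩ := Option.map_eq_some_iff.1 h
      exact ihD hk
  | ex r C ih =>
    rcases i with _ | i
    · cases h
    · obtain rfl : Item.par C i = j := Option.some.inj h
      cases h : Item.par C i with
      | none => rfl
      | some k => exact ih h

/-- `D` holds at the root of its own tree, hence so does `C`, and laying out `C` there gives the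
map. The layout says nothing about where atoms go, so their images are chosen separately; this does
no harm because atoms have no children. -/
theorem exists_isHom_of_subsumed {C D : Concept} (h : Subsumed D C) :
    ∃ f : Item C → Item D, IsRootHom C D f := by
  have hD : (none : Option (Item D)) ∈ (treeInterp D).ext D := by
    refine (mem_ext_iff _ _ _).2 ⟨fun i => some i, fun i => ?_⟩
    have : (Item.par D i).elim none (fun i => some i) = Item.par D i := by
      cases Item.par D i <;> rfl
    cases hl : Item.lab D i with
    | mk b A =>
      cases b
      · exact ⟨i, this.symm, hl⟩
      · exact ⟨i, rfl, this.symm, hl⟩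
  have hC := subsumed_iff.1 h (treeInterp D) hD
  obtain ⟨ρ, hρ⟩ := (mem_ext_iff _ _ _).1 hC
  have key : ∀ i, ∃ j, Item.lab D j = Item.lab C i ∧ Item.par D j = (Item.par C i).elim none ρ ∧
      ((Item.lab C i).1 = true → ρ i = some j) := by
    intro i
    have := hρ i
    cases hl : Item.lab C i with
    | mk b A =>
      rw [hl] at this
      cases b
      · obtain ⟨j, h1, h2⟩ := this
        exact ⟨j, h2, h1, fun h => by simp at h⟩
      · obtain ⟨j, h1, h2, h3⟩ := this
        exact ⟨j, h3, h2, fun _ => h1⟩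
  choose f hf₁ hf₂ hf₃ using key
  refine ⟨f, hf₁, fun i => ?_⟩
  rw [hf₂]
  cases h : Item.par C i with
  | none => rfl
  | some j => exact hf₃ j (Item.lab_ne_of_par h)

/-- Simulations give homomorphisms. -/
theorem exists_isHom_of_simulation (C D : Concept) (n : Option (Item D))
    (H : Option (Item C) → Option (Item D) → Prop) (hn : H none n)
    (hstep : ∀ i m, H (Item.par C i) m →
      ∃ j, Item.par D j = m ∧ Item.lab D j = Item.lab C i ∧ H (some i) (some j)) :
    ∃ f, IsHom C D n f := by
  induction C generalizing n with
  | top => exact ⟨fun i => Empty.elim i, ⟨fun i => Empty.elim i, fun i => Empty.elim i⟩⟩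
  | atom A =>
    obtain ⟨j, h1, h2, -⟩ := hstep () n hn
    exact ⟨fun _ => j, ⟨fun _ => h2, fun _ => h1⟩⟩
  | conj C₁ C₂ ih₁ ih₂ =>
    obtain ⟨f, hf⟩ := ih₁ n (fun i m => H (i.map Sum.inl) m) hn fun i m h =>
      hstep (Sum.inl i) m h
    obtain ⟨g, hg⟩ := ih₂ n (fun i m => H (i.map Sum.inr) m) hn fun i m h =>
      hstep (Sum.inr i) m h
    refine ⟨Sum.elim f g, ⟨?_, ?_⟩⟩
    · rintro (i | i)
      · exact hf.lab i
      · exact hg.lab i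
    · rintro (i | i)
      · refine (hf.par i).trans ?_
        change _ = ((Item.par C₁ i).map Sum.inl).elim _ _
        cases Item.par C₁ i <;> rfl
      · refine (hg.par i).trans ?_
        change _ = ((Item.par C₂ i).map Sum.inr).elim _ _
        cases Item.par C₂ i <;> rfl
  | ex r C ih =>
    obtain ⟨j, h1, h2, h3⟩ := hstep (none : Option (Item C)) n hn
    obtain ⟨f, hf⟩ := ih (some j) (fun (i : Option (Item C)) m => H (some i) m) h3 fun i m h =>
      hstep (some i : Option (Item C)) m h
    refine ⟨fun i : Option (Item C) => i.elim j f, ⟨?_, ?_⟩⟩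
    · rintro (_ | i)
      · exact h2
      · exact hf.lab i
    · rintro (_ | i)
      · exact h1
      · refine (hf.par i).trans ?_
        change _ = some (Option.elim (Item.par C i) j f)
        cases Item.par C i <;> rfl

end EL

namespace EL

/-! ### Restriction to a set of items -/

open Classical in
/-- Replace by `⊤` all items that are not in `S`. -/
noncomputable def restrict : (C : Concept) → (Item C → Prop) → Concept
  | .top, _ => .top
  | .atom A, S => if S () then .atom A else .top
  | .conj C D, S => .conj (restrict C fun i => S (Sum.inl i)) (restrict D fun i => S (Sum.inr i))
  | .ex r C, S => if S (none : Option (Item C)) then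
      .ex r (restrict C fun i => S (some i : Option (Item C))) else .top

theorem restrict_atom_pos {A : Name} {S : Item (.atom A) → Prop} (h : S ()) :
    restrict (.atom A) S = .atom A := if_pos h

theorem restrict_atom_neg {A : Name} {S : Item (.atom A) → Prop} (h : ¬ S ()) :
    restrict (.atom A) S = .top := if_neg h

theorem restrict_ex_pos {r : Name} {C : Concept} {S : Item (.ex r C) → Prop}
    (h : S (none : Option (Item C))) : restrict (.ex r C) S =
      .ex r (restrict C fun i => S (some i : Option (Item C))) := if_pos h

theorem restrict_ex_neg {r : Name} {C : Concept} {S : Item (.ex r C) → Prop}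
    (h : ¬ S (none : Option (Item C))) : restrict (.ex r C) S = .top := if_neg h

theorem repl_restrict (C : Concept) (S : Item C → Prop) : Repl C (restrict C S) := by
  induction C with
  | top => exact .refl _
  | atom A =>
    by_cases h : S ()
    · rw [restrict_atom_pos h]; exact .refl _
    · rw [restrict_atom_neg h]; exact .toTop _
  | conj C D ihC ihD => exact .conj (ihC _) (ihD _)
  | ex r C ih =>
    by_cases h : S (none : Option (Item C))
    · rw [restrict_ex_pos h]; exact .ex r (ih _)
    · rw [restrict_ex_neg h]; exact .toTop _

theorem restrict_eq_self (C : Concept) (S : Item C → Prop) (h : ∀ i, S i) :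
    restrict C S = C := by
  induction C with
  | top => rfl
  | atom A => exact restrict_atom_pos (h _)
  | conj C D ihC ihD =>
    simp only [restrict, ihC _ fun i => h (Sum.inl i), ihD _ fun i => h (Sum.inr i)]
  | ex r C ih =>
    rw [restrict_ex_pos (h _), ih _ fun i => h (some i : Option (Item C))]

/-- The outermost restriction is the only item without a parent, so induction along parents has a
single base case. -/
theorem Item.ex_induction {r : Name} {C : Concept} {S : Item (.ex r C) → Prop}
    (h0 : S (none : Option (Item C)))
    (h : ∀ i j, Item.par (.ex r C) i = some j → S j → S i) (i : Item (.ex r C)) : S i := by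
  have key : ∀ n, ∀ i : Item (.ex r C), Item.depth _ i = n → S i := by
    intro n
    induction n with
    | zero =>
      intro i hi
      rcases i with _ | i
      · exact h0
      · change Item.depth C i + 1 = 0 at hi
        omega
    | succ n ih =>
      intro i hi
      rw [Item.depth_par] at hi
      cases e : Item.par (.ex r C) i with
      | none => rw [e] at hi; cases hi
      | some j =>
        rw [e] at hi
        exact h i j e (ih j (Nat.succ.inj hi))
  exact key _ i rfl

/-- Sets of items that contain with each item its parent. -/
def ParentClosed {C : Concept} (S : Item C → Prop) : Prop :=
  ∀ i j, Item.par C i = some j → S i → S j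

theorem ParentClosed.inl {C D : Concept} {S : Item (.conj C D) → Prop} (h : ParentClosed S) :
    ParentClosed (C := C) fun i => S (Sum.inl i) := by
  intro i j hij hi
  refine h (Sum.inl i) (Sum.inl j) ?_ hi
  change (Item.par C i).map Sum.inl = _
  rw [hij]
  rfl

theorem ParentClosed.inr {C D : Concept} {S : Item (.conj C D) → Prop} (h : ParentClosed S) :
    ParentClosed (C := D) fun i => S (Sum.inr i) := by
  intro i j hij hi
  refine h (Sum.inr i) (Sum.inr j) ?_ hi
  change (Item.par D i).map Sum.inr = _
  rw [hij]
  rfl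

theorem ParentClosed.some {r : Name} {C : Concept} {S : Item (.ex r C) → Prop}
    (h : ParentClosed S) : ParentClosed (C := C) fun i => S (some i : Option (Item C)) := by
  intro i j hij hi
  refine h (Option.some i : Option (Item C)) (Option.some j : Option (Item C)) ?_ hi
  change Option.some (Item.par C i) = _
  rw [hij]
  rfl

theorem ParentClosed.not_of_not_root {r : Name} {C : Concept} {S : Item (.ex r C) → Prop}
    (h : ParentClosed S) (h0 : ¬ S (none : Option (Item C))) (i : Item (.ex r C)) : ¬ S i :=
  Item.ex_induction (S := fun i => ¬ S i) h0 (fun i j hij hj hi => hj (h i j hij hi)) i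

theorem IsHom.conjMap {C D C₁ D₁ : Concept} {f : Item C → Item C₁} {g : Item D → Item D₁}
    (hf : IsRootHom C C₁ f) (hg : IsRootHom D D₁ g) :
    IsRootHom (.conj C D) (.conj C₁ D₁) (Sum.map f g) where
  lab i := by
    rcases i with i | i
    · exact hf.lab i
    · exact hg.lab i
  par i := by
    rcases i with i | i
    · change (Item.par C₁ (f i)).map Sum.inl = ((Item.par C i).map Sum.inl).elim _ _
      rw [hf.par]
      cases Item.par C i <;> rfl
    · change (Item.par D₁ (g i)).map Sum.inr = ((Item.par D i).map Sum.inr).elim _ _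
      rw [hg.par]
      cases Item.par D i <;> rfl

theorem IsHom.exMap (r : Name) {C D : Concept} {f : Item C → Item D} (hf : IsRootHom C D f) :
    IsRootHom (.ex r C) (.ex r D) (Option.map f : Option (Item C) → Option (Item D)) where
  lab i := by
    rcases i with _ | i
    · rfl
    · exact hf.lab i
  par i := by
    rcases i with _ | i
    · rfl
    · change some (Item.par D (f i)) = some (Option.map f (Item.par C i))
      rw [hf.par]
      cases Item.par C i <;> rfl

theorem isRootHom_id (C : Concept) : IsRootHom C C id :=
  ⟨fun _ => rfl, fun i => by cases h : Item.par C i <;> simp [h]⟩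

/-- The items of a restriction are items in the given set, and all of them when the set contains
the parents of its elements. -/
theorem exists_restrict_map' (C : Concept) (S : Item C → Prop) :
    ∃ f : Item (restrict C S) → Item C, IsRootHom (restrict C S) C f ∧ f.Injective ∧
      (∀ x, S (f x)) ∧ (ParentClosed S → ∀ i, S i → ∃ x, f x = i) := by
  induction C with
  | top =>
    exact ⟨id, isRootHom_id _, Function.injective_id, fun i => Empty.elim i,
      fun _ i => Empty.elim i⟩
  | atom A =>
    by_cases h : S ()
    · rw [restrict_atom_pos h]
      exact ⟨id, isRootHom_id _, Function.injective_id, fun _ => h, fun _ i _ => ⟨i, rfl⟩⟩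
    · rw [restrict_atom_neg h]
      obtain ⟨f, h1, h2⟩ := Embeds.top (.atom A)
      exact ⟨f, h1, h2, fun x => Empty.elim x, fun _ i hi => absurd hi h⟩
  | conj C D ihC ihD =>
    obtain ⟨f, f1, f2, f3, f4⟩ := ihC fun i => S (Sum.inl i)
    obtain ⟨g, g1, g2, g3, g4⟩ := ihD fun i => S (Sum.inr i)
    refine ⟨Sum.map f g, f1.conjMap g1, f2.sumMap g2, ?_, fun hS => ?_⟩
    · rintro (x | x)
      · exact f3 x
      · exact g3 x
    · rintro (i | i) hi
      · obtain ⟨x, rfl⟩ := f4 hS.inl i hi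
        exact ⟨Sum.inl x, rfl⟩
      · obtain ⟨x, rfl⟩ := g4 hS.inr i hi
        exact ⟨Sum.inr x, rfl⟩
  | ex r C ih =>
    by_cases h : S (none : Option (Item C))
    · rw [restrict_ex_pos h]
      obtain ⟨f, f1, f2, f3, f4⟩ := ih fun i => S (some i : Option (Item C))
      refine ⟨(Option.map f : Option _ → Option (Item C)), f1.exMap r,
        Option.map_injective f2, ?_, fun hS => ?_⟩
      · rintro (_ | x)
        · exact h
        · exact f3 x
      · rintro (_ | i) hi
        · exact ⟨(none : Option _), rfl⟩
        · obtain ⟨x, rfl⟩ := f4 hS.some i hi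
          exact ⟨(some x : Option _), rfl⟩
    · rw [restrict_ex_neg h]
      obtain ⟨f, h1, h2⟩ := Embeds.top (.ex r C)
      exact ⟨f, h1, h2, fun x => Empty.elim x, fun hS i hi => absurd hi (hS.not_of_not_root h i)⟩

theorem exists_restrict_map (C : Concept) (S : Item C → Prop) (hS : ParentClosed S) :
    ∃ f : Item (restrict C S) → Item C, IsRootHom (restrict C S) C f ∧ f.Injective ∧
      ∀ i, (∃ x, f x = i) ↔ S i := by
  obtain ⟨f, h1, h2, h3, h4⟩ := exists_restrict_map' C S
  exact ⟨f, h1, h2, fun i => ⟨fun ⟨x, hx⟩ => hx ▸ h3 x, h4 hS i⟩⟩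

/-- Homomorphisms factor through embeddings that contain their range. -/
theorem IsHom.factor {X Y C : Concept} {f : Item X → Item C} {e : Item Y → Item C}
    (hf : IsRootHom X C f) (he : IsRootHom Y C e) (hinj : e.Injective)
    (h : ∀ x, ∃ y, e y = f x) : ∃ g : Item X → Item Y, IsRootHom X Y g ∧ ∀ x, e (g x) = f x := by
  choose g hg using h
  refine ⟨g, ⟨fun i => ?_, fun i => ?_⟩, hg⟩
  · rw [← he.lab, hg, hf.lab]
  · have h1 := he.par (g i)
    rw [hg, hf.par] at h1
    cases h2 : Item.par X i with
    | none =>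
      rw [h2] at h1
      cases h3 : Item.par Y (g i) with
      | none => rfl
      | some j => rw [h3] at h1; cases h1
    | some k =>
      rw [h2] at h1
      cases h3 : Item.par Y (g i) with
      | none => rw [h3] at h1; cases h1
      | some j =>
        rw [h3] at h1
        have h4 : f k = e j := Option.some.inj h1
        rw [← hg] at h4
        exact congrArg some (hinj h4.symm)

theorem IsHom.factor_embeds {X Y C : Concept} {f : Item X → Item C} {e : Item Y → Item C}
    (hf : IsRootHom X C f) (hfi : f.Injective) (he : IsRootHom Y C e) (hinj : e.Injective)
    (h : ∀ x, ∃ y, e y = f x) : Embeds X Y := by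
  obtain ⟨g, hg, hge⟩ := hf.factor he hinj h
  exact ⟨g, hg, fun x y hxy => hfi (by rw [← hge, ← hge, hxy])⟩

/-! ### Embeddings as replacements -/

/-- The hypothesis says that `S` is a union of whole top-level conjuncts, which can then be sorted
into those inside and those outside `S`. -/
theorem acuEq_split (C : Concept) (S : Item C → Prop)
    (hS : ∀ i j, Item.par C i = some j → (S i ↔ S j)) :
    ACUEq C (.conj (restrict C S) (restrict C fun i => ¬ S i)) := by
  induction C with
  | top => exact (ACUEq.unit _).symm
  | atom A =>
    by_cases h : S ()
    · rw [restrict_atom_pos h, restrict_atom_neg (S := fun i => ¬ S i) (not_not.2 h)]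
      exact (ACUEq.unit _).symm
    · rw [restrict_atom_neg h, restrict_atom_pos (S := fun i => ¬ S i) h]
      exact ((ACUEq.comm _ _).trans (.unit _)).symm
  | conj C D ihC ihD =>
    refine ((ihC (fun i => S (Sum.inl i)) fun i j h => ?_).conj
      (ihD (fun i => S (Sum.inr i)) fun i j h => ?_)).trans ?_
    · refine hS (Sum.inl i) (Sum.inl j) ?_
      change (Item.par C i).map Sum.inl = _
      rw [h]; rfl
    · refine hS (Sum.inr i) (Sum.inr j) ?_
      change (Item.par D i).map Sum.inr = _
      rw [h]; rfl
    · refine (ACUEq.assoc _ _ _).trans (ACUEq.trans ?_ (ACUEq.assoc _ _ _).symm)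
      refine (ACUEq.refl _).conj ?_
      exact (ACUEq.assoc _ _ _).symm.trans
        (((ACUEq.comm _ _).conj (.refl _)).trans (ACUEq.assoc _ _ _))
  | ex r C ih =>
    by_cases h : S (none : Option (Item C))
    · have : ∀ i, S i := Item.ex_induction h fun i j hij hj => (hS i j hij).2 hj
      rw [restrict_eq_self _ S this]
      rw [restrict_ex_neg (S := fun i => ¬ S i) (not_not.2 h)]
      exact (ACUEq.unit _).symm
    · have : ∀ i, ¬ S i := Item.ex_induction (S := fun i => ¬ S i) h
        fun i j hij hj hi => hj ((hS i j hij).1 hi)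
      rw [restrict_eq_self _ (fun i => ¬ S i) this]
      rw [restrict_ex_neg h]
      exact ((ACUEq.comm _ _).trans (.unit _)).symm

theorem acuEq_top_of_isEmpty (C : Concept) (h : IsEmpty (Item C)) : ACUEq C .top := by
  induction C with
  | top => exact .refl _
  | atom A => exact (h.false ()).elim
  | conj C D ihC ihD =>
    exact ((ihC ⟨fun i => h.false (Sum.inl i)⟩).conj (ihD ⟨fun i => h.false (Sum.inr i)⟩)).trans
      (.unit _)
  | ex r C _ => exact (h.false (none : Option (Item C))).elim

theorem Item.exists_root {C : Concept} (i : Item C) : ∃ j, Item.par C j = none := by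
  induction C with
  | top => exact i.elim
  | atom A => exact ⟨(), rfl⟩
  | conj C D ihC ihD =>
    rcases i with i | i
    · obtain ⟨j, hj⟩ := ihC i
      exact ⟨Sum.inl j, congrArg (Option.map Sum.inl) hj⟩
    · obtain ⟨j, hj⟩ := ihD i
      exact ⟨Sum.inr j, congrArg (Option.map Sum.inr) hj⟩
  | ex r C _ => exact ⟨(none : Option (Item C)), rfl⟩

theorem Item.par_inl (C D : Concept) (i : Item C) :
    Item.par (.conj C D) (Sum.inl i) = (Item.par C i).map Sum.inl := rfl

theorem Item.par_inr (C D : Concept) (i : Item D) :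
    Item.par (.conj C D) (Sum.inr i) = (Item.par D i).map Sum.inr := rfl

theorem Item.par_inl_eq_none {C D : Concept} {i : Item C} :
    Item.par (.conj C D) (Sum.inl i) = none ↔ Item.par C i = none :=
  Option.map_eq_none_iff

theorem Item.par_inr_eq_none {C D : Concept} {i : Item D} :
    Item.par (.conj C D) (Sum.inr i) = none ↔ Item.par D i = none :=
  Option.map_eq_none_iff

/-- Every conjunct with an item has a root, so all conjuncts other than the one of `x` are
conjunctions of `⊤` and vanish. -/
theorem acuEq_term {C : Concept} (x : Item C) (hx : Item.par C x = none)
    (huniq : ∀ y, Item.par C y = none → y = x) : ACUEq C (Item.term C x) := by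
  induction C with
  | top => exact x.elim
  | atom A => exact .refl _
  | conj C D ihC ihD =>
    rcases x with x | x
    · have hD : IsEmpty (Item D) := ⟨fun i => by
        obtain ⟨j, hj⟩ := i.exists_root
        cases huniq (Sum.inr j) (Item.par_inr_eq_none.2 hj)⟩
      refine ((ihC x (Item.par_inl_eq_none.1 hx) fun y hy =>
        Sum.inl_injective (huniq (Sum.inl y) (Item.par_inl_eq_none.2 hy))).conj
          (acuEq_top_of_isEmpty D hD)).trans (.unit _)
    · have hC : IsEmpty (Item C) := ⟨fun i => by
        obtain ⟨j, hj⟩ := i.exists_root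
        cases huniq (Sum.inl j) (Item.par_inl_eq_none.2 hj)⟩
      refine ((acuEq_top_of_isEmpty C hC).conj (ihD x (Item.par_inr_eq_none.1 hx) fun y hy =>
        Sum.inr_injective (huniq (Sum.inr y) (Item.par_inr_eq_none.2 hy)))).trans
          ((ACUEq.comm _ _).trans (.unit _))
  | ex r C _ =>
    rcases x with _ | x
    · exact .refl _
    · cases hx

theorem Item.term_cases (C : Concept) (x : Item C) :
    (∃ A, Item.term C x = .atom A) ∨ ∃ r E, Item.term C x = .ex r E := by
  induction C with
  | top => exact x.elim
  | atom A => exact .inl ⟨A, rfl⟩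
  | conj C D ihC ihD =>
    rcases x with x | x
    · exact ihC x
    · exact ihD x
  | ex r C ih =>
    rcases x with _ | x
    · exact .inr ⟨r, C, rfl⟩
    · exact ih x

theorem Item.term_of_lab_false {C : Concept} {x : Item C} {A : Name}
    (h : Item.lab C x = (false, A)) : Item.term C x = .atom A := by
  rcases Item.term_cases C x with ⟨B, hB⟩ | ⟨r, E, hE⟩
  · simp only [Item.lab, hB, Concept.label, Concept.name, Prod.mk.injEq] at h
    rw [hB, h.2]
  · simp [Item.lab, hE, Concept.label, Concept.isKind, Concept.kind] at h

theorem Item.term_of_lab_true {C : Concept} {x : Item C} {r : Name}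
    (h : Item.lab C x = (true, r)) : ∃ E, Item.term C x = .ex r E := by
  rcases Item.term_cases C x with ⟨B, hB⟩ | ⟨s, E, hE⟩
  · simp [Item.lab, hB, Concept.label, Concept.isKind, Concept.kind] at h
  · simp only [Item.lab, hE, Concept.label, Concept.name, Prod.mk.injEq] at h
    exact ⟨E, by rw [hE, h.2]⟩

/-- Each side has a unique root, and an embedding must match these; injectivity keeps the remaining
items away from the root. -/
theorem Embeds.of_ex {r s : Name} {C D : Concept} (h : Embeds (.ex r C) (.ex s D)) :
    r = s ∧ Embeds C D := by
  obtain ⟨f, hf, hfi⟩ := h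
  have h0 : f (none : Option (Item C)) = (none : Option (Item D)) := by
    have := hf.par (none : Option (Item C))
    cases h : f (none : Option (Item C)) with
    | none => rfl
    | some j => rw [h] at this; cases this
  have hl := hf.lab (none : Option (Item C))
  rw [h0] at hl
  have hrs : r = s := ((Prod.mk.injEq _ _ _ _).mp hl).2.symm
  have hs : ∀ i : Item C, ∃ j : Item D, f (some i : Option (Item C)) = (some j : Option _) := by
    intro i
    cases h : f (some i : Option (Item C)) with
    | none => cases hfi (h.trans h0.symm)
    | some j => exact ⟨j, rfl⟩
  choose g hg using hs
  refine ⟨hrs, g, ⟨fun i => ?_, fun i => ?_⟩, fun i j hij => ?_⟩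
  · have := hf.lab (some i : Option (Item C))
    rw [hg] at this
    exact this
  · have := hf.par (some i : Option (Item C))
    rw [hg] at this
    have this : some (Item.par D (g i)) = some (f (Item.par C i : Option (Item C))) := this
    have this := Option.some.inj this
    rw [this]
    cases Item.par C i with
    | none => exact h0
    | some k => exact hg k
  · have : f (some i : Option (Item C)) = f (some j : Option (Item C)) := by rw [hg, hg, hij]
    exact Option.some_injective _ (hfi this)

/-- The converse of `Repl.embeds`. Over a conjunction, `X` splits according to the conjunct in which
its items land (`acuEq_split`). Over an existential restriction, injectivity leaves `X` a single
root, so `X` is itself an existential restriction up to `ACUEq`. -/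
theorem exists_repl_of_embeds {X C : Concept} (h : Embeds X C) :
    ∃ D, Repl C D ∧ ACUEq X D := by
  by_cases hX : IsEmpty (Item X)
  · exact ⟨.top, .toTop _, acuEq_top_of_isEmpty X hX⟩
  rw [not_isEmpty_iff] at hX
  induction C generalizing X with
  | top =>
    obtain ⟨f, -, -⟩ := h
    exact (f hX.some).elim
  | atom A =>
    obtain ⟨f, hf, hfi⟩ := h
    obtain ⟨x, hx⟩ := hX.some.exists_root
    have : Item.term X x = .atom A := Item.term_of_lab_false (by rw [← hf.lab]; rfl)
    refine ⟨.atom A, .refl _, ?_⟩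
    rw [← this]
    exact acuEq_term x hx fun y _ => hfi (Subsingleton.elim (α := Unit) _ _)
  | conj C D ihC ihD =>
    obtain ⟨f, hf, hfi⟩ := h
    let S : Item X → Prop := fun i => ∃ j : Item C, f i = Sum.inl j
    have hS : ∀ i j, Item.par X i = some j → (S i ↔ S j) := by
      intro i j hij
      have := hf.par i
      rw [hij] at this
      constructor
      · rintro ⟨k, hk⟩
        rw [hk] at this
        obtain ⟨l, -, hl⟩ := Option.map_eq_some_iff.1 this
        exact ⟨l, hl.symm⟩
      · rintro ⟨k, hk⟩
        cases hi : f i with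
        | inl l => exact ⟨l, hi⟩
        | inr l =>
          rw [hi] at this
          obtain ⟨l, -, hl⟩ := Option.map_eq_some_iff.1 this
          rw [hk] at hl
          cases hl
    have hpart : ∀ (T : Item X → Prop) (E : Concept) (e : Item E → Item (.conj C D)),
        ParentClosed T → IsRootHom E (.conj C D) e → e.Injective →
          (∀ i, T i → ∃ y, e y = f i) → Embeds (restrict X T) E := by
      intro T E e hT he hei hTe
      obtain ⟨g, g1, g2, g3⟩ := exists_restrict_map X T hT
      exact IsHom.factor_embeds (hf.comp g1) (hfi.comp g2) he hei fun x => hTe _ ((g3 _).1 ⟨x, rfl⟩)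
    have h1 : Embeds (restrict X S) C := by
      refine hpart S C Sum.inl (fun i j hij hi => (hS i j hij).1 hi)
        ⟨fun _ => rfl, fun i => by rw [Item.par_inl]; cases Item.par C i <;> rfl⟩
        Sum.inl_injective ?_
      rintro i ⟨j, hj⟩
      exact ⟨j, hj.symm⟩
    have h2 : Embeds (restrict X fun i => ¬ S i) D := by
      refine hpart _ D Sum.inr (fun i j hij hi hj => hi ((hS i j hij).2 hj))
        ⟨fun _ => rfl, fun i => by rw [Item.par_inr]; cases Item.par D i <;> rfl⟩
        Sum.inr_injective ?_
      intro i hi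
      cases h : f i with
      | inl j => exact absurd ⟨j, h⟩ hi
      | inr j => exact ⟨j, rfl⟩
    have h1' : ∃ E, Repl C E ∧ ACUEq (restrict X S) E := by
      by_cases hX : IsEmpty (Item (restrict X S))
      · exact ⟨.top, .toTop _, acuEq_top_of_isEmpty _ hX⟩
      · exact ihC h1 (not_isEmpty_iff.1 hX)
    have h2' : ∃ E, Repl D E ∧ ACUEq (restrict X fun i => ¬ S i) E := by
      by_cases hX : IsEmpty (Item (restrict X fun i => ¬ S i))
      · exact ⟨.top, .toTop _, acuEq_top_of_isEmpty _ hX⟩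
      · exact ihD h2 (not_isEmpty_iff.1 hX)
    obtain ⟨C₁, hC₁, hC₁'⟩ := h1'
    obtain ⟨D₁, hD₁, hD₁'⟩ := h2'
    exact ⟨_, hC₁.conj hD₁, (acuEq_split X S hS).trans (hC₁'.conj hD₁')⟩
  | ex r C ih =>
    obtain ⟨f, hf, hfi⟩ := h
    have hroot : ∀ y, Item.par X y = none → f y = (none : Option (Item C)) := by
      intro y hy
      have := hf.par y
      rw [hy] at this
      cases h : f y with
      | none => rfl
      | some j => rw [h] at this; cases this
    obtain ⟨x, hx⟩ := hX.some.exists_root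
    have hl : Item.lab X x = (true, r) := by rw [← hf.lab, hroot x hx]; rfl
    obtain ⟨E, hE⟩ := Item.term_of_lab_true hl
    have hXE : ACUEq X (.ex r E) := by
      rw [← hE]
      exact acuEq_term x hx fun y hy => hfi ((hroot y hy).trans (hroot x hx).symm)
    have h2 := (((embeds_of_acuEq hXE).2.trans ⟨f, hf, hfi⟩).of_ex).2
    have h3 : ∃ F, Repl C F ∧ ACUEq E F := by
      by_cases hX : IsEmpty (Item E)
      · exact ⟨.top, .toTop _, acuEq_top_of_isEmpty _ hX⟩
      · exact ih h2 (not_isEmpty_iff.1 hX)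
    obtain ⟨F, hF, hF'⟩ := h3
    exact ⟨.ex r F, hF.ex r, hXE.trans (hF'.ex r)⟩

end EL

namespace EL

/-! ### Reduced forms -/

theorem ACEq.ext {C D : Concept} (h : ACEq C D) (I : Interp) : I.ext C = I.ext D := by
  have := embeds_of_acuEq h.acuEq
  exact Set.Subset.antisymm (subsumed_iff.1 this.2.subsumed I) (subsumed_iff.1 this.1.subsumed I)

theorem Contract.ext {C D : Concept} (h : Contract C D) (I : Interp) : I.ext C = I.ext D := by
  induction h with
  | here h => exact Set.inter_eq_left.2 (subsumed_iff.1 h I)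
  | left D _ ih => simp only [Interp.ext, ih]
  | right C _ ih => simp only [Interp.ext, ih]
  | ex r _ ih => simp only [Interp.ext, ih]

theorem RedStep.ext {C D : Concept} (h : RedStep C D) (I : Interp) : I.ext C = I.ext D := by
  obtain ⟨C₁, D₁, h₁, h₂, h₃⟩ := h
  rw [h₁.ext, h₂.ext, h₃.ext]

theorem ext_eq_of_reds {C D : Concept} (h : Relation.ReflTransGen RedStep C D) (I : Interp) :
    I.ext C = I.ext D := by
  induction h with
  | refl => rfl
  | tail _ h ih => rw [ih, h.ext]

/-- The number of constructors in a concept. -/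
def Concept.weight : Concept → ℕ
  | .top => 1
  | .atom _ => 1
  | .conj C D => 1 + C.weight + D.weight
  | .ex _ C => 1 + C.weight

theorem ACEq.weight {C D : Concept} (h : ACEq C D) : C.weight = D.weight := by
  induction h with
  | refl C => rfl
  | symm _ ih => exact ih.symm
  | trans _ _ ih₁ ih₂ => exact ih₁.trans ih₂
  | conj _ _ ih₁ ih₂ => simp only [Concept.weight, ih₁, ih₂]
  | ex r _ ih => simp only [Concept.weight, ih]
  | assoc C D E => simp only [Concept.weight]; omega
  | comm C D => simp only [Concept.weight]; omega

theorem Contract.weight {C D : Concept} (h : Contract C D) : D.weight < C.weight := by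
  induction h with
  | here h => simp only [Concept.weight]; omega
  | left D _ ih => simp only [Concept.weight]; omega
  | right C _ ih => simp only [Concept.weight]; omega
  | ex r _ ih => simp only [Concept.weight]; omega

theorem RedStep.weight {C D : Concept} (h : RedStep C D) : D.weight < C.weight := by
  obtain ⟨C₁, D₁, h₁, h₂, h₃⟩ := h
  rw [h₁.weight, ← h₃.weight]
  exact h₂.weight

theorem exists_isReducedForm (C : Concept) : ∃ D, IsReducedForm C D := by
  induction h : C.weight using Nat.strong_induction_on generalizing C with
  | _ n ih =>
    subst h
    by_cases hC : IsReduced C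
    · exact ⟨C, .refl, hC⟩
    · simp only [IsReduced, not_forall, not_not] at hC
      obtain ⟨D, hD⟩ := hC
      obtain ⟨E, hE, hE'⟩ := ih _ hD.weight D rfl
      exact ⟨E, .head hD hE, hE'⟩

theorem RedStep.conjLeft {C C₁ : Concept} (D : Concept) (h : RedStep C C₁) :
    RedStep (.conj C D) (.conj C₁ D) := by
  obtain ⟨E, F, h₁, h₂, h₃⟩ := h
  exact ⟨_, _, h₁.conj (.refl D), h₂.left D, h₃.conj (.refl D)⟩

theorem RedStep.conjRight {D D₁ : Concept} (C : Concept) (h : RedStep D D₁) :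
    RedStep (.conj C D) (.conj C D₁) := by
  obtain ⟨E, F, h₁, h₂, h₃⟩ := h
  exact ⟨_, _, (ACEq.refl C).conj h₁, h₂.right C, (ACEq.refl C).conj h₃⟩

theorem RedStep.ex (r : Name) {C D : Concept} (h : RedStep C D) :
    RedStep (.ex r C) (.ex r D) := by
  obtain ⟨E, F, h₁, h₂, h₃⟩ := h
  exact ⟨_, _, h₁.ex r, h₂.ex r, h₃.ex r⟩

/-- Moves a top-level conjunct to the front, in preparation for `Contract.here`. There are two
alternatives because `ACEq` cannot supply a `⊤` when no other conjunct exists. -/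
theorem acEq_root {C : Concept} (x : Item C) (hx : Item.par C x = none) :
    ACEq C (Item.term C x) ∨ ∃ D, ACEq C (.conj (Item.term C x) D) := by
  induction C with
  | top => exact x.elim
  | atom A => exact .inl (.refl _)
  | conj C D ihC ihD =>
    right
    rcases x with x | x
    · rcases ihC x (Item.par_inl_eq_none.1 hx) with h | ⟨E, h⟩
      · exact ⟨D, h.conj (.refl D)⟩
      · exact ⟨_, (h.conj (.refl D)).trans (.assoc _ _ _)⟩
    · rcases ihD x (Item.par_inr_eq_none.1 hx) with h | ⟨E, h⟩
      · exact ⟨C, (ACEq.comm _ _).trans (h.conj (.refl C))⟩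
      · exact ⟨_, (ACEq.comm _ _).trans ((h.conj (.refl C)).trans (.assoc _ _ _))⟩
  | ex r C _ =>
    rcases x with _ | x
    · exact .inl (.refl _)
    · cases hx

theorem redStep_of_roots {C D : Concept} {x : Item C} {y : Item D} (hx : Item.par C x = none)
    (hy : Item.par D y = none) (h : Subsumed (Item.term C x) (Item.term D y)) :
    ∃ E, RedStep (.conj C D) E := by
  rcases acEq_root x hx with h₁ | ⟨F, h₁⟩ <;> rcases acEq_root y hy with h₂ | ⟨G, h₂⟩
  · exact ⟨_, _, _, h₁.conj h₂, .here h, .refl _⟩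
  · exact ⟨_, _, _, (h₁.conj h₂).trans (ACEq.assoc _ _ _).symm, (Contract.here h).left G, .refl _⟩
  · exact ⟨_, _, _, (h₁.conj h₂).trans ((ACEq.assoc _ _ _).trans (((ACEq.refl _).conj
      (.comm _ _)).trans (ACEq.assoc _ _ _).symm)), (Contract.here h).left F, .refl _⟩
  · refine ⟨_, _, _, (h₁.conj h₂).trans (ACEq.trans ?_ (ACEq.assoc _ _ _).symm),
      (Contract.here h).left (.conj F G), .refl _⟩
    exact (ACEq.assoc _ _ _).trans ((ACEq.refl _).conj ((ACEq.assoc _ _ _).symm.trans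
      (((ACEq.comm _ _).conj (.refl _)).trans (.assoc _ _ _))))

/-- Distinct siblings belong to the same conjunction. Associativity and commutativity make them
adjacent, and then the weaker one can be contracted away. -/
theorem exists_redStep {C : Concept} {x y : Item C} (hne : x ≠ y)
    (hpar : Item.par C x = Item.par C y) (h : Subsumed (Item.term C x) (Item.term C y)) :
    ∃ D, RedStep C D := by
  induction C with
  | top => exact x.elim
  | atom A => exact (hne (Subsingleton.elim (α := Unit) _ _)).elim
  | conj C D ihC ihD =>
    rcases x with x | x <;> rcases y with y | y
    · obtain ⟨E, hE⟩ := ihC (fun h => hne (congrArg Sum.inl h))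
        (Option.map_injective Sum.inl_injective hpar) h
      exact ⟨_, hE.conjLeft D⟩
    -- Items of different conjuncts can have equal parents only if both are roots.
    · have hx : Item.par C x = none := by
        change (Item.par C x).map Sum.inl = (Item.par D y).map Sum.inr at hpar
        cases h1 : Item.par C x with
        | none => rfl
        | some i => cases h2 : Item.par D y <;> rw [h1, h2] at hpar <;> cases hpar
      have hy : Item.par D y = none := by
        change (Item.par C x).map Sum.inl = (Item.par D y).map Sum.inr at hpar
        cases h1 : Item.par D y with
        | none => rfl
        | some i => rw [hx, h1] at hpar; cases hpar
      exact redStep_of_roots hx hy h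
    · have hx : Item.par D x = none := by
        change (Item.par D x).map Sum.inr = (Item.par C y).map Sum.inl at hpar
        cases h1 : Item.par D x with
        | none => rfl
        | some i => cases h2 : Item.par C y <;> rw [h1, h2] at hpar <;> cases hpar
      have hy : Item.par C y = none := by
        change (Item.par D x).map Sum.inr = (Item.par C y).map Sum.inl at hpar
        cases h1 : Item.par C y with
        | none => rfl
        | some i => rw [hx, h1] at hpar; cases hpar
      obtain ⟨E, F, G, h1, h2, h3⟩ := redStep_of_roots hx hy h
      exact ⟨E, F, G, (ACEq.comm _ _).trans h1, h2, h3⟩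
    · obtain ⟨E, hE⟩ := ihD (fun h => hne (congrArg Sum.inr h))
        (Option.map_injective Sum.inr_injective hpar) h
      exact ⟨_, hE.conjRight C⟩
  | ex r C ih =>
    rcases x with _ | x <;> rcases y with _ | y
    · exact (hne rfl).elim
    · cases hpar
    · cases hpar
    · obtain ⟨E, hE⟩ := ih (fun h => hne (congrArg some h)) (Option.some.inj hpar) h
      exact ⟨_, hE.ex r⟩

/-- The items below an item. -/
theorem exists_term_map (C : Concept) (x : Item C) : ∃ g : Item (Item.term C x) → Item C,
    IsHom (Item.term C x) C (Item.par C x) g ∧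
    (∃ r, Item.par _ r = none ∧ (∀ i, Item.par _ i = none → i = r) ∧ g r = x) ∧
    ∀ k j, Item.par C k = some (g j) → ∃ i, g i = k ∧ Item.par _ i = some j := by
  induction C with
  | top => exact x.elim
  | atom A => exact ⟨id, isRootHom_id _, ⟨(), rfl, fun _ _ => rfl, rfl⟩, fun _ _ h => by cases h⟩
  | conj C D ihC ihD =>
    rcases x with x | x
    · obtain ⟨g, h1, ⟨r, h2, h3, h4⟩, h5⟩ := ihC x
      refine ⟨fun i => Sum.inl (g i), ⟨h1.lab, fun i => ?_⟩, ⟨r, h2, h3, congrArg Sum.inl h4⟩, ?_⟩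
      · refine (congrArg (Option.map Sum.inl) (h1.par i)).trans ?_
        change Option.map Sum.inl (Option.elim (Item.par (Item.term C x) i) _ _) =
          Option.elim (Item.par (Item.term C x) i) ((Item.par C x).map Sum.inl) _
        cases Item.par (Item.term C x) i <;> rfl
      · rintro (k | k) j hk
        · obtain ⟨i, hi, hi'⟩ := h5 k j (Option.map_injective Sum.inl_injective hk)
          exact ⟨i, congrArg Sum.inl hi, hi'⟩
        · obtain ⟨l, -, hl⟩ := Option.map_eq_some_iff.1 hk
          cases hl
    · obtain ⟨g, h1, ⟨r, h2, h3, h4⟩, h5⟩ := ihD x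
      refine ⟨fun i => Sum.inr (g i), ⟨h1.lab, fun i => ?_⟩, ⟨r, h2, h3, congrArg Sum.inr h4⟩, ?_⟩
      · refine (congrArg (Option.map Sum.inr) (h1.par i)).trans ?_
        change Option.map Sum.inr (Option.elim (Item.par (Item.term D x) i) _ _) =
          Option.elim (Item.par (Item.term D x) i) ((Item.par D x).map Sum.inr) _
        cases Item.par (Item.term D x) i <;> rfl
      · rintro (k | k) j hk
        · obtain ⟨l, -, hl⟩ := Option.map_eq_some_iff.1 hk
          cases hl
        · obtain ⟨i, hi, hi'⟩ := h5 k j (Option.map_injective Sum.inr_injective hk)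
          exact ⟨i, congrArg Sum.inr hi, hi'⟩
  | ex r C ih =>
    rcases x with _ | x
    · refine ⟨id, isRootHom_id _, ⟨(none : Option (Item C)), rfl, ?_, rfl⟩,
        fun k j h => ⟨k, rfl, h⟩⟩
      rintro (_ | i) hi
      · rfl
      · cases hi
    · obtain ⟨g, h1, ⟨s, h2, h3, h4⟩, h5⟩ := ih x
      refine ⟨fun i => (some (g i) : Option (Item C)), ⟨h1.lab, fun i => ?_⟩,
        ⟨s, h2, h3, congrArg some h4⟩, ?_⟩
      · refine (congrArg some (h1.par i)).trans ?_
        change some (Option.elim (Item.par (Item.term C x) i) _ _) =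
          Option.elim (Item.par (Item.term C x) i) (some (Item.par C x)) _
        cases Item.par (Item.term C x) i <;> rfl
      · rintro (_ | k) j hk
        · cases hk
        · obtain ⟨i, hi, hi'⟩ := h5 k j (Option.some.inj hk)
          exact ⟨i, congrArg some hi, hi'⟩

/-- `f` carries the subtree at `y` into the subtree at `f y`. Following `f` is a simulation between
the two, hence yields a homomorphism. -/
theorem IsHom.subsumed_term {C : Concept} {f : Item C → Item C} {n : Option (Item C)}
    (hf : IsHom C C n f) (y : Item C) :
    Subsumed (Item.term C (f y)) (Item.term C y) := by
  obtain ⟨g, g1, ⟨r, g2, g3, g4⟩, -⟩ := exists_term_map C y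
  obtain ⟨h, h1, ⟨s, h2, h3, h4⟩, h5⟩ := exists_term_map C (f y)
  obtain ⟨φ, hφ⟩ := exists_isHom_of_simulation (Item.term C y) (Item.term C (f y)) none
    (fun a b => (a = none ∧ b = none) ∨ ∃ i j, a = some i ∧ b = some j ∧ f (g i) = h j)
    (.inl ⟨rfl, rfl⟩) (by
      rintro i m (⟨hi, rfl⟩ | ⟨i', j', hi, rfl, hij⟩)
      · have hi' := g3 i hi
        subst hi'
        refine ⟨s, h2, ?_, .inr ⟨_, _, rfl, rfl, by rw [g4, h4]⟩⟩
        rw [← h1.lab, h4, hf.lab, ← g1.lab, g4]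
      · have hp : Item.par C (f (g i)) = some (h j') := by
          rw [hf.par, g1.par, hi]
          exact congrArg some hij
        obtain ⟨j, hj, hj'⟩ := h5 _ _ hp
        refine ⟨j, hj', ?_, .inr ⟨_, _, rfl, rfl, hj.symm⟩⟩
        rw [← h1.lab, hj, hf.lab, g1.lab])
  exact hφ.subsumed

/-- Concepts all of whose endomorphisms are injective. -/
def IsCore (C : Concept) : Prop := ∀ f, IsRootHom C C f → f.Injective

/-- An endomorphism of a reduced concept is even the identity. Otherwise an item of least depth that
is moved goes to a sibling, whose concept is subsumed by that of the item, and a reduction step is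
possible. -/
theorem IsReduced.isCore {C : Concept} (h : IsReduced C) : IsCore C := by
  intro f hf
  have key : ∀ n, ∀ y, Item.depth C y = n → f y = y := by
    intro n
    induction n using Nat.strong_induction_on with
    | _ n ih =>
      intro y hy
      by_contra hne
      have hpar : Item.par C (f y) = Item.par C y := by
        rw [hf.par]
        cases hp : Item.par C y with
        | none => rfl
        | some z =>
          have hd := Item.depth_par C y
          rw [hp] at hd
          exact congrArg some (ih _ (by rw [← hy, hd]; exact Nat.lt_succ_self _) z rfl)
      obtain ⟨D, hD⟩ := exists_redStep hne hpar (hf.subsumed_term y)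
      exact h D hD
  intro x y hxy
  rw [← key _ x rfl, ← key _ y rfl, hxy]

/-- The round trip from `C` through `D` is an endomorphism of a core, hence injective, and so is its
first leg. -/
theorem IsCore.embeds {C D : Concept} (hC : IsCore C) (h₁ : Subsumed C D) (h₂ : Subsumed D C) :
    Embeds C D := by
  obtain ⟨f, hf⟩ := exists_isHom_of_subsumed h₁
  obtain ⟨g, hg⟩ := exists_isHom_of_subsumed h₂
  exact ⟨g, hg, (hC _ (hf.comp hg)).of_comp⟩

theorem IsReducedForm.subsumed {C D : Concept} (h : IsReducedForm C D) :
    Subsumed C D ∧ Subsumed D C :=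
  ⟨subsumed_iff.2 fun I => (ext_eq_of_reds h.1 I).subset,
    subsumed_iff.2 fun I => (ext_eq_of_reds h.1 I).symm.subset⟩

/-- Embeddings into an equivalent core. -/
theorem synGen_embeds {C D R : Concept} (h : SynGen C D) (h₁ : Subsumed C R)
    (h₂ : Subsumed R C) : Embeds D R := by
  obtain ⟨C₁, D₁, hC, hr, -, hD⟩ := h
  refine ((embeds_of_acuEq hD).1.trans hr.embeds).trans (hC.2.isCore.embeds ?_ ?_)
  · exact hC.subsumed.2.trans h₁
  · exact h₂.trans hC.subsumed.1

/-- Reduction only deletes items, so the reduced form embeds into the concept itself. This handles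
the second of two successive weakenings, where the concept need not be reduced. -/
theorem synGen_embeds_self {C D : Concept} (h : SynGen C D) : Embeds D C := by
  obtain ⟨C₁, D₁, hC, hr, -, hD⟩ := h
  exact ((embeds_of_acuEq hD).1.trans hr.embeds).trans (embeds_of_reds hC.1)

/-- The core `R` embeds into an actual reduced form of `C`, where the embedding of `D` becomes a
replacement. The last hypothesis rules out the replacement that changes nothing. -/
theorem synGen_of_embeds {C D R : Concept} (hR : IsCore R) (h₁ : Subsumed C R)
    (h₂ : Subsumed R C) (hD : Embeds D R) (hne : ¬ Subsumed D C) : SynGen C D := by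
  obtain ⟨C₁, hC⟩ := exists_isReducedForm C
  have hRC : Embeds R C₁ := hR.embeds (h₂.trans hC.subsumed.1) (hC.subsumed.2.trans h₁)
  obtain ⟨D₁, hr, hD₁⟩ := exists_repl_of_embeds (hD.trans hRC)
  refine ⟨C₁, D₁, hC, hr, ?_, hD₁⟩
  rintro rfl
  exact hne ((embeds_of_acuEq hD₁).2.subsumed.trans hC.subsumed.2)

end EL

namespace EL

/-! ### Items and positions -/

/-- The position of an item, when the concept is found at position `p`. -/
def pth : (C : Concept) → List Bool → Item C → List Bool
  | .top, _, i => Empty.elim i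
  | .atom _, p, _ => p
  | .conj C D, p, i => Sum.elim (fun i : Item C => pth C (false :: p) i)
      (fun i : Item D => pth D (true :: p) i) i
  | .ex _ C, p, i => Option.elim i p fun i : Item C => pth C (false :: p) i

/-- The position of a node, when the root is found at position `q`. -/
def nid (C : Concept) (p q : List Bool) (n : Option (Item C)) : List Bool :=
  n.elim q fun j => false :: pth C p j

theorem pth_suffix (C : Concept) (p : List Bool) (i : Item C) : p <:+ pth C p i := by
  induction C generalizing p with
  | top => exact i.elim
  | atom A => exact List.suffix_refl _
  | conj C D ihC ihD =>
    rcases i with i | i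
    · exact (List.suffix_cons _ _).trans (ihC (false :: p) i)
    · exact (List.suffix_cons _ _).trans (ihD (true :: p) i)
  | ex r C ih =>
    rcases i with _ | i
    · exact List.suffix_refl _
    · exact (List.suffix_cons _ _).trans (ih (false :: p) i)

theorem pth_injective (C : Concept) (p : List Bool) : Function.Injective (pth C p) := by
  induction C generalizing p with
  | top => exact fun i => Empty.elim i
  | atom A => exact fun _ _ _ => rfl
  | conj C D ihC ihD =>
    have hne : ∀ i j, pth C (false :: p) i ≠ pth D (true :: p) j := by
      intro i j h
      obtain ⟨l, hl⟩ := pth_suffix C (false :: p) i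
      obtain ⟨m, hm⟩ := pth_suffix D (true :: p) j
      rw [← hl, ← hm] at h
      have := (List.append_inj' h rfl).2
      simp at this
    rintro (i | i) (j | j) h
    · exact congrArg Sum.inl (ihC _ h)
    · exact (hne i j h).elim
    · exact (hne j i h.symm).elim
    · exact congrArg Sum.inr (ihD _ h)
  | ex r C ih =>
    have hne : ∀ i, pth C (false :: p) i ≠ p := by
      intro i h
      have := (pth_suffix C (false :: p) i).length_le
      rw [h] at this
      simp at this
    rintro (_ | i) (_ | j) h
    · rfl
    · exact (hne j h.symm).elim
    · exact (hne i h).elim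
    · exact congrArg some (ih _ h)

theorem nid_injective (C : Concept) : Function.Injective (nid C [] []) := by
  rintro (_ | i) (_ | j) h
  · rfl
  · simp [nid] at h
  · simp [nid] at h
  · simp only [nid, Option.elim_some, List.cons.injEq, true_and] at h
    rw [pth_injective C [] h]

/-- The occurrence that belongs to an item. -/
def entry (C : Concept) (p q : List Bool) (i : Item C) : Occ :=
  (pth C p i, nid C p q (Item.par C i), Item.term C i)

theorem mem_filter_occ (C : Concept) (p q : List Bool) (e : Occ) :
    e ∈ (occ p q C).filter (fun e => e.2.2.isKind 1 || e.2.2.isKind 3) ↔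
      ∃ i, entry C p q i = e := by
  induction C generalizing p q with
  | top =>
    simp [occ, Concept.isKind, Concept.kind]
    exact fun i => Empty.elim i
  | atom A =>
    simp only [occ, Concept.isKind, Concept.kind, List.filter_cons]
    simp only [decide_true, Bool.true_or, if_true, List.filter_nil, List.mem_singleton]
    exact ⟨fun h => ⟨(), h.symm⟩, fun ⟨_, h⟩ => h.symm⟩
  | conj C D ihC ihD =>
    have h : (occ p q (.conj C D)).filter (fun e => e.2.2.isKind 1 || e.2.2.isKind 3) =
      (occ (false :: p) q C).filter (fun e => e.2.2.isKind 1 || e.2.2.isKind 3) ++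
        (occ (true :: p) q D).filter (fun e => e.2.2.isKind 1 || e.2.2.isKind 3) := by
      simp [occ, Concept.isKind, Concept.kind]
    rw [h, List.mem_append, ihC, ihD]
    have h1 : ∀ i : Item C, entry (.conj C D) p q (Sum.inl i) = entry C (false :: p) q i := by
      intro i
      change (_, Option.elim ((Item.par C i).map Sum.inl) _ _, _) = _
      cases e : Item.par C i <;> simp only [entry, nid, e] <;> rfl
    have h2 : ∀ i : Item D, entry (.conj C D) p q (Sum.inr i) = entry D (true :: p) q i := by
      intro i
      change (_, Option.elim ((Item.par D i).map Sum.inr) _ _, _) = _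
      cases e : Item.par D i <;> simp only [entry, nid, e] <;> rfl
    constructor
    · rintro (⟨i, rfl⟩ | ⟨i, rfl⟩)
      · exact ⟨Sum.inl i, h1 i⟩
      · exact ⟨Sum.inr i, h2 i⟩
    · rintro ⟨i | i, rfl⟩
      · exact .inl ⟨i, (h1 i).symm⟩
      · exact .inr ⟨i, (h2 i).symm⟩
  | ex r C ih =>
    have h : (occ p q (.ex r C)).filter (fun e => e.2.2.isKind 1 || e.2.2.isKind 3) =
      (p, q, .ex r C) ::
      (occ (false :: p) (false :: p) C).filter (fun e => e.2.2.isKind 1 || e.2.2.isKind 3) := by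
      simp [occ, Concept.isKind, Concept.kind]
    rw [h, List.mem_cons, ih]
    have h1 : ∀ i : Item C, entry (.ex r C) p q (some i : Option (Item C)) =
        entry C (false :: p) (false :: p) i := by
      intro i
      change (_, false :: Option.elim (Item.par C i) _ _, _) = _
      cases e : Item.par C i <;> simp only [entry, nid, e] <;> rfl
    constructor
    · rintro (rfl | ⟨i, rfl⟩)
      · exact ⟨(none : Option (Item C)), rfl⟩
      · exact ⟨(some i : Option (Item C)), h1 i⟩
    · rintro ⟨_ | i, rfl⟩
      · exact .inl rfl
      · exact .inr ⟨i, (h1 i).symm⟩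

theorem mem_items {C : Concept} {e : Occ} : e ∈ items C ↔ ∃ i, entry C [] [] i = e :=
  mem_filter_occ C [] [] e

theorem card_item_le (C : Concept) : Nat.card (Item C) ≤ (items C).length := by
  classical
  let f : Item C → (items C).toFinset := fun i =>
    ⟨entry C [] [] i, List.mem_toFinset.2 (mem_items.2 ⟨i, rfl⟩)⟩
  have hf : f.Injective := by
    intro i j h
    have h1 : entry C [] [] i = entry C [] [] j := congrArg Subtype.val h
    exact pth_injective C [] (congrArg Prod.fst h1)
  have := Nat.card_le_card_of_injective f hf
  refine this.trans ?_
  rw [Nat.card_eq_fintype_card, Fintype.card_coe]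
  exact List.toFinset_card_le _

/-- Links the computation on lists of positions with the argument about sets of items. -/
theorem restr_eq_restrict (S : List (List Bool)) (p : List Bool) (C : Concept) :
    restr S p C = restrict C fun i => pth C p i ∈ S := by
  induction C generalizing p with
  | top => rfl
  | atom A =>
    by_cases h : p ∈ S
    · rw [restrict_atom_pos (S := fun i => pth (.atom A) p i ∈ S) h]
      simp [restr, memb_iff.2 h]
    · rw [restrict_atom_neg (S := fun i => pth (.atom A) p i ∈ S) h]
      simp [restr, ← memb_iff] at h ⊢
      simp [h]
  | conj C D ihC ihD =>
    simp only [restr, ihC, ihD]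
    rfl
  | ex r C ih =>
    by_cases h : p ∈ S
    · rw [restrict_ex_pos (S := fun i => pth (.ex r C) p i ∈ S) h]
      simp only [restr, memb_iff.2 h, cond_true, ih]
      rfl
    · rw [restrict_ex_neg (S := fun i => pth (.ex r C) p i ∈ S) h]
      rw [← memb_iff, Bool.not_eq_true] at h
      simp only [restr, h, cond_false]

/-! ### Correctness of `reduce` -/

theorem restrict_mono (C : Concept) {S T : Item C → Prop} (h : ∀ i, S i → T i) :
    Subsumed (restrict C T) (restrict C S) := by
  rw [subsumed_iff]
  intro I
  induction C with
  | top => exact Set.Subset.rfl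
  | atom A =>
    by_cases hS : S ()
    · rw [restrict_atom_pos hS, restrict_atom_pos (h _ hS)]
    · rw [restrict_atom_neg hS]
      exact Set.subset_univ _
  | conj C D ihC ihD =>
    exact Set.inter_subset_inter (ihC fun i => h (Sum.inl i)) (ihD fun i => h (Sum.inr i))
  | ex r C ih =>
    by_cases hS : S (none : Option (Item C))
    · rw [restrict_ex_pos hS, restrict_ex_pos (h _ hS)]
      rintro d ⟨e, he, hde⟩
      exact ⟨e, ih (fun i => h (some i : Option (Item C))) he, hde⟩
    · rw [restrict_ex_neg hS]
      exact Set.subset_univ _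

theorem without_eq (C : Concept) (x : Item C) :
    without C (pth C [] x) = restrict C fun i => i ≠ x := by
  rw [without, restr_eq_restrict]
  congr 1
  funext i
  simp only [List.mem_map, List.mem_filter, mem_items, Bool.not_eq_true', eqb_false_iff, eq_iff_iff]
  constructor
  · rintro ⟨e, ⟨-, h⟩, h2⟩ rfl
    exact h h2
  · intro h
    exact ⟨_, ⟨⟨i, rfl⟩, fun h2 => h (pth_injective C [] h2)⟩, rfl⟩

theorem entailsb_nil_iff {C D : Concept} : entailsb [] (.gci C D) = true ↔ Subsumed C D := by
  rw [entailsb_iff]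
  have : ontology [] = ∅ := by ext; simp [ontology]
  rw [this]
  rfl

theorem card_restrict_lt (C : Concept) (x : Item C) :
    Nat.card (Item (restrict C fun i => i ≠ x)) < Nat.card (Item C) := by
  obtain ⟨f, -, h2, h3, -⟩ := exists_restrict_map' C fun i => i ≠ x
  refine lt_of_le_of_ne (Nat.card_le_card_of_injective f h2) fun h => ?_
  have := (Nat.bijective_iff_injective_and_card f).2 ⟨h2, h⟩
  obtain ⟨y, hy⟩ := this.2 x
  exact h3 y hy

/-- A non-injective endomorphism of a finite tree misses some item `x`. Its range is closed under
parents, so `C` maps into the restriction to the range, and deleting `x` would have preserved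
equivalence. -/
theorem isCore_of_minimal {C : Concept}
    (h : ∀ x, ¬ Subsumed (restrict C fun i => i ≠ x) C) : IsCore C := by
  intro f hf
  by_contra hinj
  have hsurj : ¬ f.Surjective := fun hs => hinj (Finite.injective_iff_surjective.2 hs)
  simp only [Function.Surjective, not_forall, not_exists] at hsurj
  obtain ⟨x, hx⟩ := hsurj
  refine h x ?_
  have hclosed : ParentClosed fun i => ∃ y, f y = i := by
    rintro i j hij ⟨y, rfl⟩
    rw [hf.par] at hij
    cases hp : Item.par C y with
    | none => rw [hp] at hij; cases hij
    | some z => rw [hp] at hij; exact ⟨z, Option.some.inj hij⟩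
  obtain ⟨e, h1, h2, h3⟩ := exists_restrict_map C _ hclosed
  obtain ⟨g, hg, -⟩ := hf.factor h1 h2 fun y => (h3 _).2 ⟨y, rfl⟩
  refine Subsumed.trans (restrict_mono C ?_) hg.subsumed
  rintro i ⟨y, rfl⟩
  exact hx y

theorem reduce_spec (D : Concept) :
    Subsumed D (reduce D) ∧ Subsumed (reduce D) D ∧ IsCore (reduce D) := by
  have hstep : ∀ R, reduceStep D R = R ∧ (∀ x, ¬ Subsumed (restrict R fun i => i ≠ x) D) ∨
      ∃ x, reduceStep D R = restrict R (fun i => i ≠ x) ∧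
        Subsumed (restrict R fun i => i ≠ x) D := by
    intro R
    cases h : (items R).find? fun z => entailsb [] (.gci (without R z.1) D) with
    | none =>
      left
      refine ⟨by rw [reduceStep, h]; rfl, fun x hx => ?_⟩
      have := List.find?_eq_none.1 h _ (mem_items.2 ⟨x, rfl⟩)
      rw [entailsb_nil_iff] at this
      exact this ((without_eq R x).symm ▸ hx)
    | some z =>
      right
      obtain ⟨x, rfl⟩ := mem_items.1 (List.mem_of_find?_eq_some h)
      have h2 := List.find?_some h
      rw [entailsb_nil_iff] at h2
      have h3 : without R (entry R [] [] x).1 = restrict R fun i => i ≠ x := without_eq R x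
      refine ⟨x, by rw [reduceStep, h, Option.elim_some, h3], h3 ▸ h2⟩
  obtain ⟨hfix, ⟨h1, h2, -⟩⟩ := iterate_fixed (f := reduceStep D)
    (fun R => Subsumed D R ∧ Subsumed R D ∧ Nat.card (Item R) ≤ (items D).length)
    -- Each proper step removes at least one item, and at most `(items D).length` items can go.
    (fun R => (items D).length - Nat.card (Item R)) (items D).length
    (by
      rintro R ⟨h1, h2, h3⟩
      rcases hstep R with ⟨h, -⟩ | ⟨x, h, hx⟩
      · rw [h]; exact ⟨h1, h2, h3⟩
      · rw [h]
        exact ⟨h1.trans (repl_restrict R _).embeds.subsumed, hx,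
          (card_restrict_lt R x).le.trans h3⟩)
    (by
      rintro R ⟨h1, h2, h3⟩
      rcases hstep R with ⟨h, -⟩ | ⟨x, h, hx⟩
      · exact .inl h
      · right
        rw [h]
        have := card_restrict_lt R x
        omega)
    (fun _ _ => Nat.sub_le _ _) (s := D) ⟨.refl _, .refl _, card_item_le D⟩
  refine ⟨h1, h2, isCore_of_minimal fun x hx => ?_⟩
  rcases hstep (reduce D) with ⟨-, h⟩ | ⟨y, h, hy⟩
  · exact h x (hx.trans h2)
  · have h3 := card_restrict_lt (reduce D) y
    rw [← h] at h3
    have h4 : reduceStep D (reduce D) = reduce D := hfix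
    rw [h4] at h3
    exact lt_irrefl _ h3

end EL

namespace EL

/-! ### Simulations between the nodes of a set of items -/

variable {R : Concept}

/-- The root and the items in `S`. -/
def IsNode (S : Item R → Prop) (x : Option (Item R)) : Prop := x.elim True S

/-- The condition on a pair of related nodes in the definition of simulations. -/
def SimAt (S : Item R → Prop) (B : Option (Item R) → Option (Item R) → Prop)
    (x y : Option (Item R)) : Prop :=
  ((x = none ∧ y = none) ∨ ∃ i j, x = some i ∧ y = some j ∧ Item.lab R i = Item.lab R j ∧
    B (Item.par R i) (Item.par R j)) ∧
  ∀ j, S j → Item.par R j = y → ∃ i, S i ∧ Item.par R i = x ∧ B (some i) (some j)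

/-- Relations between nodes that match the paths to the root, and each child of the second node
with a child of the first. -/
def IsSim (S : Item R → Prop) (B : Option (Item R) → Option (Item R) → Prop) : Prop :=
  ∀ x y, B x y → IsNode S x ∧ IsNode S y ∧ SimAt S B x y

theorem mem_nodeIds_iff {P : List (List Bool)} {x : Option (Item R)} :
    nid R [] [] x ∈ nodeIds P ↔ IsNode (fun i => pth R [] i ∈ P) x := by
  cases x <;> simp [nid, nodeIds, IsNode]

theorem simOk_iff {P : List (List Bool)} {L : List (List Bool × List Bool)}
    {x y : Option (Item R)} :
    simOk (items R) P L (nid R [] [] x, nid R [] [] y) = true ↔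
      SimAt (fun i => pth R [] i ∈ P) (fun a b => (nid R [] [] a, nid R [] [] b) ∈ L) x y := by
  have h1 : ∀ (x : Option (Item R)) (i : Item R),
      false :: pth R [] i = nid R [] [] x ↔ x = some i := by
    intro x i
    exact ⟨fun h => (nid_injective R (a₁ := some i) h).symm, fun h => by rw [h]; rfl⟩
  have h2 : ∀ x : Option (Item R), nid R [] [] x = [] ↔ x = none := by
    intro x
    exact ⟨fun h => nid_injective R (a₂ := none) h, fun h => by rw [h]; rfl⟩
  have h3 : ∀ x y : Option (Item R), nid R [] [] x = nid R [] [] y ↔ x = y := fun x y =>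
    (nid_injective R).eq_iff
  simp only [simOk, Bool.and_eq_true, Bool.or_eq_true, List.any_eq_true, List.all_eq_true,
    eqb_iff, memb_iff, mem_items, SimAt, Bool.not_eq_true']
  refine and_congr (or_congr (and_congr (h2 _) (h2 _)) ?_) ?_
  · constructor
    · rintro ⟨_, ⟨i, rfl⟩, hi, _, ⟨j, rfl⟩, ⟨hj, hl⟩, hB⟩
      exact ⟨i, j, (h1 _ _).1 hi, (h1 _ _).1 hj, hl, hB⟩
    · rintro ⟨i, j, hi, hj, hl, hB⟩
      exact ⟨_, ⟨i, rfl⟩, (h1 _ _).2 hi, _, ⟨j, rfl⟩, ⟨(h1 _ _).2 hj, hl⟩, hB⟩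
  · constructor
    · intro h j hj hy
      rcases h _ ⟨j, rfl⟩ with h | ⟨_, ⟨i, rfl⟩, ⟨hi, hx⟩, hB⟩
      · have h4 : (memb (entry R [] [] j).1 P && eqb (entry R [] [] j).2.1 (nid R [] [] y)) =
            true := by
          simp only [Bool.and_eq_true, memb_iff, eqb_iff]
          exact ⟨hj, congrArg (nid R [] []) hy⟩
        rw [h4] at h
        cases h
      · exact ⟨i, hi, (h3 _ _).1 hx, hB⟩
    · rintro h _ ⟨j, rfl⟩
      by_cases hj : pth R [] j ∈ P ∧ Item.par R j = y
      · obtain ⟨i, hi, hx, hB⟩ := h j hj.1 hj.2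
        exact .inr ⟨_, ⟨i, rfl⟩, ⟨hi, congrArg (nid R [] []) hx⟩, hB⟩
      · left
        rw [← Bool.not_eq_true, Bool.and_eq_true, memb_iff, eqb_iff]
        exact fun h => hj ⟨h.1, (h3 _ _).1 h.2⟩

/-- `simRel` is the greatest simulation. -/
theorem simRel_spec (P : List (List Bool)) :
    IsSim (fun i => pth R [] i ∈ P)
        (fun x y => (nid R [] [] x, nid R [] [] y) ∈ simRel (items R) P) ∧
      ∀ B, IsSim (fun i => pth R [] i ∈ P) B → ∀ x y, B x y →
        (nid R [] [] x, nid R [] [] y) ∈ simRel (items R) P := by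
  let U := pairs (nodeIds P) (nodeIds P)
  obtain ⟨h1, h2, h3, -⟩ := iterate_fixed
    (f := fun L : List (List Bool × List Bool) => L.filter (simOk (items R) P L))
    (fun L => (∀ e ∈ L, e ∈ U) ∧ (∀ B, IsSim (fun i => pth R [] i ∈ P) B → ∀ x y, B x y →
      (nid R [] [] x, nid R [] [] y) ∈ L) ∧ L.length ≤ U.length)
    (fun L => U.length - L.length) U.length
    (by
      rintro L ⟨h1, h2, h3⟩
      refine ⟨fun e he => h1 e (List.mem_of_mem_filter he), fun B hB x y hxy => ?_,
        (List.length_filter_le _ _).trans h3⟩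
      refine List.mem_filter.2 ⟨h2 B hB x y hxy, simOk_iff.2 ?_⟩
      obtain ⟨-, -, h4, h5⟩ := hB x y hxy
      refine ⟨h4.imp_right ?_, fun j hj hy => ?_⟩
      · rintro ⟨i, j, hi, hj, hl, h⟩
        exact ⟨i, j, hi, hj, hl, h2 B hB _ _ h⟩
      · obtain ⟨i, hi, hx, h⟩ := h5 j hj hy
        exact ⟨i, hi, hx, h2 B hB _ _ h⟩)
    (by
      rintro L ⟨-, -, h3⟩
      rcases (List.length_filter_le (simOk (items R) P L) L).eq_or_lt with h | h
      · exact .inl (List.filter_sublist.eq_of_length h)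
      · right
        omega)
    (fun _ _ => Nat.sub_le _ _) (s := U)
    ⟨fun _ h => h, fun B hB x y hxy => by
      obtain ⟨hx, hy, -⟩ := hB x y hxy
      exact mem_pairs.2 ⟨mem_nodeIds_iff.2 hx, mem_nodeIds_iff.2 hy⟩, le_rfl⟩
  refine ⟨fun x y hxy => ?_, h3⟩
  obtain ⟨hx, hy⟩ := mem_pairs.1 (h2 _ hxy)
  have hxy' : (nid R [] [] x, nid R [] [] y) ∈ simRel (items R) P := hxy
  refine ⟨mem_nodeIds_iff.1 hx, mem_nodeIds_iff.1 hy, simOk_iff.1 ?_⟩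
  change List.filter (simOk (items R) P (simRel (items R) P)) (simRel (items R) P) =
    simRel (items R) P at h1
  rw [← h1] at hxy'
  exact (List.mem_filter.1 hxy').2

/-- The greatest simulation between the nodes of `S`. -/
def Sim (S : Item R → Prop) (x y : Option (Item R)) : Prop := ∃ B, IsSim S B ∧ B x y

theorem isSim_sim (S : Item R → Prop) : IsSim S (Sim S) := by
  rintro x y ⟨B, hB, hxy⟩
  obtain ⟨hx, hy, h1, h2⟩ := hB x y hxy
  refine ⟨hx, hy, h1.imp_right ?_, fun j hj hy => ?_⟩
  · rintro ⟨i, j, hi, hj, hl, h⟩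
    exact ⟨i, j, hi, hj, hl, B, hB, h⟩
  · obtain ⟨i, hi, hx, h⟩ := h2 j hj hy
    exact ⟨i, hi, hx, B, hB, h⟩

theorem mem_simRel_iff {P : List (List Bool)} {x y : Option (Item R)} :
    (nid R [] [] x, nid R [] [] y) ∈ simRel (items R) P ↔
      Sim (fun i => pth R [] i ∈ P) x y :=
  ⟨fun h => ⟨_, (simRel_spec P).1, h⟩, fun ⟨B, hB, h⟩ => (simRel_spec P).2 B hB x y h⟩

theorem isNode_par {S : Item R → Prop} (hS : ParentClosed S) {i : Item R} (hi : S i) :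
    IsNode S (Item.par R i) := by
  cases h : Item.par R i with
  | none => trivial
  | some j => exact hS i j h hi

theorem sim_refl {S : Item R → Prop} (hS : ParentClosed S) {x : Option (Item R)}
    (hx : IsNode S x) : Sim S x x := by
  refine ⟨fun x y => x = y ∧ IsNode S x, ?_, rfl, hx⟩
  rintro x _ ⟨rfl, hx⟩
  refine ⟨hx, hx, ?_, fun j hj hy => ⟨j, hj, hy, rfl, hj⟩⟩
  cases x with
  | none => exact .inl ⟨rfl, rfl⟩
  | some i => exact .inr ⟨i, i, rfl, rfl, rfl, rfl, isNode_par hS hx⟩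

/-- Embeddings of a set of items. -/
structure EmbedsOn (S : Item R → Prop) (f : Item R → Item R) : Prop where
  inj : ∀ i j, S i → S j → f i = f j → i = j
  lab : ∀ i, S i → Item.lab R (f i) = Item.lab R i
  par : ∀ i, S i → Item.par R (f i) = (Item.par R i).map f

/-- Sets of items that are closed under their embeddings. -/
def Rigid (S : Item R → Prop) : Prop := ∀ f, EmbedsOn S f → ∀ i, S i → S (f i)

theorem exists_preimage {S : Item R → Prop} {f : Item R → Item R} (hf : EmbedsOn S f)
    (h : ∀ i, S i → S (f i)) {j : Item R} (hj : S j) : ∃ i, S i ∧ f i = j := by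
  let g : {i // S i} → {i // S i} := fun i => ⟨f i, h _ i.2⟩
  have hg : g.Injective := fun i j hij =>
    Subtype.ext (hf.inj _ _ i.2 j.2 (congrArg Subtype.val hij))
  obtain ⟨i, hi⟩ := Finite.injective_iff_surjective.1 hg ⟨j, hj⟩
  exact ⟨i, i.2, congrArg Subtype.val hi⟩

/-- By finiteness `f` permutes `S`, so the children of `f y` in `S` are exactly the images of the
children of `y`. What `x` offers for `y` therefore also serves `f y`. -/
theorem sim_map {S : Item R → Prop} (hS : ParentClosed S) {f : Item R → Item R}
    (hf : EmbedsOn S f) (h : ∀ i, S i → S (f i)) {x y : Option (Item R)} (hxy : Sim S x y) :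
    Sim S x (y.map f) := by
  refine ⟨fun x y => ∃ z, Sim S x z ∧ y = z.map f, ?_, y, hxy, rfl⟩
  rintro x _ ⟨z, hxz, rfl⟩
  obtain ⟨hx, hz, h1, h2⟩ := isSim_sim S x z hxz
  refine ⟨hx, ?_, ?_, fun j hj hy => ?_⟩
  · cases z with
    | none => trivial
    | some i => exact h i hz
  · rcases h1 with ⟨rfl, rfl⟩ | ⟨i, j, rfl, rfl, hl, hB⟩
    · exact .inl ⟨rfl, rfl⟩
    · exact .inr ⟨i, f j, rfl, rfl, hl.trans (hf.lab j hz).symm, _, hB, hf.par j hz⟩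
  · obtain ⟨k, hk, rfl⟩ := exists_preimage hf h hj
    have hkz : Item.par R k = z := by
      have h3 := isNode_par hS hk
      rw [hf.par k hk] at hy
      cases h4 : Item.par R k with
      | none => cases z with
        | none => rfl
        | some i => rw [h4] at hy; cases hy
      | some l => cases z with
        | none => rw [h4] at hy; cases hy
        | some i =>
          rw [h4] at hy h3
          rw [hf.inj l i h3 hz (Option.some.inj hy)]
    obtain ⟨i, hi, hx, hB⟩ := h2 k hk hkz
    exact ⟨i, hi, hx, some k, hB, rfl⟩

/-- Add to `S` all items similar to `z`. -/
def Orbit (S : Item R → Prop) (z : Item R) (i : Item R) : Prop :=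
  S i ∨ (Item.lab R i = Item.lab R z ∧ Sim S (Item.par R z) (Item.par R i))

theorem orbit_parentClosed {S : Item R → Prop} (hS : ParentClosed S) (z : Item R) :
    ParentClosed (Orbit S z) := by
  rintro i j hij (hi | ⟨-, hi⟩)
  · exact .inl (hS i j hij hi)
  · have := (isSim_sim S _ _ hi).2.1
    rw [hij] at this
    exact .inl this

/-- An embedding of the orbit restricts to one of `S`, which preserves `S` by rigidity. By `sim_map`
the image of a new item again hangs below a node simulated by the parent of `z`, and its label is
unchanged. -/
theorem orbit_rigid {S : Item R → Prop} (hS : ParentClosed S) (hR : Rigid S) (z : Item R) :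
    Rigid (Orbit S z) := by
  intro f hf
  have hfS : EmbedsOn S f := ⟨fun i j hi hj => hf.inj i j (.inl hi) (.inl hj),
    fun i hi => hf.lab i (.inl hi), fun i hi => hf.par i (.inl hi)⟩
  rintro i (hi | ⟨hl, hi⟩)
  · exact .inl (hR f hfS i hi)
  · refine .inr ⟨(hf.lab i (.inr ⟨hl, hi⟩)).trans hl, ?_⟩
    rw [hf.par i (.inr ⟨hl, hi⟩)]
    exact sim_map hS hfS (hR f hfS) hi

theorem orbit_self {S : Item R → Prop} (hS : ParentClosed S) {z : Item R}
    (hz : IsNode S (Item.par R z)) : Orbit S z z :=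
  .inr ⟨rfl, sim_refl hS hz⟩

/-- `Anc x y`: the node `x` is `y` or above `y`. -/
inductive Anc : Option (Item R) → Option (Item R) → Prop
  | refl (x : Option (Item R)) : Anc x x
  | par {i : Item R} {y : Option (Item R)} : Anc (some i) y → Anc (Item.par R i) y

/-- The number of steps from the root to a node. -/
def nodeDepth (x : Option (Item R)) : ℕ := x.elim 0 fun i => Item.depth R i + 1

theorem depth_eq_nodeDepth (i : Item R) : Item.depth R i = nodeDepth (Item.par R i) :=
  Item.depth_par R i

theorem anc_cases {x y : Option (Item R)} (h : Anc x y) :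
    x = y ∨ ∃ i, Item.par R i = x ∧ Anc (some i) y := by
  cases h with
  | refl => exact .inl rfl
  | par h => exact .inr ⟨_, rfl, h⟩

theorem anc_none (y : Option (Item R)) : Anc none y := by
  have key : ∀ n, ∀ x : Option (Item R), nodeDepth x = n → Anc x y → Anc none y := by
    intro n
    induction n with
    | zero =>
      rintro (_ | i) hi h
      · exact h
      · cases hi
    | succ n ih =>
      rintro (_ | i) hi h
      · exact h
      · refine ih _ ?_ h.par
        rw [← depth_eq_nodeDepth]
        exact Nat.succ.inj hi
  exact key _ y rfl (.refl y)

theorem sim_depth {S : Item R → Prop} {x y : Option (Item R)} (h : Sim S x y) :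
    nodeDepth x = nodeDepth y := by
  have key : ∀ n, ∀ x y : Option (Item R), nodeDepth x = n → Sim S x y → nodeDepth y = n := by
    intro n
    induction n with
    | zero =>
      intro x y hx h
      rcases (isSim_sim S _ _ h).2.2.1 with ⟨rfl, rfl⟩ | ⟨i, j, rfl, rfl, -, -⟩
      · rfl
      · cases hx
    | succ n ih =>
      intro x y hx h
      rcases (isSim_sim S _ _ h).2.2.1 with ⟨rfl, rfl⟩ | ⟨i, j, rfl, rfl, -, hB⟩
      · exact hx
      · refine congrArg Nat.succ ?_
        rw [depth_eq_nodeDepth]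
        exact ih _ _ ((depth_eq_nodeDepth i).symm.trans (Nat.succ.inj hx)) hB
  exact (key _ x y rfl h).symm

theorem Anc.depth {x y : Option (Item R)} (h : Anc x y) :
    x = y ∨ nodeDepth x < nodeDepth y := by
  induction h with
  | refl => exact .inl rfl
  | @par i y _ ih =>
    right
    have h1 : nodeDepth (some i) = nodeDepth (Item.par R i) + 1 :=
      congrArg Nat.succ (depth_eq_nodeDepth i)
    rcases ih with rfl | ih <;> omega

theorem anc_unique {x y p : Option (Item R)} (hx : Anc x p) (hy : Anc y p)
    (h : nodeDepth x = nodeDepth y) : x = y := by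
  induction hx generalizing y with
  | refl p => exact (hy.depth.resolve_right (by omega)).symm
  | @par i p hip ih =>
    rcases anc_cases hy with rfl | ⟨j, rfl, hj⟩
    · rcases hip.par.depth with h' | h'
      · exact h'
      · omega
    · rw [← depth_eq_nodeDepth, ← depth_eq_nodeDepth] at h
      rw [Option.some.inj (ih hj (congrArg Nat.succ h))]

theorem insert_parentClosed {S : Item R → Prop} (hS : ParentClosed S) {z : Item R}
    (hz : IsNode S (Item.par R z)) : ParentClosed fun i => S i ∨ i = z := by
  rintro i j hij (hi | rfl)
  · exact .inl (hS i j hij hi)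
  · rw [hij] at hz
    exact .inl hz

/-- Adding all items similar to `z` is not stronger than adding `z`. -/
theorem subsumed_orbit {S : Item R → Prop} (hS : ParentClosed S) {z : Item R}
    (hz : IsNode S (Item.par R z)) :
    Subsumed (restrict R fun i => S i ∨ i = z) (restrict R (Orbit S z)) := by
  obtain ⟨e, e1, e2, e3⟩ := exists_restrict_map R _ (insert_parentClosed hS hz)
  obtain ⟨g, g1, g2, g3⟩ := exists_restrict_map R _ (orbit_parentClosed hS z)
  have hepar : ∀ x, (Item.par _ x).map e = Item.par R (e x) := by
    intro x
    rw [e1.par]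
    cases Item.par _ x <;> rfl
  have hgpar : ∀ x, (Item.par _ x).map g = Item.par R (g x) := by
    intro x
    rw [g1.par]
    cases Item.par _ x <;> rfl
  have heinj := Option.map_injective e2
  let p := Item.par R z
  -- A node `y` goes to a node `x` that simulates it, and to the path from the root to `p` whenever
  -- some node on that path simulates `y`. This preference ensures that a parent of a new item goes
  -- to `p`, where `z` is available; new items themselves go to `z`.
  let H : Option (Item R) → Option (Item R) → Prop := fun y x =>
    (Sim S x y ∧ ((∃ c, Anc c p ∧ Sim S c y) → Anc x p)) ∨
      (x = some z ∧ ∃ w, y = some w ∧ ¬ S w)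
  suffices h : ∃ f, IsRootHom (restrict R (Orbit S z)) (restrict R fun i => S i ∨ i = z) f by
    obtain ⟨f, hf⟩ := h
    exact hf.subsumed
  refine exists_isHom_of_simulation _ _ none (fun y x => H (y.map g) (x.map e))
    (.inl ⟨sim_refl hS trivial, fun _ => anc_none p⟩) fun w m hm => ?_
  suffices h : ∃ j, (S j ∨ j = z) ∧ Item.par R j = m.map e ∧
      Item.lab R j = Item.lab R (g w) ∧ H (some (g w)) (some j) by
    obtain ⟨j, hj, hjm, hjl, hjH⟩ := h
    obtain ⟨j, rfl⟩ := (e3 j).2 hj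
    refine ⟨j, heinj ((hepar j).trans hjm), ?_, hjH⟩
    rw [← e1.lab, hjl, g1.lab]
  replace hm : H ((Item.par _ w).map g) (m.map e) := hm
  rw [hgpar] at hm
  have hw : Orbit S z (g w) := (g3 _).1 ⟨w, rfl⟩
  generalize g w = w at hw hm
  generalize m.map e = x at hm
  rcases hm with ⟨hB, hc⟩ | ⟨rfl, v, hv, hvS⟩
  · by_cases hwS : S w
    -- If a node `c` on the path simulates `w`, its parent simulates the parent of `w`, so `x` lies
    -- on the path too. Simulation preserves depth, and the path has one node of each depth, so `x`
    -- is the parent of `c`.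
    · by_cases hcw : ∃ c, Anc c p ∧ Sim S c (some w)
      · obtain ⟨c, hcp, hcw⟩ := hcw
        obtain ⟨hcn, -, h1, -⟩ := isSim_sim S _ _ hcw
        rcases h1 with ⟨-, h⟩ | ⟨i, j, rfl, hj, hl, hB'⟩
        · cases h
        · obtain rfl := Option.some.inj hj
          have hx := hc ⟨_, hcp.par, hB'⟩
          have hd := (sim_depth hB').trans (sim_depth hB).symm
          refine ⟨i, .inl hcn, ?_, hl, .inl ⟨hcw, fun _ => hcp⟩⟩
          exact anc_unique hcp.par hx hd
      · obtain ⟨-, -, -, h2⟩ := isSim_sim S _ _ hB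
        obtain ⟨i, hi, hx, hiw⟩ := h2 w hwS rfl
        obtain ⟨-, -, h1, -⟩ := isSim_sim S _ _ hiw
        rcases h1 with ⟨-, h⟩ | ⟨i', j, hi', hj, hl, -⟩
        · cases h
        · obtain rfl := Option.some.inj hj
          obtain rfl := Option.some.inj hi'
          exact ⟨i, .inl hi, hx, hl, .inl ⟨hiw, fun h => absurd h hcw⟩⟩
    -- For a new item `w` the node `p` simulates its parent, so `x` is on the path and has the depth
    -- of `p`: it is `p`.
    · obtain ⟨hl, hw⟩ := hw.resolve_left hwS
      have hx := hc ⟨p, .refl p, hw⟩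
      have hd := (sim_depth hw).trans (sim_depth hB).symm
      exact ⟨z, .inr rfl, anc_unique (.refl p) hx hd, hl.symm, .inr ⟨rfl, w, rfl, hwS⟩⟩
  -- New items are leaves of the orbit: the parent of any of its items is the root or in `S`.
  · have h1 := orbit_parentClosed hS z
    rcases hw with hw | ⟨-, hw⟩
    · exact absurd (hS _ _ hv hw) hvS
    · have := (isSim_sim S _ _ hw).2.1
      rw [hv] at this
      exact absurd this hvS

end EL

namespace EL

/-! ### Correctness of `climb` -/

theorem mem_extend_iff {R : Concept} {P : List (List Bool)} {z i : Item R} :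
    pth R [] i ∈ extend (items R) P (entry R [] [] z) ↔
      Orbit (fun i => pth R [] i ∈ P) z i := by
  simp only [extend, List.mem_append, List.mem_map, List.mem_filter, mem_items,
    Bool.and_eq_true, Bool.not_eq_true', eqb_iff, memb_iff, Orbit]
  constructor
  · rintro (h | ⟨_, ⟨⟨j, rfl⟩, ⟨-, hl⟩, hB⟩, hj⟩)
    · exact .inl h
    · obtain rfl := pth_injective R [] hj
      exact .inr ⟨hl, mem_simRel_iff.1 hB⟩
  · rintro (h | ⟨hl, hB⟩)
    · exact .inl h
    · by_cases h : pth R [] i ∈ P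
      · exact .inl h
      · refine .inr ⟨_, ⟨⟨i, rfl⟩, ⟨?_, hl⟩, mem_simRel_iff.2 hB⟩, rfl⟩
        rw [← Bool.not_eq_true, memb_iff]
        exact h

/-- The set of items whose positions are computed by `climb`. -/
def climbSet (O : List Ax) (α : Ax) (C R : Concept) (i : Item R) : Prop :=
  pth R [] i ∈ climb O α C R

theorem weakenRhs_eq (O : List Ax) (α : Ax) (C R : Concept) :
    weakenRhs O α C R = .gci C (restrict R (climbSet O α C R)) := by
  rw [weakenRhs, restr_eq_restrict]
  rfl

theorem entails_mono_rhs {O : List Ax} {α : Ax} {C D E : Concept} (h : Subsumed D E)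
    (hE : Entails (ontology (.gci C E :: O)) α) : Entails (ontology (.gci C D :: O)) α := by
  intro I hI
  refine hE I fun γ hγ => ?_
  rcases List.mem_cons.1 hγ with rfl | hγ
  · exact (hI (.gci C D) List.mem_cons_self).trans (subsumed_iff.1 h I)
  · exact hI γ (List.mem_cons_of_mem _ hγ)

/-- The first three properties are the loop invariant. At the fixed point every admissible orbit
makes `α` follow, and by `subsumed_orbit` the single item `z` already does. -/
theorem climb_spec {O : List Ax} {α : Ax} (hO : ¬ Entails (ontology O) α) (C R : Concept) :
    (ParentClosed (climbSet O α C R) ∧ Rigid (climbSet O α C R) ∧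
      ¬ Entails (ontology (.gci C (restrict R (climbSet O α C R)) :: O)) α) ∧
    ∀ z, ¬ climbSet O α C R z → IsNode (climbSet O α C R) (Item.par R z) →
      Entails (ontology (.gci C (restrict R fun i => climbSet O α C R i ∨ i = z) :: O)) α := by
  let S : List (List Bool) → Item R → Prop := fun P i => pth R [] i ∈ P
  have hext : ∀ P z, restr (extend (items R) P (entry R [] [] z)) [] R =
      restrict R (Orbit (S P) z) := by
    intro P z
    rw [restr_eq_restrict]
    exact congrArg _ (funext fun i => propext mem_extend_iff)
  let Q : List (List Bool) → Item R → Prop := fun P z => ¬ S P z ∧ IsNode (S P) (Item.par R z) ∧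
    ¬ Entails (ontology (.gci C (restrict R (Orbit (S P) z)) :: O)) α
  have htest : ∀ P z, (!memb (entry R [] [] z).1 P && memb (entry R [] [] z).2.1 (nodeIds P) &&
      !entailsb (.gci C (restr (extend (items R) P (entry R [] [] z)) [] R) :: O) α) = true ↔
      Q P z := by
    intro P z
    rw [hext]
    simp only [Bool.and_eq_true, Bool.not_eq_true', ← Bool.not_eq_true, memb_iff, entailsb_iff,
      and_assoc]
    exact and_congr_right' (and_congr_left' mem_nodeIds_iff)
  have hstep : ∀ P, (climbStep O α C R P = P ∧ ∀ z, ¬ Q P z) ∨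
      ∃ z, climbStep O α C R P = extend (items R) P (entry R [] [] z) ∧ Q P z := by
    intro P
    cases h : (items R).find? fun z => !memb z.1 P && memb z.2.1 (nodeIds P) &&
        !entailsb (.gci C (restr (extend (items R) P z) [] R) :: O) α with
    | none =>
      left
      refine ⟨by rw [climbStep, h]; rfl, fun z hz => ?_⟩
      exact List.find?_eq_none.1 h _ (mem_items.2 ⟨z, rfl⟩) ((htest P z).2 hz)
    | some e =>
      right
      obtain ⟨z, rfl⟩ := mem_items.1 (List.mem_of_find?_eq_some h)
      have h1 := List.find?_some h
      exact ⟨z, by rw [climbStep, h]; rfl, (htest P z).1 h1⟩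
  have hSext : ∀ P z, S (extend (items R) P (entry R [] [] z)) = Orbit (S P) z := fun P z =>
    funext fun i => propext mem_extend_iff
  obtain ⟨h1, h2⟩ := iterate_fixed (f := climbStep O α C R)
    (fun P => ParentClosed (S P) ∧ Rigid (S P) ∧
      ¬ Entails (ontology (.gci C (restrict R (S P)) :: O)) α)
    (fun P => {i | S P i}.ncard) (items R).length
    (by
      rintro P ⟨h1, h2, h3⟩
      rcases hstep P with ⟨h, -⟩ | ⟨z, h, -, hz, hα⟩
      · rw [h]; exact ⟨h1, h2, h3⟩
      · rw [h, hSext]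
        exact ⟨orbit_parentClosed h1 z, orbit_rigid h1 h2 z, hα⟩)
    (by
      rintro P ⟨h1, -, -⟩
      rcases hstep P with ⟨h, -⟩ | ⟨z, h, hzS, hz, -⟩
      · exact .inl h
      · right
        rw [h]
        refine Set.ncard_lt_ncard ?_ (Set.toFinite _)
        rw [hSext]
        exact Set.ssubset_iff_of_subset (fun i hi => .inl hi) |>.2
          ⟨z, orbit_self h1 hz, hzS⟩)
    (fun P _ => (Set.ncard_le_card _).trans (card_item_le R)) (s := [])
    (by
      -- The restriction to the empty set is equivalent to `⊤`, so its GCI is a tautology and `α`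
      -- would follow from `O` alone.
      have h0 : ∀ i, ¬ S [] i := fun i => List.not_mem_nil
      refine ⟨fun i _ _ hi => absurd hi (h0 i), fun _ _ i hi => absurd hi (h0 i), fun h => hO ?_⟩
      intro I hI
      refine h I fun γ hγ => ?_
      rcases List.mem_cons.1 hγ with rfl | hγ
      · obtain ⟨e, -, -, he⟩ := exists_restrict_map R (S []) fun i _ _ hi => absurd hi (h0 i)
        have hemb : Embeds (restrict R (S [])) .top :=
          ⟨fun x => absurd ((he _).1 ⟨x, rfl⟩) (h0 _),
            ⟨fun x => absurd ((he _).1 ⟨x, rfl⟩) (h0 _),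
              fun x => absurd ((he _).1 ⟨x, rfl⟩) (h0 _)⟩,
            fun x => absurd ((he _).1 ⟨x, rfl⟩) (h0 _)⟩
        exact (Set.subset_univ _).trans (subsumed_iff.1 hemb.subsumed I)
      · exact hI γ hγ)
  refine ⟨h2, fun z hzS hz => ?_⟩
  rcases hstep (climb O α C R) with ⟨-, h⟩ | ⟨y, h, hyS, hy, -⟩
  · have h3 := h z
    simp only [Q, not_and, not_not] at h3
    exact entails_mono_rhs (subsumed_orbit h2.1 hz) (h3 hzS hz)
  · have h4 : climbStep O α C R (climb O α C R) = climb O α C R := h1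
    rw [h4] at h
    have h5 := orbit_self h2.1 hy
    change Orbit (S (climb O α C R)) y y at h5
    rw [← hSext, ← h] at h5
    exact absurd h5 hyS

end EL

namespace EL

/-! ### Maximally strong weakenings -/

theorem ontology_weaken (os j : List Ax) (β γ : Ax) :
    ontology (γ :: (os ++ j.filter fun y => !eqb y β)) =
      ontology os ∪ (ontology j \ {β}) ∪ {γ} := by
  ext δ
  simp only [ontology, List.mem_cons, List.mem_append, List.mem_filter, Bool.not_eq_true',
    eqb_false_iff, Set.mem_ofPred_eq, Set.mem_union, Set.mem_sdiff, Set.mem_singleton_iff]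
  tauto

theorem entails_of_entails {O : List Ax} {α β γ : Ax} (h : Entails {γ} β)
    (hβ : Entails (ontology (β :: O)) α) : Entails (ontology (γ :: O)) α := by
  intro I hI
  refine hβ I fun δ hδ => ?_
  rcases List.mem_cons.1 hδ with rfl | hδ
  · refine h I fun ε hε => ?_
    rw [Set.mem_singleton_iff.1 hε]
    exact hI γ List.mem_cons_self
  · exact hI δ (List.mem_cons_of_mem _ hδ)

theorem entails_gci_of_subsumed {C D E : Concept} (h : Subsumed D E) :
    Entails {.gci C D} (.gci C E) := fun I hI =>
  (hI (.gci C D) rfl).trans (subsumed_iff.1 h I)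

/-- An embedding of a proper superset of `S` yields an item that can be added to `S`. -/
theorem exists_insert {R X : Concept} {S : Item R → Prop} (hS : ParentClosed S)
    {f : Item X → Item R} (hf : IsRootHom X R f) (hfi : f.Injective)
    (hsub : ∀ i, S i → ∃ x, f x = i) (hne : ¬ ∀ x, S (f x)) :
    ∃ z, ¬ S z ∧ IsNode S (Item.par R z) ∧
      Subsumed X (restrict R fun i => S i ∨ i = z) := by
  -- Going up from an item mapped outside `S` reaches one that is a root or whose parent is mapped
  -- into `S`.
  have key : ∀ n x, Item.depth X x = n → ¬ S (f x) →
      ∃ x, ¬ S (f x) ∧ IsNode S (Item.par R (f x)) := by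
    intro n
    induction n with
    | zero =>
      intro x hx hxS
      refine ⟨x, hxS, ?_⟩
      rw [hf.par]
      cases h : Item.par X x with
      | none => trivial
      | some y => rw [Item.depth_par, h] at hx; cases hx
    | succ n ih =>
      intro x hx hxS
      cases h : Item.par X x with
      | none => rw [Item.depth_par, h] at hx; cases hx
      | some y =>
        by_cases hy : S (f y)
        · refine ⟨x, hxS, ?_⟩
          rw [hf.par, h]
          exact hy
        · rw [Item.depth_par, h] at hx
          exact ih y (Nat.succ.inj hx) hy
  rw [not_forall] at hne
  obtain ⟨x, hx⟩ := hne
  obtain ⟨x, hxS, hxn⟩ := key _ x rfl hx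
  refine ⟨f x, hxS, hxn, ?_⟩
  obtain ⟨e, e1, -, e3⟩ := exists_restrict_map R _ (insert_parentClosed hS hxn)
  obtain ⟨g, hg, -⟩ := e1.factor hf hfi fun y => by
    rcases (e3 (e y)).1 ⟨y, rfl⟩ with h | h
    · exact hsub _ h
    · exact ⟨x, h.symm⟩
  exact hg.subsumed

/-- The embeddings of a restriction to a closed set are onto that set. -/
theorem Rigid.range_eq {R : Concept} {S : Item R → Prop} (hS : ParentClosed S) (hR : Rigid S)
    {f : Item (restrict R S) → Item R} (hf : IsRootHom (restrict R S) R f) (hfi : f.Injective)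
    (i : Item R) (hi : S i) : ∃ x, f x = i := by
  obtain ⟨e, e1, e2, e3⟩ := exists_restrict_map R S hS
  -- `f`, transported along `e` to a self-map of the items of `R`; the values outside `S` play no
  -- role in `EmbedsOn`.
  have hext : ∀ x, Function.extend e f id (e x) = f x := e2.extend_apply f id
  have hemb : EmbedsOn S (Function.extend e f id) := by
    refine ⟨fun i j hi hj h => ?_, fun i hi => ?_, fun i hi => ?_⟩
    · obtain ⟨x, rfl⟩ := (e3 i).2 hi
      obtain ⟨y, rfl⟩ := (e3 j).2 hj
      rw [hext, hext] at h
      rw [hfi h]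
    · obtain ⟨x, rfl⟩ := (e3 i).2 hi
      rw [hext, hf.lab, e1.lab]
    · obtain ⟨x, rfl⟩ := (e3 i).2 hi
      rw [hext, hf.par, e1.par]
      cases Item.par _ x with
      | none => rfl
      | some y => exact congrArg some (hext y).symm
  obtain ⟨k, hk, rfl⟩ := exists_preimage hemb (hR _ hemb) hi
  obtain ⟨x, rfl⟩ := (e3 k).2 hk
  exact ⟨x, (hext x).symm⟩

theorem weaken_spec {os j : List Ax} {α : Ax} {C D : Concept}
    (hj : Entails (ontology os ∪ ontology j) α)
    (hmin : ¬ Entails (ontology os ∪ (ontology j \ {.gci C D})) α)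
    (hβ : .gci C D ∈ ontology j) :
    IsMaxStrongWeakening SynWeaker (ontology os) (ontology j) α (.gci C D)
      (weaken (os, j, α, .gci C D)) := by
  let O : List Ax := os ++ j.filter fun y => !eqb y (.gci C D)
  let R := reduce D
  have hO : ontology O = ontology os ∪ (ontology j \ {.gci C D}) := by
    ext δ
    simp only [O, ontology, List.mem_append, List.mem_filter, Bool.not_eq_true',
      eqb_false_iff, Set.mem_ofPred_eq, Set.mem_union, Set.mem_sdiff, Set.mem_singleton_iff]
  have hβO : Entails (ontology (.gci C D :: O)) α := by
    rw [ontology_weaken, Set.union_assoc, Set.sdiff_union_of_subset]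
    · exact hj
    · exact Set.singleton_subset_iff.2 hβ
  obtain ⟨hR1, hR2, hR3⟩ := reduce_spec D
  obtain ⟨⟨h1, h2, h3⟩, h4⟩ := climb_spec (hO ▸ hmin) C R
  have hw : weaken (os, j, α, .gci C D) = .gci C (restrict R (climbSet O α C R)) :=
    weakenRhs_eq O α C R
  rw [hw]
  -- A weakening that entails the original axiom would restore `α`.
  have hne : ¬ Entails {.gci C (restrict R (climbSet O α C R))} (.gci C D) := fun h =>
    h3 (entails_of_entails h hβO)
  refine ⟨⟨rfl, synGen_of_embeds hR3 hR1 hR2 (repl_restrict R _).embeds fun h =>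
    hne (entails_gci_of_subsumed h), hne⟩, ?_, ?_⟩
  · rw [← ontology_weaken]
    exact h3
  · rintro (⟨C', E⟩ | _ | _) hβδ hδγ
    · obtain ⟨rfl, hDE, -⟩ := hβδ
      obtain ⟨-, hEP, hEne⟩ := hδγ
      rw [← ontology_weaken]
      -- `f` embeds the intermediate concept `E` into `R`, and `g` embeds the result into `E`. By
      -- rigidity the range of the composite contains the computed set itself, hence so does the
      -- range of `f`.
      obtain ⟨f, hf, hfi⟩ := synGen_embeds hDE hR1 hR2
      obtain ⟨g, hg, hgi⟩ := synGen_embeds_self hEP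
      have hsub : ∀ i, climbSet O α C R i → ∃ x, f x = i := fun i hi => by
        obtain ⟨x, hx⟩ := Rigid.range_eq h1 h2 (hf.comp hg) (hfi.comp hgi) i hi
        exact ⟨g x, hx⟩
      -- If `f` stays inside the computed set, the result is subsumed by `E`, contradicting that it
      -- is strictly weaker. Otherwise `E` contains the set and one adjacent item, and `α` follows.
      by_cases hne : ∀ x, climbSet O α C R (f x)
      · obtain ⟨e, e1, e2, e3⟩ := exists_restrict_map R _ h1
        obtain ⟨k, hk, -⟩ := hf.factor e1 e2 fun x => (e3 _).2 (hne x)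
        exact absurd (entails_gci_of_subsumed hk.subsumed) hEne
      · obtain ⟨z, hz, hzn, hE⟩ := exists_insert h1 hf hfi hsub hne
        exact entails_mono_rhs hE (h4 z hz hzn)
    · exact hβδ.elim
    · exact hβδ.elim

end EL

theorem mainTheorem10 :
    ∃ (prog : While.Cmd) (p : Polynomial ℕ),
      ∀ (os orf j : List EL.Ax) (α : EL.Ax) (C D : EL.Concept),
        EL.IsJustification (EL.ontology os) (EL.ontology orf) α (EL.ontology j) →
        EL.Ax.gci C D ∈ EL.ontology j →
        ∃ (γ : EL.Ax) (t : ℕ),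
          EL.IsMaxStrongWeakening EL.SynWeaker (EL.ontology os) (EL.ontology j) α
            (EL.Ax.gci C D) γ ∧
          While.Outputs prog (EL.encInput os j α (EL.Ax.gci C D)) γ.enc t ∧
          t ≤ p.eval (EL.encInput os j α (EL.Ax.gci C D)).size := by
  obtain ⟨c, p, hc⟩ := EL.PolyTime.weaken
  refine ⟨c 0, p, fun os orf j α C D hJ hβ => ?_⟩
  obtain ⟨t, τ, h1, h2, -, h3⟩ := hc 0 (While.initStore (EL.encInput os j α (.gci C D)))
    (os, j, α, .gci C D) rfl
  refine ⟨_, t, EL.weaken_spec hJ.2.1 (hJ.2.2 _ ?_) hβ, ⟨τ, h1, h2⟩, h3⟩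
  -- Minimality of the justification is needed only for the removal of the axiom to be weakened.
  exact Set.sdiff_singleton_ssubset.2 hβ
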